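/- Let $k$ be an algebraically closed field and let $X$ be a scheme of finite type over $k$, or let $k=\mathbb C$ and let $X$ be a complex space. Let $D$ be an effective Cartier divisor on $X$, let $\mathcal E$ be a vector bundle on $X$ and let $\nabla:\mathcal E\to\mathcal E\otimes\Omega^1_X(D)$ be an integrable connection, i.e. $\nabla^2=0$ in $\mathcal E\otimes\Omega^2_X(*D)$, where $\Omega^q_X(*D)=\varinjlim_n\Omega^q_X(nD)$. Put $V_n=\operatorname{Spec}k[\epsilon]/(\epsilon^{n+1})$. A connection on a vector bundle $\mathcal E_n$ over $X\times V_n$ with fixed divisor of poles $D$ is a $k[\epsilon]$-linear map $\nabla_n:\mathcal E_n\to\mathcal E_n\otimes\Omega^1_X(D)$ satisfying the Leibniz rule. Let $\mathcal R^\bullet$ be the complex $$\mathcal R^\bullet=\bigl[\mathcal End(\mathcal E)\to\mathcal End(\mathcal E)\otimes\Omega^1_X(D)\to\mathcal End(\mathcal E)\otimes\Omega^2_X(*D)\to\mathcal End(\mathcal E)\otimes\Omega^3_X(*D)\to\cdots\bigr]$$ whose differential $d$ is induced by $\nabla$, and let $\mathbb H^i(\mathcal R^\bullet)$ be its Čech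 hypercohomology, i.e. the direct limit over the open coverings $\mathfrak U=(U_i)$ of $X$ of the cohomology of the total complex of $\check C^p(\mathfrak U,\mathcal R^q)$ with differential $\check\delta+(-1)^p d$. The Yoneda product $\mathbb H^1(\mathcal R^\bullet)\times\mathbb H^1(\mathcal R^\bullet)\to\mathbb H^2(\mathcal R^\bullet)$ is the product induced by composition of endomorphisms and wedge product of forms: $$[(a,A)]\circ[(b,B)]=\bigl[\bigl(a_{ij}b_{jk},\ a_{ij}B_j-A_ib_{ij},\ A_i\wedge B_i\bigr)\bigr].$$ Let $(\mathcal E_1,\nabla_1)$ be a first-order deformation of $(\mathcal E,\nabla)$: an integrable connection over $X\times V_1$ with fixed divisor of poles $D$ together with an isomorphism of its restriction to $X$ with $(\mathcal E,\nabla)$. Suppose that it is defined by the cocycle $((a_{ij}),(A_i))$ of total degree $1$ on a covering $\mathfrak U$ with values in $\mathcal R^\bullet$, that is, there are isomorphisms $\mathcal E|_{U_i}\otimes_k k[\epsilon]/(\epsilon^2)\simeq\mathcal E_1|_{U_i}$, equal to the identity modulo $\epsilon$, in which $\nabla_1$ is $\nabla+\epsilon A_i$ and the transition maps on $U_i\cap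 U_j$ are $1+\epsilon a_{ij}$. Then $(\mathcal E_1,\nabla_1)$ extends to an integrable connection $(\mathcal E_2,\nabla_2)$ over $X\times V_2$ with the same fixed divisor of poles $D$ (one whose restriction to $X\times V_1$ is isomorphic to $(\mathcal E_1,\nabla_1)$) if and only if the Yoneda square $[(a,A)]\circ[(a,A)]$ of its class vanishes in $\mathbb H^2(\mathcal R^\bullet)$. -/

import Mathlib

open scoped KaehlerDifferential TensorProduct

universe u

noncomputable section

set_option linter.unusedSectionVars false

namespace DeRham

section Exterior
variable (k B : Type u) [Field k] [CommRing B] [Algebra k B]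

/-- The exterior algebra of the module of Kähler differentials. -/
abbrev Forms : Type u := ExteriorAlgebra B (Ω[B⁄k])

/-- The exact one-form `d b`. -/
def exactForm (b : B) : Forms k B := ExteriorAlgebra.ι B (KaehlerDifferential.D k B b)

/-- The grading involution: multiplication by `(-1)^q` on `q`-forms. -/
def parity : Forms k B →ₐ[B] Forms k B := ExteriorAlgebra.map (-LinearMap.id)

theorem parity_ι (w : Ω[B⁄k]) :
    parity k B (ExteriorAlgebra.ι B w) = -ExteriorAlgebra.ι B w := by
  simp [parity]

theorem ι_mul_comm (w : Ω[B⁄k]) (x : Forms k B) :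
    ExteriorAlgebra.ι B w * x = parity k B x * ExteriorAlgebra.ι B w := by
  induction x using ExteriorAlgebra.induction with
  | algebraMap r => simp [Algebra.commutes]
  | ι v =>
    rw [parity_ι, neg_mul, eq_neg_iff_add_eq_zero]
    exact ExteriorAlgebra.ι_add_mul_swap w v
  | mul a b ha hb => rw [← mul_assoc, ha, mul_assoc, hb, map_mul, mul_assoc]
  | add a b ha hb => rw [mul_add, ha, hb, map_add, add_mul]

/-- Auxiliary algebra of upper triangular matrices, used to construct the exterior derivative. -/
def triangular : Subalgebra k (Matrix (Fin 2) (Fin 2) (Forms k B)) where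
  carrier := {M | M 1 0 = 0 ∧ M 0 0 = parity k B (M 1 1)}
  mul_mem' := by
    rintro M N ⟨h1, h2⟩ ⟨h3, h4⟩
    simp [Matrix.mul_apply, Fin.sum_univ_two, h1, h2, h3, h4]
  add_mem' := by
    rintro M N ⟨h1, h2⟩ ⟨h3, h4⟩
    simp [h1, h2, h3, h4]
  algebraMap_mem' := by
    intro c
    have : parity k B (algebraMap k (Forms k B) c) = algebraMap k (Forms k B) c := by
      rw [IsScalarTower.algebraMap_apply k B, AlgHom.commutes]
    simp [Matrix.algebraMap_matrix_apply, this]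

variable {k B} in
theorem triangular_ext {M N : triangular k B} (h0 : M.1 0 1 = N.1 0 1)
    (h1 : M.1 1 1 = N.1 1 1) : M = N := by
  apply Subtype.ext
  ext i j
  fin_cases i <;> fin_cases j
  · simpa [M.2.2, N.2.2] using congrArg (parity k B) h1
  · exact h0
  · simpa using M.2.1.trans N.2.1.symm
  · exact h1

/-- The scalars of `B` acting on the auxiliary algebra through `b + d b`. -/
def triangularScalar : B →+* triangular k B where
  toFun b := ⟨!![algebraMap B _ b, exactForm k B b; 0, algebraMap B _ b], by
    constructor <;> simp⟩
  map_one' := by apply triangular_ext <;> simp [exactForm]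
  map_zero' := by apply triangular_ext <;> simp [exactForm]
  map_add' a b := by apply triangular_ext <;> simp [exactForm]
  map_mul' a b := by
    apply triangular_ext
    · simp only [Subalgebra.coe_mul, Matrix.mul_apply, Fin.sum_univ_two]
      simp [exactForm, Algebra.smul_def, Algebra.commutes b]
    · simp [Matrix.mul_apply, Fin.sum_univ_two]

instance : Algebra B (triangular k B) :=
  (triangularScalar k B).toAlgebra' fun b M => by
    apply triangular_ext
    · change ((triangularScalar k B b).1 * M.1) 0 1 = (M.1 * (triangularScalar k B b).1) 0 1
      simp [triangularScalar, Matrix.mul_apply, Fin.sum_univ_two, M.2.2, exactForm, ι_mul_comm,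
        Algebra.commutes, add_comm]
    · change ((triangularScalar k B b).1 * M.1) 1 1 = (M.1 * (triangularScalar k B b).1) 1 1
      simp [triangularScalar, Matrix.mul_apply, Fin.sum_univ_two, M.2.1, Algebra.commutes]

theorem triangular_algebraMap (b : B) :
    algebraMap B (triangular k B) b = triangularScalar k B b := rfl

instance : IsScalarTower k B (triangular k B) := IsScalarTower.of_algebraMap_eq fun c => by
  apply triangular_ext
  · simp [triangular_algebraMap, triangularScalar, exactForm, Matrix.algebraMap_matrix_apply]
  · simp [triangular_algebraMap, triangularScalar, Matrix.algebraMap_matrix_apply,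
      IsScalarTower.algebraMap_apply k B (Forms k B)]

/-- The derivation `b ↦ d b` with values in the auxiliary algebra. -/
def triangularD : Derivation k B (triangular k B) where
  toFun b := ⟨!![-exactForm k B b, 0; 0, exactForm k B b], by
    constructor <;> simp [exactForm, parity_ι]⟩
  map_add' a b := by apply triangular_ext <;> simp [exactForm]
  map_smul' c b := by apply triangular_ext <;> simp [exactForm]
  map_one_eq_zero' := by apply triangular_ext <;> simp [exactForm]
  leibniz' a b := by
    apply triangular_ext
    · simp only [Algebra.smul_def, triangular_algebraMap, triangularScalar, Subalgebra.coe_add,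
        Subalgebra.coe_mul, Matrix.mul_apply, Fin.sum_univ_two, Matrix.add_apply]
      simp [exactForm, add_comm, ExteriorAlgebra.ι_add_mul_swap]
    · simp only [Algebra.smul_def, triangular_algebraMap, triangularScalar, Subalgebra.coe_add,
        Subalgebra.coe_mul, Matrix.mul_apply, Fin.sum_univ_two, Matrix.add_apply]
      simp [exactForm, Algebra.smul_def]

/-- The lower right entry. -/
def triangularFst : triangular k B →ₐ[B] Forms k B where
  toFun M := M.1 1 1
  map_one' := by simp
  map_zero' := by simp
  map_add' M N := by simp
  map_mul' M N := by simp [Matrix.mul_apply, Fin.sum_univ_two, M.2.1]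
  commutes' b := by simp [triangular_algebraMap, triangularScalar]

theorem triangularD_fst (w : Ω[B⁄k]) :
    ((triangularD k B).liftKaehlerDifferential w).1 1 1 = ExteriorAlgebra.ι B w := by
  have : (triangularFst k B).toLinearMap.comp (triangularD k B).liftKaehlerDifferential
      = ExteriorAlgebra.ι B := by
    apply Derivation.liftKaehlerDifferential_unique
    ext b
    change (((triangularD k B).liftKaehlerDifferential (KaehlerDifferential.D k B b))).1 1 1 = _
    simp [triangularD, exactForm]
  exact DFunLike.congr_fun this w

theorem triangularD_even (w : Ω[B⁄k]) :
    parity k B (((triangularD k B).liftKaehlerDifferential w).1 0 1)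
      = ((triangularD k B).liftKaehlerDifferential w).1 0 1 := by
  have hw : w ∈ Submodule.span B (Set.range (KaehlerDifferential.D k B)) := by
    rw [KaehlerDifferential.span_range_derivation]; trivial
  induction hw using Submodule.span_induction with
  | mem x hx =>
    obtain ⟨b, rfl⟩ := hx
    simp [triangularD]
  | zero => simp
  | add x y _ _ hx hy => simp [hx, hy]
  | smul b x _ hx =>
    rw [map_smul, Algebra.smul_def, triangular_algebraMap]
    simp [triangularScalar, Matrix.mul_apply, Fin.sum_univ_two, triangularD_fst, hx, exactForm,
      parity_ι]

theorem triangularD_sq (w : Ω[B⁄k]) :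
    (triangularD k B).liftKaehlerDifferential w * (triangularD k B).liftKaehlerDifferential w
      = 0 := by
  apply triangular_ext
  · have h := ((triangularD k B).liftKaehlerDifferential w).2.2
    rw [triangularD_fst, parity_ι] at h
    simp only [Subalgebra.coe_mul, Matrix.mul_apply, Fin.sum_univ_two, h, triangularD_fst]
    simp [ι_mul_comm, triangularD_even]
  · simp [Matrix.mul_apply, Fin.sum_univ_two, triangularD_fst,
      ((triangularD k B).liftKaehlerDifferential w).2.1]

/-- The algebra homomorphism `w ↦ (w, d w)` -/
def triangularLift : Forms k B →ₐ[B] triangular k B :=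
  ExteriorAlgebra.lift B ⟨(triangularD k B).liftKaehlerDifferential, triangularD_sq k B⟩

theorem triangularLift_fst (x : Forms k B) : (triangularLift k B x).1 1 1 = x := by
  have : (triangularFst k B).comp (triangularLift k B) = AlgHom.id B _ := by
    apply ExteriorAlgebra.hom_ext
    refine LinearMap.ext fun w => ?_
    change ((triangularLift k B (ExteriorAlgebra.ι B w))).1 1 1 = _
    simp [triangularLift, triangularD_fst]
  exact DFunLike.congr_fun this x

/-- The exterior derivative on the algebraic differential forms of `B` over `k`. -/
def extDerivative : Forms k B →+ Forms k B where
  toFun x := (triangularLift k B x).1 0 1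
  map_zero' := by simp
  map_add' x y := by simp

theorem extDerivative_mul (x y : Forms k B) :
    extDerivative k B (x * y) = extDerivative k B x * y + parity k B x * extDerivative k B y := by
  have h := (triangularLift k B x).2.2
  simp only [triangularLift_fst] at h
  simp [extDerivative, Matrix.mul_apply, Fin.sum_univ_two, h, triangularLift_fst, add_comm]

theorem extDerivative_algebraMap (b : B) :
    extDerivative k B (algebraMap B _ b) = exactForm k B b := by
  simp [extDerivative, triangular_algebraMap, triangularScalar]

theorem extDerivative_exactForm (b : B) : extDerivative k B (exactForm k B b) = 0 := by
  simp [extDerivative, exactForm, triangularLift, triangularD]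

theorem parity_extDerivative_ι (w : Ω[B⁄k]) :
    parity k B (extDerivative k B (ExteriorAlgebra.ι B w))
      = extDerivative k B (ExteriorAlgebra.ι B w) := by
  simpa [extDerivative, triangularLift] using triangularD_even k B w

theorem extDerivative_extDerivative_ι (w : Ω[B⁄k]) :
    extDerivative k B (extDerivative k B (ExteriorAlgebra.ι B w)) = 0 := by
  have hw : w ∈ Submodule.span B (Set.range (KaehlerDifferential.D k B)) := by
    rw [KaehlerDifferential.span_range_derivation]; trivial
  induction hw using Submodule.span_induction with
  | mem x hx =>
    obtain ⟨b, rfl⟩ := hx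
    have := extDerivative_exactForm k B b
    rw [exactForm] at this
    rw [this, map_zero]
  | zero => simp
  | add x y _ _ hx hy => simp [hx, hy]
  | smul b x _ hx =>
    rw [map_smul, Algebra.smul_def, extDerivative_mul, extDerivative_algebraMap, map_add,
      extDerivative_mul, extDerivative_exactForm, AlgHom.commutes, extDerivative_mul,
      extDerivative_algebraMap, hx, exactForm, parity_ι]
    simp

end Exterior


section Local
variable (k : Type u) [Field k] {A : Type u} [CommRing A] [IsLocalRing A] [Algebra k A]
  (I : Ideal A)

/-- The elements generating a power of the ideal `I`; for `I = (f)` with `f` regular these are the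
elements `u f ^ n` with `u` a unit. -/
def equations : Submonoid A where
  carrier := {s | ∃ n : ℕ, Ideal.span {s} = I ^ n}
  one_mem' := ⟨0, by simp⟩
  mul_mem' := by
    rintro a b ⟨m, hm⟩ ⟨n, hn⟩
    exact ⟨m + n, by rw [pow_add, ← hm, ← hn, Ideal.span_singleton_mul_span_singleton]⟩

/-- The ring `A[1/f]` for `I = (f)`: the stalk of the sheaf `𝒪(*D)`. -/
abbrev Polar : Type u := Localization (equations I)

/-- The stalk of the invertible sheaf `𝒪(D)`: the elements `b` of `A[1/f]` with `b I ⊆ A`. -/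
def lineBundle : Submodule A (Polar I) where
  carrier := {b | ∀ i ∈ I, ∃ a : A, algebraMap A (Polar I) a = algebraMap A (Polar I) i * b}
  zero_mem' := fun i _ => ⟨0, by simp⟩
  add_mem' := by
    intro b c hb hc i hi
    obtain ⟨x, hx⟩ := hb i hi
    obtain ⟨y, hy⟩ := hc i hi
    exact ⟨x + y, by rw [map_add, hx, hy, mul_add]⟩
  smul_mem' := by
    intro r b hb i hi
    obtain ⟨x, hx⟩ := hb i hi
    exact ⟨r * x, by rw [map_mul, hx, Algebra.smul_def]; ring⟩

theorem one_mem_lineBundle : (1 : Polar I) ∈ lineBundle I := fun i _ => ⟨i, by simp⟩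

variable (A) in
/-- The Kähler differentials that lie in `𝔪 ^ n Ω` for every `n`. -/
def infinitesimals : Submodule A (Ω[A⁄k]) :=
  ⨅ n : ℕ, (IsLocalRing.maximalIdeal A ^ n) • (⊤ : Submodule A (Ω[A⁄k]))

variable (A) in
/-- The stalk of the sheaf of differential one-forms. -/
abbrev OneForms : Type u := Ω[A⁄k] ⧸ infinitesimals k A

/-- The stalk of `Ω¹(D) = 𝒪(D) ⊗ Ω¹`. -/
abbrev PoleForms : Type u := TensorProduct A (lineBundle I) (OneForms k A)

/-- The differential `𝒪 → Ω¹ → Ω¹(D)`. -/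
def poleD (f : A) : PoleForms k I :=
  TensorProduct.tmul A (⟨1, one_mem_lineBundle I⟩ : lineBundle I)
    (Submodule.Quotient.mk (KaehlerDifferential.D k A f))

/-- The differential ideal of `⋀ Ω` over `A[1/f]` generated by the infinitesimal one-forms. -/
def infinitesimalIdeal : TwoSidedIdeal (Forms k (Polar I)) :=
  TwoSidedIdeal.span {x | ∃ w ∈ infinitesimals k A,
    x = ExteriorAlgebra.ι (Polar I) (KaehlerDifferential.map k k A (Polar I) w) ∨
    x = extDerivative k (Polar I)
      (ExteriorAlgebra.ι (Polar I) (KaehlerDifferential.map k k A (Polar I) w))}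

theorem parity_mem (x : Forms k (Polar I)) (hx : x ∈ infinitesimalIdeal k I) :
    parity k (Polar I) x ∈ infinitesimalIdeal k I := by
  refine TwoSidedIdeal.span_induction
    (p := fun x _ => parity k (Polar I) x ∈ infinitesimalIdeal k I) ?_ ?_ ?_ ?_ ?_ ?_ hx
  · rintro _ ⟨w, hw, rfl | rfl⟩
    · rw [parity_ι]
      exact TwoSidedIdeal.neg_mem _ (TwoSidedIdeal.subset_span ⟨w, hw, Or.inl rfl⟩)
    · rw [parity_extDerivative_ι]
      exact TwoSidedIdeal.subset_span ⟨w, hw, Or.inr rfl⟩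
  · simp
  · intro x y _ _ hx hy
    rw [map_add]
    exact TwoSidedIdeal.add_mem _ hx hy
  · intro x _ hx
    rw [map_neg]
    exact TwoSidedIdeal.neg_mem _ hx
  · intro a x _ hx
    rw [map_mul]
    exact TwoSidedIdeal.mul_mem_left _ _ _ hx
  · intro b x _ hx
    rw [map_mul]
    exact TwoSidedIdeal.mul_mem_right _ _ _ hx

theorem extDerivative_mem (x : Forms k (Polar I)) (hx : x ∈ infinitesimalIdeal k I) :
    extDerivative k (Polar I) x ∈ infinitesimalIdeal k I := by
  refine (TwoSidedIdeal.span_induction (p := fun x _ => x ∈ infinitesimalIdeal k I ∧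
    extDerivative k (Polar I) x ∈ infinitesimalIdeal k I) ?_ ?_ ?_ ?_ ?_ ?_ hx).2
  · rintro _ ⟨w, hw, rfl | rfl⟩
    · exact ⟨TwoSidedIdeal.subset_span ⟨w, hw, Or.inl rfl⟩,
        TwoSidedIdeal.subset_span ⟨w, hw, Or.inr rfl⟩⟩
    · refine ⟨TwoSidedIdeal.subset_span ⟨w, hw, Or.inr rfl⟩, ?_⟩
      rw [extDerivative_extDerivative_ι]
      exact TwoSidedIdeal.zero_mem _
  · simp
  · rintro x y _ _ ⟨hx, hx'⟩ ⟨hy, hy'⟩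
    rw [map_add]
    exact ⟨TwoSidedIdeal.add_mem _ hx hy, TwoSidedIdeal.add_mem _ hx' hy'⟩
  · rintro x _ ⟨hx, hx'⟩
    rw [map_neg]
    exact ⟨TwoSidedIdeal.neg_mem _ hx, TwoSidedIdeal.neg_mem _ hx'⟩
  · rintro a x _ ⟨hx, hx'⟩
    rw [extDerivative_mul]
    exact ⟨TwoSidedIdeal.mul_mem_left _ _ _ hx, TwoSidedIdeal.add_mem _
      (TwoSidedIdeal.mul_mem_left _ _ _ hx) (TwoSidedIdeal.mul_mem_left _ _ _ hx')⟩
  · rintro b x _ ⟨hx, hx'⟩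
    rw [extDerivative_mul]
    exact ⟨TwoSidedIdeal.mul_mem_right _ _ _ hx, TwoSidedIdeal.add_mem _
      (TwoSidedIdeal.mul_mem_right _ _ _ hx')
      (TwoSidedIdeal.mul_mem_right _ _ _ (parity_mem k I _ hx))⟩

/-- The stalk of `⨁ Ω^q(*D)`. -/
def PolarForms : Type u := Forms k (Polar I) ⧸ TwoSidedIdeal.asIdeal (infinitesimalIdeal k I)

instance : Ring (PolarForms k I) :=
  inferInstanceAs (Ring (Forms k (Polar I) ⧸ TwoSidedIdeal.asIdeal (infinitesimalIdeal k I)))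

instance : Algebra (Polar I) (PolarForms k I) :=
  inferInstanceAs (Algebra (Polar I)
    (Forms k (Polar I) ⧸ TwoSidedIdeal.asIdeal (infinitesimalIdeal k I)))

instance : Algebra A (PolarForms k I) :=
  inferInstanceAs (Algebra A
    (Forms k (Polar I) ⧸ TwoSidedIdeal.asIdeal (infinitesimalIdeal k I)))

instance : IsScalarTower A (Polar I) (PolarForms k I) :=
  inferInstanceAs (IsScalarTower A (Polar I)
    (Forms k (Polar I) ⧸ TwoSidedIdeal.asIdeal (infinitesimalIdeal k I)))

/-- The class of a form. -/
def toPolar : Forms k (Polar I) →ₐ[Polar I] PolarForms k I :=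
  Ideal.Quotient.mkₐ (Polar I) (TwoSidedIdeal.asIdeal (infinitesimalIdeal k I))

theorem toPolar_surjective : Function.Surjective (toPolar k I) := Ideal.Quotient.mk_surjective

theorem toPolar_eq_zero {x : Forms k (Polar I)} :
    toPolar k I x = 0 ↔ x ∈ infinitesimalIdeal k I := by
  rw [← TwoSidedIdeal.mem_asIdeal]
  exact Ideal.Quotient.eq_zero_iff_mem

/-- The grading involution on `⨁ Ω^q(*D)`. -/
def polarParity : PolarForms k I →ₐ[Polar I] PolarForms k I :=
  Ideal.Quotient.liftₐ (TwoSidedIdeal.asIdeal (infinitesimalIdeal k I))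
    ((toPolar k I).comp (parity k (Polar I)))
    (fun x hx => (toPolar_eq_zero k I).2 (parity_mem k I x hx))

/-- The exterior derivative on `⨁ Ω^q(*D)`. -/
def polarD : PolarForms k I →+ PolarForms k I :=
  QuotientAddGroup.lift (TwoSidedIdeal.asIdeal (infinitesimalIdeal k I)).toAddSubgroup
    ((toPolar k I : Forms k (Polar I) →+ PolarForms k I).comp (extDerivative k (Polar I)))
    (fun x hx => (toPolar_eq_zero k I).2 (extDerivative_mem k I x hx))

@[simp] theorem polarParity_toPolar (x : Forms k (Polar I)) :
    polarParity k I (toPolar k I x) = toPolar k I (parity k (Polar I) x) := rfl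

@[simp] theorem polarD_toPolar (x : Forms k (Polar I)) :
    polarD k I (toPolar k I x) = toPolar k I (extDerivative k (Polar I) x) := rfl

theorem polarD_mul (x y : PolarForms k I) :
    polarD k I (x * y) = polarD k I x * y + polarParity k I x * polarD k I y := by
  obtain ⟨x, rfl⟩ := toPolar_surjective k I x
  obtain ⟨y, rfl⟩ := toPolar_surjective k I y
  rw [← map_mul, polarD_toPolar, extDerivative_mul]
  simp

/-- The canonical map `Ω¹ → Ω¹(*D)`. -/
def oneFormsToPolar : OneForms k A →ₗ[A] PolarForms k I :=
  (infinitesimals k A).liftQ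
    (((toPolar k I).toLinearMap.restrictScalars A).comp
      (((ExteriorAlgebra.ι (Polar I)).restrictScalars A).comp
        (KaehlerDifferential.map k k A (Polar I))))
    (fun w hw => (toPolar_eq_zero k I).2 (TwoSidedIdeal.subset_span ⟨w, hw, Or.inl rfl⟩))

/-- The canonical map `Ω¹(D) → Ω¹(*D)`. -/
def poleToPolar : PoleForms k I →ₗ[A] PolarForms k I :=
  TensorProduct.lift ((LinearMap.mul A (PolarForms k I)).compl₁₂
    (((Algebra.linearMap (Polar I) (PolarForms k I)).restrictScalars A).comp
      (lineBundle I).subtype) (oneFormsToPolar k I))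

theorem poleToPolar_tmul (b : lineBundle I) (w : Ω[A⁄k]) :
    poleToPolar k I (TensorProduct.tmul A b (Submodule.Quotient.mk w)) =
      algebraMap (Polar I) (PolarForms k I) b * toPolar k I
        (ExteriorAlgebra.ι (Polar I) (KaehlerDifferential.map k k A (Polar I) w)) := rfl

theorem polarD_algebraMap (f : A) :
    polarD k I (algebraMap A (PolarForms k I) f) = poleToPolar k I (poleD k I f) := by
  rw [poleD, poleToPolar_tmul, IsScalarTower.algebraMap_apply A (Polar I), ← (toPolar k I).commutes,
    polarD_toPolar, extDerivative_algebraMap]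
  simp [exactForm]

theorem polarD_algebraMap_mul (f : A) (x : PolarForms k I) :
    poleToPolar k I (poleD k I f) * x = polarParity k I x * poleToPolar k I (poleD k I f) := by
  obtain ⟨x, rfl⟩ := toPolar_surjective k I x
  simp only [poleD, poleToPolar_tmul, map_one, one_mul, polarParity_toPolar]
  rw [← map_mul, ← map_mul, ι_mul_comm]

theorem polarParity_poleToPolar (x : PoleForms k I) :
    polarParity k I (poleToPolar k I x) = -poleToPolar k I x := by
  induction x using TensorProduct.induction_on with
  | zero => simp
  | add x y hx hy => simp [hx, hy, add_comm]
  | tmul b w =>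
    obtain ⟨w, rfl⟩ := Submodule.Quotient.mk_surjective _ w
    rw [poleToPolar_tmul, map_mul, AlgHom.commutes, polarParity_toPolar, parity_ι]
    simp

end Local

section Modules
variable (k : Type u) [Field k] {A : Type u} [CommRing A] [IsLocalRing A] [Algebra k A]
  (I : Ideal A) (M : Type u) [AddCommGroup M] [Module A M]

/-- The stalk of `ℰ ⊗ Ω¹(D)`. -/
abbrev PoleValued : Type u := TensorProduct A M (PoleForms k I)

/-- The stalk of `⨁ ℰ ⊗ Ω^q(*D)`. -/
abbrev PolarValued : Type u := TensorProduct A M (PolarForms k I)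

/-- The canonical map `ℰ ⊗ Ω¹(D) → ℰ ⊗ Ω¹(*D)`. -/
def valuedToPolar : PoleValued k I M →ₗ[A] PolarValued k I M :=
  LinearMap.lTensor M (poleToPolar k I)

/-- Wedge product `(s ⊗ η) ∧ ω = s ⊗ (η ∧ ω)`, as a linear map in `ω` and then in `s ⊗ η`. -/
def wedge : PolarForms k I →ₗ[A] PolarValued k I M →ₗ[A] PolarValued k I M :=
  (LinearMap.lTensorHom M).comp (LinearMap.mul A (PolarForms k I)).flip

@[simp] theorem wedge_tmul (w : PolarForms k I) (m : M) (x : PolarForms k I) :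
    wedge k I M w (m ⊗ₜ[A] x) = m ⊗ₜ[A] (x * w) := rfl

/-- The action of the grading involution on the form part. -/
def valuedParity : PolarValued k I M →ₗ[A] PolarValued k I M :=
  LinearMap.lTensor M ((polarParity k I).toLinearMap.restrictScalars A)

@[simp] theorem valuedParity_tmul (m : M) (x : PolarForms k I) :
    valuedParity k I M (m ⊗ₜ[A] x) = m ⊗ₜ[A] polarParity k I x := rfl

/-- A germ of a connection with poles along `I`: an additive map satisfying the Leibniz rule
(hence linear over `k`). -/
structure Connection where
  toFun : M →+ PoleValued k I M
  leibniz : ∀ (f : A) (m : M), toFun (f • m) = f • toFun m + m ⊗ₜ[A] poleD k I f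

variable {k I M}

namespace Connection
variable (nab : Connection k I M)

/-- The extension `∇ (m ⊗ w) = ∇ m ∧ w + m ⊗ d w` of a connection to forms with values in `M`. -/
def ext : PolarValued k I M →+ PolarValued k I M :=
  TensorProduct.liftAddHom
    { toFun := fun m =>
        { toFun := fun w => wedge k I M w (valuedToPolar k I M (nab.toFun m))
            + m ⊗ₜ[A] polarD k I w
          map_zero' := by simp
          map_add' := fun w w' => by
            simp only [map_add, LinearMap.add_apply, TensorProduct.tmul_add]; abel }
      map_zero' := by ext; simp
      map_add' := fun m m' => by
        ext w
        simp only [map_add, TensorProduct.add_tmul, AddMonoidHom.coe_mk, ZeroHom.coe_mk,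
          AddMonoidHom.add_apply]
        abel }
    (by
      intro f m w
      have h : wedge k I M w (valuedToPolar k I M (m ⊗ₜ[A] poleD k I f))
          = m ⊗ₜ[A] (poleToPolar k I (poleD k I f) * w) := rfl
      simp only [AddMonoidHom.coe_mk, ZeroHom.coe_mk, nab.leibniz, map_add, h, map_smul,
        LinearMap.smul_apply]
      rw [Algebra.smul_def f w, polarD_mul, polarD_algebraMap, TensorProduct.tmul_add,
        IsScalarTower.algebraMap_apply A (Polar I), AlgHom.commutes,
        ← IsScalarTower.algebraMap_apply, ← Algebra.smul_def, ← TensorProduct.smul_tmul]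
      abel)

theorem ext_tmul (m : M) (w : PolarForms k I) :
    nab.ext (m ⊗ₜ[A] w) = wedge k I M w (valuedToPolar k I M (nab.toFun m))
      + m ⊗ₜ[A] polarD k I w := rfl

/-- The curvature `∇ ∘ ∇ : M → M ⊗ Ω²(*D)`. -/
def curvature (m : M) : PolarValued k I M := nab.ext (valuedToPolar k I M (nab.toFun m))

end Connection

/-- The extension `Φ (m ⊗ w) = Φ m ∧ w` of a form `Φ` with values in `End M` to an endomorphism of
the forms with values in `M`. -/
def act (P : M →ₗ[A] PolarValued k I M) : PolarValued k I M →ₗ[A] PolarValued k I M :=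
  TensorProduct.lift ((wedge k I M).flip.comp P)

@[simp] theorem act_tmul (P : M →ₗ[A] PolarValued k I M) (m : M) (w : PolarForms k I) :
    act P (m ⊗ₜ[A] w) = wedge k I M w (P m) := rfl

/-- The grading involution on forms with values in `End M`. -/
def signed (P : M →ₗ[A] PolarValued k I M) : M →ₗ[A] PolarValued k I M :=
  (valuedParity k I M).comp P

/-- The product of forms with values in `End M`. -/
def formMul (P Q : M →ₗ[A] PolarValued k I M) : M →ₗ[A] PolarValued k I M := (act P).comp Q

/-- The canonical map from `End M ⊗ Ω¹(D)` to `End M ⊗ Ω¹(*D)`. -/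
def toPolarEnd (P : M →ₗ[A] PoleValued k I M) : M →ₗ[A] PolarValued k I M :=
  (valuedToPolar k I M).comp P

namespace Connection
variable (nab : Connection k I M)

/-- The induced connection `End M → End M ⊗ Ω¹(D)`, `a ↦ ∇ ∘ a - a ∘ ∇`. -/
def endZero (a : M →ₗ[A] M) : M →ₗ[A] PoleValued k I M where
  toFun m := nab.toFun (a m) - LinearMap.rTensor (PoleForms k I) a (nab.toFun m)
  map_add' m m' := by simp only [map_add]; abel
  map_smul' f m := by
    simp only [map_smul, nab.leibniz, map_add, LinearMap.rTensor_tmul, RingHom.id_apply, smul_sub]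
    abel

theorem smul_eq_wedge (f : A) (t : PolarValued k I M) :
    f • t = wedge k I M (algebraMap A _ f) t := by
  induction t using TensorProduct.induction_on with
  | zero => simp
  | add x y hx hy => simp only [smul_add, map_add, hx, hy]
  | tmul m x => rw [wedge_tmul, ← Algebra.commutes, ← Algebra.smul_def, TensorProduct.tmul_smul]

theorem wedge_wedge (v w : PolarForms k I) (t : PolarValued k I M) :
    wedge k I M w (wedge k I M v t) = wedge k I M (v * w) t := by
  induction t using TensorProduct.induction_on with
  | zero => simp
  | add x y hx hy => simp only [map_add, hx, hy]
  | tmul m x => simp [mul_assoc]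

/-- The graded Leibniz rule. -/
theorem ext_wedge (w : PolarForms k I) (t : PolarValued k I M) :
    nab.ext (wedge k I M w t) =
      wedge k I M w (nab.ext t) + wedge k I M (polarD k I w) (valuedParity k I M t) := by
  induction t using TensorProduct.induction_on with
  | zero => simp
  | add x y hx hy => simp only [map_add, hx, hy]; abel
  | tmul m x =>
    simp only [wedge_tmul, ext_tmul, map_add, polarD_mul, TensorProduct.tmul_add, wedge_wedge,
      valuedParity_tmul]
    abel

/-- The map `End M ⊗ Ω^q(*D) → End M ⊗ Ω^(q+1)(*D)`, `P ↦ ∇ ∘ P - (-1)^q P ∘ ∇`, induced by a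
connection. -/
def endForm (P : M →ₗ[A] PolarValued k I M) : M →ₗ[A] PolarValued k I M where
  toFun m := nab.ext (P m) - act (signed P) (valuedToPolar k I M (nab.toFun m))
  map_add' m m' := by simp only [map_add]; abel
  map_smul' f m := by
    have h : act (signed P) (valuedToPolar k I M (m ⊗ₜ[A] poleD k I f)) =
        wedge k I M (poleToPolar k I (poleD k I f)) (valuedParity k I M (P m)) := rfl
    rw [map_smul, smul_eq_wedge, ext_wedge, polarD_algebraMap, nab.leibniz, map_add, map_add, h,
      map_smul, map_smul, ← smul_eq_wedge, RingHom.id_apply, smul_sub]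
    abel

theorem act_wedge (P : M →ₗ[A] PolarValued k I M) (w : PolarForms k I) (t : PolarValued k I M) :
    act P (wedge k I M w t) = wedge k I M w (act P t) := by
  induction t using TensorProduct.induction_on with
  | zero => simp
  | add x y hx hy => simp only [map_add, hx, hy]
  | tmul m x => simp [wedge_wedge]

theorem valuedParity_wedge (w : PolarForms k I) (t : PolarValued k I M) :
    valuedParity k I M (wedge k I M w t) =
      wedge k I M (polarParity k I w) (valuedParity k I M t) := by
  induction t using TensorProduct.induction_on with
  | zero => simp
  | add x y hx hy => simp only [map_add, hx, hy]
  | tmul m x => simp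

theorem valuedParity_act (P : M →ₗ[A] PolarValued k I M) (t : PolarValued k I M) :
    valuedParity k I M (act P t) = act (signed P) (valuedParity k I M t) := by
  induction t using TensorProduct.induction_on with
  | zero => simp
  | add x y hx hy => simp only [map_add, hx, hy]
  | tmul m x => simp [valuedParity_wedge, signed]

theorem act_endForm (P : M →ₗ[A] PolarValued k I M) (t : PolarValued k I M) :
    act (nab.endForm P) t = nab.ext (act P t) - act (signed P) (nab.ext t) := by
  induction t using TensorProduct.induction_on with
  | zero => simp
  | add x y hx hy => simp only [map_add, hx, hy]; abel
  | tmul m x =>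
    have h : nab.endForm P m =
      nab.ext (P m) - act (signed P) (valuedToPolar k I M (nab.toFun m)) := rfl
    simp only [act_tmul, ext_wedge, ext_tmul, map_add, act_wedge, h, map_sub]
    simp only [signed, LinearMap.comp_apply]
    abel

theorem act_formMul (P Q : M →ₗ[A] PolarValued k I M) (t : PolarValued k I M) :
    act (formMul P Q) t = act P (act Q t) := by
  induction t using TensorProduct.induction_on with
  | zero => simp
  | add x y hx hy => simp only [map_add, hx, hy]
  | tmul m x => simp [act_wedge, formMul]

/-- The graded Leibniz rule for products of forms with values in `End M`. -/
theorem endForm_formMul (P Q : M →ₗ[A] PolarValued k I M) :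
    nab.endForm (formMul P Q) = formMul (nab.endForm P) Q + formMul (signed P) (nab.endForm Q) := by
  ext m
  have h1 : signed (formMul P Q) = formMul (signed P) (signed Q) := by
    ext m
    exact valuedParity_act P (Q m)
  have h2 : ∀ R : M →ₗ[A] PolarValued k I M, nab.endForm R m =
      nab.ext (R m) - act (signed R) (valuedToPolar k I M (nab.toFun m)) := fun _ => rfl
  rw [h2, h1, act_formMul]
  simp only [formMul, LinearMap.comp_apply, LinearMap.add_apply, act_endForm, h2, map_sub]
  abel

/-- The induced map `End M ⊗ Ω¹(D) → End M ⊗ Ω²(*D)`. -/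
def endOne (P : M →ₗ[A] PoleValued k I M) : M →ₗ[A] PolarValued k I M :=
  nab.endForm (toPolarEnd P)

end Connection
end Modules

section Products
variable {k : Type u} [Field k] {A : Type u} [CommRing A] [IsLocalRing A] [Algebra k A]
  {I : Ideal A} {M : Type u} [AddCommGroup M] [Module A M]

/-- The product of an endomorphism and an `End M`-valued form in `Ω¹(D)`. -/
def zeroMulOne (a : M →ₗ[A] M) (P : M →ₗ[A] PoleValued k I M) : M →ₗ[A] PoleValued k I M :=
  (LinearMap.rTensor (PoleForms k I) a).comp P

/-- The product of an `End M`-valued form in `Ω¹(D)` and an endomorphism. -/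
def oneMulZero (P : M →ₗ[A] PoleValued k I M) (a : M →ₗ[A] M) : M →ₗ[A] PoleValued k I M :=
  P.comp a

/-- The wedge product of `End M`-valued forms in `Ω¹(D)`. -/
def oneMulOne (P Q : M →ₗ[A] PoleValued k I M) : M →ₗ[A] PolarValued k I M :=
  formMul (toPolarEnd P) (toPolarEnd Q)

/-- An endomorphism as a form of degree zero. -/
def zeroForm (a : M →ₗ[A] M) : M →ₗ[A] PolarValued k I M :=
  ((TensorProduct.mk A M (PolarForms k I)).flip 1).comp a

theorem zeroForm_apply (a : M →ₗ[A] M) (m : M) :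
    zeroForm (k := k) (I := I) a m = a m ⊗ₜ[A] 1 := rfl

theorem act_zeroForm (a : M →ₗ[A] M) (t : PolarValued k I M) :
    act (zeroForm a) t = LinearMap.rTensor (PolarForms k I) a t := by
  induction t using TensorProduct.induction_on with
  | zero => simp
  | add x y hx hy => simp only [map_add, hx, hy]
  | tmul m x => simp [zeroForm_apply]

theorem valuedToPolar_rTensor (a : M →ₗ[A] M) (t : PoleValued k I M) :
    valuedToPolar k I M (LinearMap.rTensor (PoleForms k I) a t) =
      LinearMap.rTensor (PolarForms k I) a (valuedToPolar k I M t) := by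
  induction t using TensorProduct.induction_on with
  | zero => simp
  | add x y hx hy => simp only [map_add, hx, hy]
  | tmul m x => simp [valuedToPolar]

theorem toPolarEnd_zeroMulOne (a : M →ₗ[A] M) (P : M →ₗ[A] PoleValued k I M) :
    toPolarEnd (zeroMulOne a P) = formMul (zeroForm a) (toPolarEnd P) := by
  ext m
  simp [toPolarEnd, zeroMulOne, formMul, act_zeroForm, valuedToPolar_rTensor]


theorem act_add (P Q : M →ₗ[A] PolarValued k I M) (t : PolarValued k I M) :
    act (P + Q) t = act P t + act Q t := by
  induction t using TensorProduct.induction_on with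
  | zero => simp
  | add x y hx hy => simp only [map_add, hx, hy]; abel
  | tmul m x => simp

theorem act_neg (P : M →ₗ[A] PolarValued k I M) (t : PolarValued k I M) :
    act (-P) t = -act P t := by
  induction t using TensorProduct.induction_on with
  | zero => simp
  | add x y hx hy => simp only [map_add, hx, hy]; abel
  | tmul m x => simp

theorem wedge_one (t : PolarValued k I M) : wedge k I M 1 t = t := by
  rw [← map_one (algebraMap A (PolarForms k I)), ← Connection.smul_eq_wedge, one_smul]

theorem toPolarEnd_oneMulZero (P : M →ₗ[A] PoleValued k I M) (a : M →ₗ[A] M) :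
    toPolarEnd (oneMulZero P a) = formMul (toPolarEnd P) (zeroForm a) := by
  ext m
  simp [toPolarEnd, oneMulZero, formMul, zeroForm_apply, wedge_one]

theorem signed_zeroForm (a : M →ₗ[A] M) : signed (zeroForm (k := k) (I := I) a) = zeroForm a := by
  ext m
  simp [signed, zeroForm_apply]

theorem signed_toPolarEnd (P : M →ₗ[A] PoleValued k I M) :
    signed (toPolarEnd P) = -toPolarEnd P := by
  ext m
  simp only [signed, toPolarEnd, LinearMap.comp_apply, LinearMap.neg_apply]
  induction P m using TensorProduct.induction_on with
  | zero => simp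
  | add x y hx hy => simp only [map_add, hx, hy]; abel
  | tmul m x => simp [valuedToPolar, polarParity_poleToPolar, TensorProduct.tmul_neg]

namespace Connection
variable (nab : Connection k I M)

theorem endForm_zeroForm (a : M →ₗ[A] M) :
    nab.endForm (zeroForm a) = toPolarEnd (nab.endZero a) := by
  ext m
  have h1 : nab.endForm (zeroForm a) m = nab.ext (a m ⊗ₜ[A] 1)
      - act (signed (zeroForm a)) (valuedToPolar k I M (nab.toFun m)) := rfl
  have h2 : toPolarEnd (nab.endZero a) m = valuedToPolar k I M
      (nab.toFun (a m) - LinearMap.rTensor (PoleForms k I) a (nab.toFun m)) := rfl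
  have h3 : polarD k I 1 = 0 := by
    have := polarD_algebraMap k I 1
    rw [map_one] at this
    rw [this, poleD]
    simp
  rw [h1, h2, signed_zeroForm, act_zeroForm, ext_tmul, wedge_one, h3, map_sub,
    valuedToPolar_rTensor]
  simp

theorem endZero_mul (a b : M →ₗ[A] M) :
    nab.endZero (a.comp b) = oneMulZero (nab.endZero a) b + zeroMulOne a (nab.endZero b) := by
  ext m
  have h : ∀ (c : M →ₗ[A] M) (m : M), nab.endZero c m =
    nab.toFun (c m) - LinearMap.rTensor (PoleForms k I) c (nab.toFun m) := fun _ _ => rfl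
  simp [h, oneMulZero, zeroMulOne, LinearMap.rTensor_comp_apply]

theorem endZero_add (a b : M →ₗ[A] M) :
    nab.endZero (a + b) = nab.endZero a + nab.endZero b := by
  ext m
  have h : ∀ (c : M →ₗ[A] M) (m : M), nab.endZero c m =
    nab.toFun (c m) - LinearMap.rTensor (PoleForms k I) c (nab.toFun m) := fun _ _ => rfl
  simp only [h, LinearMap.add_apply, map_add, LinearMap.rTensor_add]
  abel

theorem endForm_add (P Q : M →ₗ[A] PolarValued k I M) :
    nab.endForm (P + Q) = nab.endForm P + nab.endForm Q := by
  ext m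
  have h2 : ∀ R : M →ₗ[A] PolarValued k I M, nab.endForm R m =
      nab.ext (R m) - act (signed R) (valuedToPolar k I M (nab.toFun m)) := fun _ => rfl
  have h3 : act (signed (P + Q)) (valuedToPolar k I M (nab.toFun m)) =
      act (signed P) (valuedToPolar k I M (nab.toFun m)) +
      act (signed Q) (valuedToPolar k I M (nab.toFun m)) := by
    rw [signed, LinearMap.comp_add, act_add]
    rfl
  rw [LinearMap.add_apply, h2, h2, h2, h3, LinearMap.add_apply, map_add]
  abel

/-- `endZero` as an additive map. -/
def endZeroHom : (M →ₗ[A] M) →+ (M →ₗ[A] PoleValued k I M) :=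
  AddMonoidHom.mk' nab.endZero nab.endZero_add

/-- `endForm` as an additive map. -/
def endFormHom : (M →ₗ[A] PolarValued k I M) →+ (M →ₗ[A] PolarValued k I M) :=
  AddMonoidHom.mk' nab.endForm nab.endForm_add

/-- `endOne` as an additive map. -/
def endOneHom : (M →ₗ[A] PoleValued k I M) →+ (M →ₗ[A] PolarValued k I M) :=
  AddMonoidHom.mk' nab.endOne fun P Q => by
    rw [endOne, toPolarEnd, LinearMap.comp_add, endForm_add]; rfl

theorem endOne_zeroMulOne (a : M →ₗ[A] M) (P : M →ₗ[A] PoleValued k I M) :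
    nab.endOne (zeroMulOne a P) =
      oneMulOne (nab.endZero a) P + formMul (zeroForm a) (nab.endOne P) := by
  rw [endOne, toPolarEnd_zeroMulOne, endForm_formMul, endForm_zeroForm, signed_zeroForm]
  rfl

theorem endOne_oneMulZero (P : M →ₗ[A] PoleValued k I M) (a : M →ₗ[A] M) :
    nab.endOne (oneMulZero P a) =
      formMul (nab.endOne P) (zeroForm a) - oneMulOne P (nab.endZero a) := by
  rw [endOne, toPolarEnd_oneMulZero, endForm_formMul, endForm_zeroForm, signed_toPolarEnd,
    sub_eq_add_neg]
  congr 1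
  ext m
  simp [formMul, oneMulOne, act_neg]

theorem endForm_oneMulOne (P Q : M →ₗ[A] PoleValued k I M) :
    nab.endForm (oneMulOne P Q) =
      formMul (nab.endOne P) (toPolarEnd Q) - formMul (toPolarEnd P) (nab.endOne Q) := by
  rw [oneMulOne, endForm_formMul, signed_toPolarEnd, sub_eq_add_neg]
  congr 1
  ext m
  simp [formMul, endOne, act_neg]

end Connection
end Products

open CategoryTheory Opposite TopologicalSpace AlgebraicGeometry

section Spaces

/-- A structure of locally ringed space over `k`. -/
class SpaceOver (k : Type u) [Field k] (X : LocallyRingedSpace.{u}) where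
  scalars : k →+* LocallyRingedSpace.Γ.obj (op X)

/-- The stalk of the structure sheaf. -/
abbrev Stalk (X : LocallyRingedSpace.{u}) (x : X) : Type u := X.presheaf.stalk x

/-- The sections of the structure sheaf on an open subset. -/
abbrev Regular (X : LocallyRingedSpace.{u}) (V : Opens X) : Type u := X.presheaf.obj (op V)

/-- The germ of a section of the structure sheaf. -/
abbrev germAt {X : LocallyRingedSpace.{u}} {V : Opens X} (f : Regular X V) (x : V) :
    Stalk X x.1 := (X.presheaf.germ V x.1 x.2).hom f

instance (k : Type u) [Field k] (X : LocallyRingedSpace.{u}) [SpaceOver k X] (x : X) :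
    Algebra k (Stalk X x) :=
  (((X.presheaf.germ ⊤ x trivial).hom).comp (SpaceOver.scalars (k := k) (X := X))).toAlgebra

/-- `X` is (the locally ringed space of) a scheme of finite type over `k`. -/
def IsAlgebraicScheme (k : Type u) [Field k] (X : LocallyRingedSpace.{u}) [SpaceOver k X] : Prop :=
  ∃ (Y : Scheme.{u}) (f : Y ⟶ Spec (.of k)) (e : Y.toLocallyRingedSpace ≅ X),
    LocallyOfFiniteType f ∧ QuasiCompact f ∧
    ∀ c : k, (LocallyRingedSpace.Γ.map e.hom.op).hom (SpaceOver.scalars (X := X) c) =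
      f.appTop.hom ((Scheme.ΓSpecIso (.of k)).inv.hom c)

/-- The ring of germs of holomorphic functions at a point of `ℂⁿ`. -/
def HolomorphicGerm {n : ℕ} (z : Fin n → ℂ) : Subring ((nhds z).Germ ℂ) where
  carrier := {g | ∃ h : (Fin n → ℂ) → ℂ, AnalyticAt ℂ h z ∧ g = h}
  mul_mem' := by
    rintro _ _ ⟨g, hg, rfl⟩ ⟨h, hh, rfl⟩
    exact ⟨g * h, hg.mul hh, rfl⟩
  one_mem' := ⟨1, analyticAt_const, rfl⟩
  add_mem' := by
    rintro _ _ ⟨g, hg, rfl⟩ ⟨h, hh, rfl⟩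
    exact ⟨g + h, hg.add hh, rfl⟩
  zero_mem' := ⟨0, analyticAt_const, rfl⟩
  neg_mem' := by
    rintro _ ⟨g, hg, rfl⟩
    exact ⟨-g, hg.neg, rfl⟩

/-- The germ at `z` of a function that is holomorphic at `z`. -/
def HolomorphicGerm.of {n : ℕ} {z : Fin n → ℂ} (h : (Fin n → ℂ) → ℂ) (hh : AnalyticAt ℂ h z) :
    HolomorphicGerm z := ⟨h, h, hh, rfl⟩

/-- An isomorphism over `ℂ` of an open subspace `V` of `X` with the local model cut out by
holomorphic functions `f₁, …, f_m` in an open subset of `ℂⁿ`: a homeomorphism of `V` onto the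
common zero set together with an isomorphism of `𝒪 / (f₁, …, f_m)` with the structure sheaf. -/
structure AnalyticChart {k : Type u} [Field k] (σ : ℂ ≃+* k) (X : LocallyRingedSpace.{u})
    [SpaceOver k X] (V : Opens X) where
  n : ℕ
  m : ℕ
  domain : Opens (Fin n → ℂ)
  f : Fin m → (Fin n → ℂ) → ℂ
  holomorphic : ∀ i, ∀ z ∈ domain, AnalyticAt ℂ (f i) z
  map : V → (Fin n → ℂ)
  isEmbedding : Topology.IsEmbedding map
  range_map : Set.range map = {z | z ∈ domain ∧ ∀ i, f i z = 0}
  comorphism : ∀ x : V, HolomorphicGerm (map x) →+* Stalk X x.1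
  comorphism_const : ∀ (x : V) (c : ℂ),
    comorphism x (HolomorphicGerm.of (fun _ => c) analyticAt_const) = algebraMap k (Stalk X x.1) (σ c)
  comorphism_surjective : ∀ x : V, Function.Surjective (comorphism x)
  ker_comorphism : ∀ x : V, RingHom.ker (comorphism x) = Ideal.span (Set.range fun i =>
    HolomorphicGerm.of (f i) (holomorphic i (map x) (range_map.le ⟨x, rfl⟩).1))
  comorphism_section : ∀ (h : (Fin n → ℂ) → ℂ) (x : V), AnalyticAt ℂ h (map x) →
    ∃ (W : Opens X) (hW : W ≤ V) (s : Regular X W), x.1 ∈ W ∧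
      ∀ y : W, ∃ hy : AnalyticAt ℂ h (map ⟨y.1, hW y.2⟩),
        comorphism ⟨y.1, hW y.2⟩ (HolomorphicGerm.of h hy) = germAt s y

/-- `X` is a (Hausdorff) complex space, the field `k` being identified with `ℂ`. -/
def IsComplexSpace (k : Type u) [Field k] (X : LocallyRingedSpace.{u}) [SpaceOver k X] : Prop :=
  T2Space X ∧ ∃ σ : ℂ ≃+* k, ∀ x : X, ∃ V : Opens X, x ∈ V ∧ Nonempty (AnalyticChart σ X V)

/-- An effective Cartier divisor, given by the stalks of its ideal sheaf `𝒪(-D)`, which are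
generated locally by a section of the structure sheaf that is not a zero divisor. -/
structure EffectiveCartierDivisor (X : LocallyRingedSpace.{u}) where
  ideal : ∀ x : X, Ideal (Stalk X x)
  locally_principal : ∀ x : X, ∃ V : Opens X, x ∈ V ∧ ∃ f : Regular X V, ∀ y : V,
    germAt f y ∈ nonZeroDivisors (Stalk X y.1) ∧ ideal y.1 = Ideal.span {germAt f y}

end Spaces

section Sheaves
variable {k : Type u} [Field k] {X : LocallyRingedSpace.{u}} [SpaceOver k X]

/-- `F` holds near every point of `V`, where `F W` is a condition on the restriction to `W`. -/
def LocallyOn (V : Opens X) (F : ∀ W : Opens X, W ≤ V → Prop) : Prop :=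
  ∀ x : V, ∃ (W : Opens X) (h : W ≤ V), x.1 ∈ W ∧ F W h

/-- `t` is locally a finite sum of families in `G` (up to signs). -/
def LocallySum {F : X → Type u} [∀ x, AddCommGroup (F x)] (G : ∀ W : Opens X, Set (∀ x : W, F x.1))
    {V : Opens X} (t : ∀ x : V, F x.1) : Prop :=
  LocallyOn V fun W h => (fun x : W => t ⟨x.1, h x.2⟩) ∈ AddSubgroup.closure (G W)

variable (D : EffectiveCartierDivisor X)

/-- The sections of `𝒪(*D)`: locally `g / s` with `g` regular and `s` an equation of some `n D`. -/
def IsPolarFunction {V : Opens X} (b : ∀ x : V, Polar (D.ideal x.1)) : Prop :=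
  LocallyOn V fun W h => ∃ g s : Regular X W, ∀ x : W,
    germAt s x ∈ equations (D.ideal x.1) ∧
      algebraMap _ (Polar (D.ideal x.1)) (germAt s x) * b ⟨x.1, h x.2⟩ =
        algebraMap _ (Polar (D.ideal x.1)) (germAt g x)

variable (k) in
/-- The sections of `Ω¹(D) = 𝒪(D) ⊗ Ω¹`: locally sums of `b ⊗ d g` with `b` a section of `𝒪(D)`. -/
def IsPoleForm {V : Opens X} (w : ∀ x : V, PoleForms k (D.ideal x.1)) : Prop :=
  LocallySum (F := fun x => PoleForms k (D.ideal x)) (fun W => {v |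
    ∃ (b : ∀ x : W, lineBundle (D.ideal x.1)) (g : Regular X W),
      (IsPolarFunction D fun x => (b x : Polar (D.ideal x.1))) ∧
      v = fun x => b x ⊗ₜ[Stalk X x.1]
        (Submodule.Quotient.mk (KaehlerDifferential.D k (Stalk X x.1) (germAt g x)) :
          OneForms k (Stalk X x.1))}) w

variable (k) in
/-- The sections of `Ω^q(*D)`: locally sums of `b d g₁ ∧ ⋯ ∧ d g_q` with `b` a section of
`𝒪(*D)`. -/
def IsPolarForm (q : ℕ) {V : Opens X} (w : ∀ x : V, PolarForms k (D.ideal x.1)) : Prop :=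
  LocallySum (F := fun x => PolarForms k (D.ideal x)) (fun W => {v |
    ∃ (b : ∀ x : W, Polar (D.ideal x.1)) (g : Fin q → Regular X W), IsPolarFunction D b ∧
      v = fun x => b x • (List.ofFn fun j => polarD k (D.ideal x.1)
        (algebraMap _ (PolarForms k (D.ideal x.1)) (germAt (g j) x))).prod}) w

/-- A vector bundle on `X × Spec k[ε]/(ε^(n+1))`: a sheaf of `𝒪[ε]/(ε^(n+1))`-modules on `X` that is
locally free of finite rank, given by its stalks, which are modules over the stalks of the structure
sheaf with an endomorphism `ε`, and by its sections, which are families of germs. -/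
structure VectorBundle (X : LocallyRingedSpace.{u}) (n : ℕ) where
  fiber : X → Type u
  [addCommGroup : ∀ x, AddCommGroup (fiber x)]
  [module : ∀ x, Module (Stalk X x) (fiber x)]
  eps : ∀ x, fiber x →ₗ[Stalk X x] fiber x
  eps_pow : ∀ x, eps x ^ (n + 1) = 0
  sheaf : TopCat.LocalPredicate (X := X.toTopCat) fiber
  locally_free : ∀ x : X, ∃ V : Opens X, x ∈ V ∧ ∃ (r : ℕ) (e : Fin r → ∀ y : V, fiber y.1),
    (∀ y : V, LinearIndependent (Stalk X y.1)
        (fun p : Fin r × Fin (n + 1) => (eps y.1 ^ (p.2 : ℕ)) (e p.1 y)) ∧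
      Submodule.span (Stalk X y.1) (Set.range
        (fun p : Fin r × Fin (n + 1) => (eps y.1 ^ (p.2 : ℕ)) (e p.1 y))) = ⊤) ∧
    ∀ (W : Opens X) (h : W ≤ V) (s : ∀ y : W, fiber y.1), sheaf.pred s ↔
      LocallyOn W fun W' h' => ∃ c : Fin r → Fin (n + 1) → Regular X W', ∀ y : W',
        s ⟨y.1, h' y.2⟩ = ∑ i, ∑ j : Fin (n + 1),
          germAt (c i j) y • (eps y.1 ^ (j : ℕ)) (e i ⟨y.1, h (h' y.2)⟩)

attribute [instance] VectorBundle.addCommGroup VectorBundle.module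

variable {D} {n : ℕ} (E : VectorBundle X n)

variable (k D) in
/-- The sections of `ℰ ⊗ Ω¹(D)`. -/
def IsPoleValued {V : Opens X} (t : ∀ x : V, PoleValued k (D.ideal x.1) (E.fiber x.1)) : Prop :=
  LocallySum (F := fun x => PoleValued k (D.ideal x) (E.fiber x)) (fun W => {v |
    ∃ (s : ∀ x : W, E.fiber x.1) (w : ∀ x : W, PoleForms k (D.ideal x.1)),
      E.sheaf.pred s ∧ IsPoleForm k D w ∧ v = fun x => s x ⊗ₜ[Stalk X x.1] w x}) t

variable (k D) in
/-- The sections of `ℰ ⊗ Ω^q(*D)`. -/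
def IsPolarValued (q : ℕ) {V : Opens X}
    (t : ∀ x : V, PolarValued k (D.ideal x.1) (E.fiber x.1)) : Prop :=
  LocallySum (F := fun x => PolarValued k (D.ideal x) (E.fiber x)) (fun W => {v |
    ∃ (s : ∀ x : W, E.fiber x.1) (w : ∀ x : W, PolarForms k (D.ideal x.1)),
      E.sheaf.pred s ∧ IsPolarForm k D q w ∧ v = fun x => s x ⊗ₜ[Stalk X x.1] w x}) t

variable (k D) in
/-- An integrable connection `∇ : ℰ → ℰ ⊗ Ω¹(D)`, linear over `k[ε]`, on a vector bundle over
`X × Spec k[ε]/(ε^(n+1))`, with `D` as divisor of poles: a morphism of sheaves, given on stalks,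
that satisfies the Leibniz rule and `∇² = 0`. -/
structure IntegrableConnection (n : ℕ) where
  bundle : VectorBundle X n
  nabla : ∀ x : X, Connection k (D.ideal x) (bundle.fiber x)
  nabla_section : ∀ (V : Opens X) (s : ∀ x : V, bundle.fiber x.1), bundle.sheaf.pred s →
    IsPoleValued k D bundle fun x => (nabla x.1).toFun (s x)
  nabla_eps : ∀ (x : X) (m : bundle.fiber x), (nabla x).toFun (bundle.eps x m) =
    LinearMap.rTensor (PoleForms k (D.ideal x)) (bundle.eps x) ((nabla x).toFun m)
  integrable : ∀ (x : X) (m : bundle.fiber x), (nabla x).curvature m = 0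

/-- An isomorphism of the restriction of `P` to `X × Spec k[ε]/(ε^(m+1))` with `Q`, given as a
surjective morphism `P → Q` with kernel `ε^(m+1) P`. -/
structure Restriction {n m : ℕ} (P : IntegrableConnection k D n)
    (Q : IntegrableConnection k D m) where
  map : ∀ x : X, P.bundle.fiber x →ₗ[Stalk X x] Q.bundle.fiber x
  map_section : ∀ (V : Opens X) (s : ∀ x : V, P.bundle.fiber x.1), P.bundle.sheaf.pred s →
    Q.bundle.sheaf.pred fun x : V => map x.1 (s x)
  map_eps : ∀ (x : X) (s : P.bundle.fiber x),
    map x (P.bundle.eps x s) = Q.bundle.eps x (map x s)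
  surjective : ∀ x : X, Function.Surjective (map x)
  ker_map : ∀ x : X, LinearMap.ker (map x) = LinearMap.range (P.bundle.eps x ^ (m + 1))
  map_nabla : ∀ (x : X) (s : P.bundle.fiber x), (Q.nabla x).toFun (map x s) =
    LinearMap.rTensor (PoleForms k (D.ideal x)) (map x) ((P.nabla x).toFun s)

end Sheaves

section SectionLemmas
variable {k : Type u} [Field k] {X : LocallyRingedSpace.{u}} [SpaceOver k X]

section LocallySum
variable {F F' : X → Type u} [∀ x, AddCommGroup (F x)] [∀ x, AddCommGroup (F' x)]
  {G : ∀ W : Opens X, Set (∀ x : W, F x.1)} {G' : ∀ W : Opens X, Set (∀ x : W, F' x.1)}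

/-- The families in `G` are stable under restriction. -/
def Restricts (G : ∀ W : Opens X, Set (∀ x : W, F x.1)) : Prop :=
  ∀ (W W' : Opens X) (h : W' ≤ W) (v : ∀ x : W, F x.1), v ∈ G W →
    (fun x : W' => v ⟨x.1, h x.2⟩) ∈ G W'

theorem Restricts.closure (hG : Restricts G) {W W' : Opens X} (h : W' ≤ W) {v : ∀ x : W, F x.1}
    (hv : v ∈ AddSubgroup.closure (G W)) :
    (fun x : W' => v ⟨x.1, h x.2⟩) ∈ AddSubgroup.closure (G W') := by
  induction hv using AddSubgroup.closure_induction with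
  | mem v hv => exact AddSubgroup.subset_closure (hG _ _ h v hv)
  | zero => exact zero_mem _
  | add v w _ _ hv hw => exact add_mem hv hw
  | neg v _ hv => exact neg_mem hv

theorem LocallySum.res (hG : Restricts G) {W W' : Opens X} (h : W' ≤ W) {t : ∀ x : W, F x.1}
    (ht : LocallySum G t) : LocallySum G (fun x : W' => t ⟨x.1, h x.2⟩) := by
  intro x
  obtain ⟨V, hV, hx, hv⟩ := ht ⟨x.1, h x.2⟩
  exact ⟨V ⊓ W', inf_le_right, ⟨hx, x.2⟩, hG.closure inf_le_left hv⟩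

theorem LocallySum.of_local {W : Opens X} {t : ∀ x : W, F x.1}
    (ht : LocallyOn W fun W' h => LocallySum G (fun x : W' => t ⟨x.1, h x.2⟩)) :
    LocallySum G t := by
  intro x
  obtain ⟨V, hV, hx, hv⟩ := ht x
  obtain ⟨V', hV', hx', hv'⟩ := hv ⟨x.1, hx⟩
  exact ⟨V', hV'.trans hV, hx', hv'⟩

theorem LocallySum.of_mem {W : Opens X} {t : ∀ x : W, F x.1} (ht : t ∈ G W) : LocallySum G t :=
  fun x => ⟨W, le_rfl, x.2, AddSubgroup.subset_closure ht⟩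

theorem LocallySum.zero {W : Opens X} : LocallySum G (0 : ∀ x : W, F x.1) :=
  fun x => ⟨W, le_rfl, x.2, zero_mem _⟩

theorem LocallySum.neg {W : Opens X} {t : ∀ x : W, F x.1} (ht : LocallySum G t) :
    LocallySum G (-t) := fun x => by
  obtain ⟨V, hV, hx, hv⟩ := ht x
  exact ⟨V, hV, hx, neg_mem hv⟩

theorem LocallySum.add (hG : Restricts G) {W : Opens X} {t t' : ∀ x : W, F x.1}
    (ht : LocallySum G t) (ht' : LocallySum G t') : LocallySum G (t + t') := fun x => by
  obtain ⟨V, hV, hx, hv⟩ := ht x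
  obtain ⟨V', hV', hx', hv'⟩ := ht' x
  exact ⟨V ⊓ V', inf_le_left.trans hV, ⟨hx, hx'⟩,
    add_mem (hG.closure inf_le_left hv) (hG.closure inf_le_right hv')⟩

theorem LocallySum.map (hG' : Restricts G') {W : Opens X} (f : ∀ x : W, F x.1 →+ F' x.1)
    (hf : ∀ (W' : Opens X) (h : W' ≤ W), ∀ v ∈ G W',
      LocallySum G' fun x : W' => f ⟨x.1, h x.2⟩ (v x))
    {t : ∀ x : W, F x.1} (ht : LocallySum G t) : LocallySum G' fun x => f x (t x) := by
  refine LocallySum.of_local fun x => ?_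
  obtain ⟨V, hV, hx, hv⟩ := ht x
  refine ⟨V, hV, hx, ?_⟩
  have key : ∀ v ∈ AddSubgroup.closure (G V), LocallySum G' fun x : V => f ⟨x.1, hV x.2⟩ (v x) := by
    intro v hv
    induction hv using AddSubgroup.closure_induction with
    | mem v hv => exact hf V hV v hv
    | zero =>
      simp only [Pi.zero_apply, map_zero]
      exact LocallySum.zero
    | add v w _ _ hv hw =>
      simp only [Pi.add_apply, map_add]
      exact hv.add hG' hw
    | neg v _ hv =>
      simp only [Pi.neg_apply, map_neg]
      exact hv.neg
  exact key _ hv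

end LocallySum

section Forms
variable {D : EffectiveCartierDivisor X}

theorem LocallyOn.res {V W : Opens X} (h : W ≤ V) {F : ∀ W : Opens X, W ≤ V → Prop}
    (hF : LocallyOn V F) (hr : ∀ (W W' : Opens X) (h : W ≤ V) (h' : W' ≤ W), F W h →
      F W' (h'.trans h)) : LocallyOn W fun W' h' => F W' (h'.trans h) := by
  intro x
  obtain ⟨U, hU, hx, hF⟩ := hF ⟨x.1, h x.2⟩
  exact ⟨U ⊓ W, inf_le_right, ⟨hx, x.2⟩, hr _ _ hU inf_le_left hF⟩

/-- Restriction of a section of the structure sheaf. -/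
def Regular.res {V W : Opens X} (h : W ≤ V) (f : Regular X V) : Regular X W :=
  (X.presheaf.map (homOfLE h).op).hom f

theorem germAt_res {V W : Opens X} (h : W ≤ V) (f : Regular X V) (x : W) :
    germAt (Regular.res h f) x = germAt f ⟨x.1, h x.2⟩ :=
  TopCat.Presheaf.germ_res_apply X.presheaf (homOfLE h) x.1 x.2 f

theorem IsPolarFunction.res {V W : Opens X} (h : W ≤ V) {b : ∀ x : V, Polar (D.ideal x.1)}
    (hb : IsPolarFunction D b) : IsPolarFunction D fun x : W => b ⟨x.1, h x.2⟩ := by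
  refine LocallyOn.res h hb ?_
  rintro W W' h h' ⟨g, s, hgs⟩
  refine ⟨Regular.res h' g, Regular.res h' s, fun x => ?_⟩
  rw [germAt_res, germAt_res]
  exact hgs ⟨x.1, h' x.2⟩

theorem IsPolarFunction.mul {V : Opens X} {b c : ∀ x : V, Polar (D.ideal x.1)}
    (hb : IsPolarFunction D b) (hc : IsPolarFunction D c) : IsPolarFunction D (b * c) := by
  intro x
  obtain ⟨W, hW, hx, g, s, hgs⟩ := hb x
  obtain ⟨W', hW', hx', g', s', hgs'⟩ := hc x
  refine ⟨W ⊓ W', inf_le_left.trans hW, ⟨hx, hx'⟩,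
    Regular.res inf_le_left g * Regular.res inf_le_right g',
    Regular.res inf_le_left s * Regular.res inf_le_right s', fun y => ?_⟩
  have h1 := hgs ⟨y.1, y.2.1⟩
  have h2 := hgs' ⟨y.1, y.2.2⟩
  simp only [germAt, map_mul]
  rw [← germAt, ← germAt, ← germAt, ← germAt, germAt_res, germAt_res, germAt_res, germAt_res]
  refine ⟨mul_mem h1.1 h2.1, ?_⟩
  rw [← h1.2, ← h2.2, Pi.mul_apply]
  ring

theorem isPoleForm_restricts : Restricts (F := fun x => PoleForms k (D.ideal x)) (fun W => {v |
    ∃ (b : ∀ x : W, lineBundle (D.ideal x.1)) (g : Regular X W),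
      (IsPolarFunction D fun x => (b x : Polar (D.ideal x.1))) ∧
      v = fun x => b x ⊗ₜ[Stalk X x.1]
        (Submodule.Quotient.mk (KaehlerDifferential.D k (Stalk X x.1) (germAt g x)) :
          OneForms k (Stalk X x.1))}) := by
  rintro W W' h _ ⟨b, g, hb, rfl⟩
  refine ⟨fun x => b ⟨x.1, h x.2⟩, Regular.res h g, hb.res h, ?_⟩
  simp only [germAt_res]

theorem isPolarForm_restricts (q : ℕ) :
    Restricts (F := fun x => PolarForms k (D.ideal x)) (fun W => {v |
    ∃ (b : ∀ x : W, Polar (D.ideal x.1)) (g : Fin q → Regular X W), IsPolarFunction D b ∧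
      v = fun x => b x • (List.ofFn fun j => polarD k (D.ideal x.1)
        (algebraMap _ (PolarForms k (D.ideal x.1)) (germAt (g j) x))).prod}) := by
  rintro W W' h _ ⟨b, g, hb, rfl⟩
  refine ⟨fun x => b ⟨x.1, h x.2⟩, fun j => Regular.res h (g j), hb.res h, ?_⟩
  simp only [germAt_res]

theorem poleToPolar_tmul_D {A : Type u} [CommRing A] [IsLocalRing A] [Algebra k A] (I : Ideal A)
    (b : lineBundle I) (f : A) :
    poleToPolar k I (b ⊗ₜ[A] (Submodule.Quotient.mk (KaehlerDifferential.D k A f) :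
      OneForms k A)) = (b : Polar I) • polarD k I (algebraMap A _ f) := by
  rw [polarD_algebraMap, poleD, poleToPolar_tmul, poleToPolar_tmul, Algebra.smul_def]
  simp

theorem IsPoleForm.mul_generator {V : Opens X} (b : ∀ x : V, lineBundle (D.ideal x.1))
    (g : Regular X V) (hb : IsPolarFunction D fun x => (b x : Polar (D.ideal x.1)))
    {w : ∀ x : V, PoleForms k (D.ideal x.1)} (hw : IsPoleForm k D w) :
    IsPolarForm k D 2 fun x => poleToPolar k _ (b x ⊗ₜ[Stalk X x.1] (Submodule.Quotient.mk
      (KaehlerDifferential.D k (Stalk X x.1) (germAt g x)) : OneForms k (Stalk X x.1))) *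
        poleToPolar k _ (w x) := by
  let f : ∀ x : V, PoleForms k (D.ideal x.1) →+ PolarForms k (D.ideal x.1) := fun x =>
    (AddMonoidHom.mulLeft (poleToPolar k (D.ideal x.1) (b x ⊗ₜ[Stalk X x.1]
      (Submodule.Quotient.mk (KaehlerDifferential.D k (Stalk X x.1) (germAt g x)) :
        OneForms k (Stalk X x.1))))).comp (poleToPolar k (D.ideal x.1)).toAddMonoidHom
  refine LocallySum.map (F := fun x => PoleForms k (D.ideal x))
    (F' := fun x => PolarForms k (D.ideal x)) (isPolarForm_restricts 2) f ?_ hw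
  rintro W h _ ⟨b', g', hb', rfl⟩
  refine LocallySum.of_mem ⟨_, ![Regular.res h g, g'], (hb.res h).mul hb', ?_⟩
  funext x
  simp [f, poleToPolar_tmul_D, germAt_res, mul_smul, -mul_eq_mul_left_iff]
  rw [smul_comm]

theorem IsPoleForm.mul {V : Opens X} {v w : ∀ x : V, PoleForms k (D.ideal x.1)}
    (hv : IsPoleForm k D v) (hw : IsPoleForm k D w) :
    IsPolarForm k D 2 fun x => poleToPolar k _ (v x) * poleToPolar k _ (w x) := by
  let f : ∀ x : V, PoleForms k (D.ideal x.1) →+ PolarForms k (D.ideal x.1) := fun x =>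
    (AddMonoidHom.mulRight (poleToPolar k (D.ideal x.1) (w x))).comp
      (poleToPolar k (D.ideal x.1)).toAddMonoidHom
  refine LocallySum.map (F := fun x => PoleForms k (D.ideal x))
    (F' := fun x => PolarForms k (D.ideal x)) (isPolarForm_restricts 2) f ?_ hv
  rintro W h _ ⟨b, g, hb, rfl⟩
  exact IsPoleForm.mul_generator b g hb (hw.res isPoleForm_restricts h)

end Forms

theorem germAt_sub {V : Opens X} (f g : Regular X V) (x : V) :
    germAt (f - g) x = germAt f x - germAt g x := map_sub _ _ _

section Bundles
variable {D : EffectiveCartierDivisor X} {n : ℕ} (E : VectorBundle X n)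

theorem VectorBundle.res {V W : Opens X} (h : W ≤ V) {s : ∀ x : V, E.fiber x.1}
    (hs : E.sheaf.pred s) : E.sheaf.pred fun x : W => s ⟨x.1, h x.2⟩ :=
  E.sheaf.res (homOfLE h) s hs

theorem VectorBundle.of_local {V : Opens X} {s : ∀ x : V, E.fiber x.1}
    (hs : LocallyOn V fun W h => E.sheaf.pred fun x : W => s ⟨x.1, h x.2⟩) : E.sheaf.pred s := by
  refine E.sheaf.locality s fun x => ?_
  obtain ⟨W, h, hx, hW⟩ := hs x
  exact ⟨W, hx, homOfLE h, hW⟩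

theorem VectorBundle.zero_pred {V : Opens X} : E.sheaf.pred fun x : V => (0 : E.fiber x.1) := by
  refine E.of_local fun x => ?_
  obtain ⟨W, hx, r, e, -, he⟩ := E.locally_free x.1
  refine ⟨W ⊓ V, inf_le_right, ⟨hx, x.2⟩, (he _ inf_le_left _).2 fun y => ?_⟩
  exact ⟨W ⊓ V, le_rfl, y.2, fun _ _ => 0, fun z => by simp [germAt]⟩

theorem VectorBundle.sub_pred {V : Opens X} {s t : ∀ x : V, E.fiber x.1}
    (hs : E.sheaf.pred s) (ht : E.sheaf.pred t) : E.sheaf.pred fun x : V => s x - t x := by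
  refine E.of_local fun x => ?_
  obtain ⟨W, hx, r, e, -, he⟩ := E.locally_free x.1
  refine ⟨W ⊓ V, inf_le_right, ⟨hx, x.2⟩, (he _ inf_le_left _).2 fun y => ?_⟩
  obtain ⟨W1, h1, hy1, c1, hc1⟩ := (he _ inf_le_left _).1 (E.res (inf_le_right : W ⊓ V ≤ V) hs) y
  obtain ⟨W2, h2, hy2, c2, hc2⟩ := (he _ inf_le_left _).1 (E.res (inf_le_right : W ⊓ V ≤ V) ht) y
  refine ⟨W1 ⊓ W2, inf_le_left.trans h1, ⟨hy1, hy2⟩, fun i j => Regular.res inf_le_left (c1 i j)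
    - Regular.res inf_le_right (c2 i j), fun z => ?_⟩
  have e1 := hc1 ⟨z.1, z.2.1⟩
  have e2 := hc2 ⟨z.1, z.2.2⟩
  simp only at e1 e2
  rw [e1, e2, ← Finset.sum_sub_distrib]
  refine Finset.sum_congr rfl fun i _ => ?_
  rw [← Finset.sum_sub_distrib]
  refine Finset.sum_congr rfl fun j _ => ?_
  rw [germAt_sub, germAt_res, germAt_res, sub_smul]

theorem VectorBundle.neg_pred {V : Opens X} {s : ∀ x : V, E.fiber x.1}
    (hs : E.sheaf.pred s) : E.sheaf.pred fun x : V => - s x := by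
  simpa using E.sub_pred E.zero_pred hs

theorem VectorBundle.add_pred {V : Opens X} {s t : ∀ x : V, E.fiber x.1}
    (hs : E.sheaf.pred s) (ht : E.sheaf.pred t) : E.sheaf.pred fun x : V => s x + t x := by
  simpa using E.sub_pred hs (E.neg_pred ht)

theorem isPoleValued_restricts :
    Restricts (F := fun x => PoleValued k (D.ideal x) (E.fiber x)) (fun W => {v |
    ∃ (s : ∀ x : W, E.fiber x.1) (w : ∀ x : W, PoleForms k (D.ideal x.1)),
      E.sheaf.pred s ∧ IsPoleForm k D w ∧ v = fun x => s x ⊗ₜ[Stalk X x.1] w x}) := by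
  rintro W W' h _ ⟨s, w, hs, hw, rfl⟩
  exact ⟨_, _, E.res h hs, hw.res isPoleForm_restricts h, rfl⟩

theorem isPolarValued_restricts (q : ℕ) :
    Restricts (F := fun x => PolarValued k (D.ideal x) (E.fiber x)) (fun W => {v |
    ∃ (s : ∀ x : W, E.fiber x.1) (w : ∀ x : W, PolarForms k (D.ideal x.1)),
      E.sheaf.pred s ∧ IsPolarForm k D q w ∧ v = fun x => s x ⊗ₜ[Stalk X x.1] w x}) := by
  rintro W W' h _ ⟨s, w, hs, hw, rfl⟩
  exact ⟨_, _, E.res h hs, hw.res (isPolarForm_restricts q) h, rfl⟩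

end Bundles

end SectionLemmas

section Cech
variable {X : LocallyRingedSpace.{u}}

/-- Open coverings of `X`, indexed by the points of `X`: an open neighbourhood of every point. A
larger covering in this order is a finer one. Every open covering is refined by one of these. -/
abbrev Covering (X : LocallyRingedSpace.{u}) : Type u := (∀ x : X, OpenNhdsOf x)ᵒᵈ

/-- The member of a covering with index `x`. -/
def Covering.nhd (U : Covering X) (x : X) : Opens X := (OrderDual.ofDual U x).toOpens

/-- The intersection of the members with indices `i₀, …, i_p`. -/
def Covering.inter (U : Covering X) {p : ℕ} (i : Fin (p + 1) → X) : Opens X where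
  carrier := {x | ∀ j, x ∈ U.nhd (i j)}
  is_open' := by
    simp only [Set.ofPred_forall]
    exact isOpen_iInter_of_finite fun j => (U.nhd (i j)).isOpen

theorem Covering.inter_mono {U V : Covering X} (h : U ≤ V) {p : ℕ} (i : Fin (p + 1) → X) :
    V.inter i ≤ U.inter i := fun _ hx l => h (i l) (hx l)

/-- Čech cochains of degree `p`, as families of germs. -/
abbrev Cochain (U : Covering X) (p : ℕ) (F : X → Type u) : Type u :=
  ∀ (i : Fin (p + 1) → X) (x : U.inter i), F x.1

variable {F : X → Type u} [∀ x, AddCommGroup (F x)]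

/-- The Čech differential. -/
def cechD (U : Covering X) (p : ℕ) : Cochain U p F →+ Cochain U (p + 1) F where
  toFun c i x := ∑ j : Fin (p + 2), (-1 : ℤ) ^ (j : ℕ) •
    c (i ∘ j.succAbove) ⟨x.1, fun l => x.2 (j.succAbove l)⟩
  map_zero' := by ext i x; simp
  map_add' c d := by ext i x; simp [Finset.sum_add_distrib]

/-- Restriction of cochains to a finer covering. -/
def Cochain.restrict {U V : Covering X} (h : U ≤ V) (p : ℕ) : Cochain U p F →+ Cochain V p F where
  toFun c i x := c i ⟨x.1, fun l => h (i l) (x.2 l)⟩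
  map_zero' := rfl
  map_add' _ _ := rfl

theorem cechD_restrict {U V : Covering X} (h : U ≤ V) (p : ℕ) (c : Cochain U p F) :
    cechD V p (Cochain.restrict h p c) = Cochain.restrict h (p + 1) (cechD U p c) := rfl

/-- Pointwise application of additive maps to cochains. -/
def Cochain.map {G : X → Type u} [∀ x, AddCommGroup (G x)] (U : Covering X) (p : ℕ)
    (f : ∀ x, F x →+ G x) : Cochain U p F →+ Cochain U p G where
  toFun c i x := f x.1 (c i x)
  map_zero' := by ext i x; simp
  map_add' c d := by ext i x; simp

theorem Cochain.map_restrict {G : X → Type u} [∀ x, AddCommGroup (G x)] {U V : Covering X}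
    (h : U ≤ V) (p : ℕ) (f : ∀ x, F x →+ G x) (c : Cochain U p F) :
    Cochain.map V p f (Cochain.restrict h p c) = Cochain.restrict h p (Cochain.map U p f c) := rfl

end Cech

section Hypercohomology
variable {k : Type u} [Field k] {X : LocallyRingedSpace.{u}} [SpaceOver k X]
  {D : EffectiveCartierDivisor X} (P : IntegrableConnection k D 0)

/-- The stalks of `ℛ⁰ = ℰnd(ℰ)`. -/
abbrev EndZero (x : X) : Type u := P.bundle.fiber x →ₗ[Stalk X x] P.bundle.fiber x

/-- The stalks of `ℛ¹ = ℰnd(ℰ) ⊗ Ω¹(D)`. -/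
abbrev EndOne (x : X) : Type u :=
  P.bundle.fiber x →ₗ[Stalk X x] PoleValued k (D.ideal x) (P.bundle.fiber x)

/-- The stalks of `⨁ ℰnd(ℰ) ⊗ Ω^q(*D)`, which contain those of `ℛ²` and `ℛ³`. -/
abbrev EndPolar (x : X) : Type u :=
  P.bundle.fiber x →ₗ[Stalk X x] PolarValued k (D.ideal x) (P.bundle.fiber x)

/-- The sections of `ℛ⁰ = ℰnd(ℰ)`. -/
def IsEndZero {V : Opens X} (a : ∀ x : V, EndZero P x.1) : Prop :=
  ∀ (W : Opens X) (h : W ≤ V) (s : ∀ x : W, P.bundle.fiber x.1), P.bundle.sheaf.pred s →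
    P.bundle.sheaf.pred fun x : W => a ⟨x.1, h x.2⟩ (s x)

/-- The sections of `ℛ¹ = ℰnd(ℰ) ⊗ Ω¹(D) = ℋom(ℰ, ℰ ⊗ Ω¹(D))`. -/
def IsEndOne {V : Opens X} (a : ∀ x : V, EndOne P x.1) : Prop :=
  ∀ (W : Opens X) (h : W ≤ V) (s : ∀ x : W, P.bundle.fiber x.1), P.bundle.sheaf.pred s →
    IsPoleValued k D P.bundle fun x : W => a ⟨x.1, h x.2⟩ (s x)

/-- The sections of `ℰnd(ℰ) ⊗ Ω^q(*D) = ℋom(ℰ, ℰ ⊗ Ω^q(*D))`, that is, of `ℛ^q` if `q ≥ 2`. -/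
def IsEndPolar (q : ℕ) {V : Opens X} (a : ∀ x : V, EndPolar P x.1) : Prop :=
  ∀ (W : Opens X) (h : W ≤ V) (s : ∀ x : W, P.bundle.fiber x.1), P.bundle.sheaf.pred s →
    IsPolarValued k D P.bundle q fun x : W => a ⟨x.1, h x.2⟩ (s x)

variable (U : Covering X)

/-- Families of germs of degree one: `C¹(ℛ⁰) × C⁰(ℛ¹)`. -/
abbrev FamilyOne : Type u := Cochain U 1 (EndZero P) × Cochain U 0 (EndOne P)

/-- Families of germs of degree two: `C²(ℛ⁰) × C¹(ℛ¹) × C⁰(ℛ²)`. -/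
abbrev FamilyTwo : Type u :=
  Cochain U 2 (EndZero P) × Cochain U 1 (EndOne P) × Cochain U 0 (EndPolar P)

/-- Families of germs of degree three: `C³(ℛ⁰) × C²(ℛ¹) × C¹(ℛ²) × C⁰(ℛ³)`. -/
abbrev FamilyThree : Type u :=
  Cochain U 3 (EndZero P) × Cochain U 2 (EndOne P) × Cochain U 1 (EndPolar P) ×
    Cochain U 0 (EndPolar P)

section Membership
variable {P} {V : Opens X}

theorem IsEndZero.res {W : Opens X} (h : W ≤ V) {a : ∀ x : V, EndZero P x.1} (ha : IsEndZero P a) :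
    IsEndZero P fun x : W => a ⟨x.1, h x.2⟩ :=
  fun W' h' s hs => ha W' (h'.trans h) s hs

theorem IsEndOne.res {W : Opens X} (h : W ≤ V) {a : ∀ x : V, EndOne P x.1} (ha : IsEndOne P a) :
    IsEndOne P fun x : W => a ⟨x.1, h x.2⟩ :=
  fun W' h' s hs => ha W' (h'.trans h) s hs

theorem IsEndPolar.res {q : ℕ} {W : Opens X} (h : W ≤ V) {a : ∀ x : V, EndPolar P x.1}
    (ha : IsEndPolar P q a) : IsEndPolar P q fun x : W => a ⟨x.1, h x.2⟩ :=
  fun W' h' s hs => ha W' (h'.trans h) s hs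

theorem IsEndZero.comp {a b : ∀ x : V, EndZero P x.1} (ha : IsEndZero P a) (hb : IsEndZero P b) :
    IsEndZero P fun x => (a x).comp (b x) :=
  fun W h s hs => ha W h _ (hb W h s hs)

theorem IsEndOne.zeroMulOne {a : ∀ x : V, EndZero P x.1} {b : ∀ x : V, EndOne P x.1}
    (ha : IsEndZero P a) (hb : IsEndOne P b) : IsEndOne P fun x => zeroMulOne (a x) (b x) := by
  intro W h s hs
  refine LocallySum.map (isPoleValued_restricts P.bundle)
    (fun x : W => (LinearMap.rTensor (PoleForms k (D.ideal x.1)) (a ⟨x.1, h x.2⟩)).toAddMonoidHom)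
    ?_ (hb W h s hs)
  rintro W' h' _ ⟨t, w, ht, hw, rfl⟩
  exact LocallySum.of_mem ⟨_, w, ha W' (h'.trans h) t ht, hw, rfl⟩

theorem IsEndOne.oneMulZero {a : ∀ x : V, EndOne P x.1} {b : ∀ x : V, EndZero P x.1}
    (ha : IsEndOne P a) (hb : IsEndZero P b) : IsEndOne P fun x => oneMulZero (a x) (b x) :=
  fun W h s hs => ha W h _ (hb W h s hs)

theorem IsEndOne.oneMulOne {a b : ∀ x : V, EndOne P x.1} (ha : IsEndOne P a) (hb : IsEndOne P b) :
    IsEndPolar P 2 fun x => oneMulOne (a x) (b x) := by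
  intro W h s hs
  refine LocallySum.map (isPolarValued_restricts P.bundle 2)
    (fun x : W => ((act (toPolarEnd (a ⟨x.1, h x.2⟩))).comp
      (valuedToPolar k (D.ideal x.1) (P.bundle.fiber x.1))).toAddMonoidHom) ?_ (hb W h s hs)
  rintro W' h' _ ⟨t, w, ht, hw, rfl⟩
  refine LocallySum.map (isPolarValued_restricts P.bundle 2)
    (fun x : W' => ((wedge k (D.ideal x.1) (P.bundle.fiber x.1)
      (poleToPolar k (D.ideal x.1) (w x))).comp
      (valuedToPolar k (D.ideal x.1) (P.bundle.fiber x.1))).toAddMonoidHom) ?_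
      (ha W' (h'.trans h) t ht)
  rintro W'' h'' _ ⟨u, v, hu, hv, rfl⟩
  exact LocallySum.of_mem ⟨u, _, hu, hv.mul (hw.res isPoleForm_restricts h''), rfl⟩

theorem IsEndZero.neg {a : ∀ x : V, EndZero P x.1} (ha : IsEndZero P a) : IsEndZero P (-a) :=
  fun W h s hs => P.bundle.neg_pred (ha W h s hs)

theorem IsEndZero.add {a b : ∀ x : V, EndZero P x.1} (ha : IsEndZero P a) (hb : IsEndZero P b) :
    IsEndZero P (a + b) :=
  fun W h s hs => P.bundle.add_pred (ha W h s hs) (hb W h s hs)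

theorem IsEndOne.neg {a : ∀ x : V, EndOne P x.1} (ha : IsEndOne P a) : IsEndOne P (-a) :=
  fun W h s hs => LocallySum.neg (ha W h s hs)

theorem IsEndOne.add {a b : ∀ x : V, EndOne P x.1} (ha : IsEndOne P a) (hb : IsEndOne P b) :
    IsEndOne P (a + b) :=
  fun W h s hs => LocallySum.add (isPoleValued_restricts P.bundle) (ha W h s hs) (hb W h s hs)

theorem IsEndPolar.add {q : ℕ} {a b : ∀ x : V, EndPolar P x.1} (ha : IsEndPolar P q a)
    (hb : IsEndPolar P q b) : IsEndPolar P q (a + b) :=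
  fun W h s hs => LocallySum.add (isPolarValued_restricts P.bundle q) (ha W h s hs) (hb W h s hs)

end Membership

/-- The group `C^p(ℛ⁰)` of Čech cochains. -/
def cochainsZero (p : ℕ) : AddSubgroup (Cochain U p (EndZero P)) where
  carrier := {c | ∀ i, IsEndZero P (c i)}
  zero_mem' _ _ _ _ _ := P.bundle.zero_pred
  add_mem' hc hd i := (hc i).add (hd i)
  neg_mem' hc i := (hc i).neg

/-- The group `C^p(ℛ¹)` of Čech cochains. -/
def cochainsOne (p : ℕ) : AddSubgroup (Cochain U p (EndOne P)) where
  carrier := {c | ∀ i, IsEndOne P (c i)}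
  zero_mem' _ _ _ _ _ := LocallySum.zero
  add_mem' hc hd i := (hc i).add (hd i)
  neg_mem' hc i := (hc i).neg

/-- The group `C^p(ℛ²)` of Čech cochains. -/
def cochainsTwo (p : ℕ) : AddSubgroup (Cochain U p (EndPolar P)) where
  carrier := {c | ∀ i, IsEndPolar P 2 (c i)}
  zero_mem' _ _ _ _ _ := LocallySum.zero
  add_mem' hc hd i := (hc i).add (hd i)
  neg_mem' hc i := fun W h s hs => LocallySum.neg (hc i W h s hs)

/-- The total complex in degree one. -/
def totalOne : AddSubgroup (FamilyOne P U) := (cochainsZero P U 1).prod (cochainsOne P U 0)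

/-- The total complex in degree two. -/
def totalTwo : AddSubgroup (FamilyTwo P U) :=
  (cochainsZero P U 2).prod ((cochainsOne P U 1).prod (cochainsTwo P U 0))

/-- The differential `ℛ⁰ → ℛ¹` on cochains. -/
def endZeroD (p : ℕ) : Cochain U p (EndZero P) →+ Cochain U p (EndOne P) :=
  Cochain.map U p fun x => (P.nabla x).endZeroHom

/-- The differential `ℛ¹ → ℛ²` on cochains. -/
def endOneD (p : ℕ) : Cochain U p (EndOne P) →+ Cochain U p (EndPolar P) :=
  Cochain.map U p fun x => (P.nabla x).endOneHom

/-- The differential `ℛ² → ℛ³` on cochains. -/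
def endTwoD (p : ℕ) : Cochain U p (EndPolar P) →+ Cochain U p (EndPolar P) :=
  Cochain.map U p fun x => (P.nabla x).endFormHom

/-- The total differential `δ + (-1)^p d` in degree zero. -/
def totalDZero : Cochain U 0 (EndZero P) →+ FamilyOne P U :=
  (cechD U 0).prod (endZeroD P U 0)

/-- The total differential `δ + (-1)^p d` in degree one. -/
def totalDOne : FamilyOne P U →+ FamilyTwo P U where
  toFun z := (cechD U 1 z.1, cechD U 0 z.2 - endZeroD P U 1 z.1, endOneD P U 0 z.2)
  map_zero' := by simp
  map_add' z w := by
    simp only [Prod.fst_add, Prod.snd_add, map_add, Prod.mk_add_mk]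
    congr 2
    abel

/-- The total differential `δ + (-1)^p d` in degree two. -/
def totalDTwo : FamilyTwo P U →+ FamilyThree P U where
  toFun z := (cechD U 2 z.1, cechD U 1 z.2.1 + endZeroD P U 2 z.1,
    cechD U 0 z.2.2 - endOneD P U 1 z.2.1, endTwoD P U 0 z.2.2)
  map_zero' := by simp
  map_add' z w := by
    simp only [Prod.fst_add, Prod.snd_add, map_add, Prod.mk_add_mk]
    congr 2
    · abel
    · congr 1
      abel

/-- The group of cocycles of degree one. -/
def cocyclesOne : AddSubgroup (FamilyOne P U) := totalOne P U ⊓ (totalDOne P U).ker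

/-- The group of coboundaries of degree one. -/
def coboundariesOne : AddSubgroup (FamilyOne P U) := (cochainsZero P U 0).map (totalDZero P U)

/-- The group of cocycles of degree two. -/
def cocyclesTwo : AddSubgroup (FamilyTwo P U) := totalTwo P U ⊓ (totalDTwo P U).ker

/-- The group of coboundaries of degree two. -/
def coboundariesTwo : AddSubgroup (FamilyTwo P U) := (totalOne P U).map (totalDOne P U)

/-- The Čech hypercohomology group `ℍ¹(𝔘, ℛ•)` of the covering. -/
def CechOne : Type u := cocyclesOne P U ⧸ (coboundariesOne P U).addSubgroupOf (cocyclesOne P U)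

instance : AddCommGroup (CechOne P U) := inferInstanceAs (AddCommGroup
  (cocyclesOne P U ⧸ (coboundariesOne P U).addSubgroupOf (cocyclesOne P U)))

/-- The class of a cocycle of degree one. -/
def cechOneClass : cocyclesOne P U →+ CechOne P U :=
  QuotientAddGroup.mk' ((coboundariesOne P U).addSubgroupOf (cocyclesOne P U))

theorem cechOneClass_surjective : Function.Surjective (cechOneClass P U) :=
  QuotientAddGroup.mk'_surjective _

theorem cechOneClass_eq_zero (z : cocyclesOne P U) :
    cechOneClass P U z = 0 ↔ (z : FamilyOne P U) ∈ coboundariesOne P U :=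
  QuotientAddGroup.eq_zero_iff z

/-- The Čech hypercohomology group `ℍ²(𝔘, ℛ•)` of the covering. -/
def CechTwo : Type u := cocyclesTwo P U ⧸ (coboundariesTwo P U).addSubgroupOf (cocyclesTwo P U)

instance : AddCommGroup (CechTwo P U) := inferInstanceAs (AddCommGroup
  (cocyclesTwo P U ⧸ (coboundariesTwo P U).addSubgroupOf (cocyclesTwo P U)))

/-- The class of a cocycle of degree two. -/
def cechTwoClass : cocyclesTwo P U →+ CechTwo P U :=
  QuotientAddGroup.mk' ((coboundariesTwo P U).addSubgroupOf (cocyclesTwo P U))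

theorem cechTwoClass_surjective : Function.Surjective (cechTwoClass P U) :=
  QuotientAddGroup.mk'_surjective _

theorem cechTwoClass_eq_zero (z : cocyclesTwo P U) :
    cechTwoClass P U z = 0 ↔ (z : FamilyTwo P U) ∈ coboundariesTwo P U :=
  QuotientAddGroup.eq_zero_iff z

section Refinement
variable {U} {V : Covering X} (h : U ≤ V)

/-- Restriction to a finer covering in degree one. -/
def familyOneRestrict : FamilyOne P U →+ FamilyOne P V :=
  (Cochain.restrict h 1).prodMap (Cochain.restrict h 0)

/-- Restriction to a finer covering in degree two. -/
def familyTwoRestrict : FamilyTwo P U →+ FamilyTwo P V :=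
  (Cochain.restrict h 2).prodMap ((Cochain.restrict h 1).prodMap (Cochain.restrict h 0))

theorem familyOneRestrict_mem {z : FamilyOne P U} (hz : z ∈ totalOne P U) :
    familyOneRestrict P h z ∈ totalOne P V :=
  ⟨fun i => (hz.1 i).res (Covering.inter_mono h i), fun i => (hz.2 i).res (Covering.inter_mono h i)⟩

theorem familyTwoRestrict_mem {z : FamilyTwo P U} (hz : z ∈ totalTwo P U) :
    familyTwoRestrict P h z ∈ totalTwo P V :=
  ⟨fun i => (hz.1 i).res (Covering.inter_mono h i), fun i => (hz.2.1 i).res (Covering.inter_mono h i),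
    fun i => (hz.2.2 i).res (Covering.inter_mono h i)⟩

theorem totalDOne_restrict (z : FamilyOne P U) :
    totalDOne P V (familyOneRestrict P h z) = familyTwoRestrict P h (totalDOne P U z) := rfl

theorem totalDTwo_restrict_zero {z : FamilyTwo P U} (hz : totalDTwo P U z = 0) :
    totalDTwo P V (familyTwoRestrict P h z) = 0 := by
  have e : totalDTwo P V (familyTwoRestrict P h z) =
      (Cochain.restrict h 3 (totalDTwo P U z).1, Cochain.restrict h 2 (totalDTwo P U z).2.1,
        Cochain.restrict h 1 (totalDTwo P U z).2.2.1,
        Cochain.restrict h 0 (totalDTwo P U z).2.2.2) := rfl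
  rw [e, hz]
  rfl

/-- Restriction of cocycles to a finer covering in degree one. -/
def cocyclesOneRestrict : cocyclesOne P U →+ cocyclesOne P V :=
  ((familyOneRestrict P h).comp (cocyclesOne P U).subtype).codRestrict _ fun z =>
    ⟨familyOneRestrict_mem P h z.2.1, (congrArg (familyTwoRestrict P h) z.2.2 :
      familyTwoRestrict P h (totalDOne P U z) = familyTwoRestrict P h 0).trans (map_zero _)⟩

/-- Restriction of cocycles to a finer covering in degree two. -/
def cocyclesTwoRestrict : cocyclesTwo P U →+ cocyclesTwo P V :=
  ((familyTwoRestrict P h).comp (cocyclesTwo P U).subtype).codRestrict _ fun z =>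
    ⟨familyTwoRestrict_mem P h z.2.1, totalDTwo_restrict_zero P h z.2.2⟩

/-- Restriction of cohomology classes to a finer covering in degree one. -/
def cechOneRestrict : CechOne P U →+ CechOne P V :=
  QuotientAddGroup.map ((coboundariesOne P U).addSubgroupOf (cocyclesOne P U))
    ((coboundariesOne P V).addSubgroupOf (cocyclesOne P V)) (cocyclesOneRestrict P h) <| by
    rintro z ⟨c, hc, hz⟩
    exact ⟨Cochain.restrict h 0 c, fun i => (hc i).res (Covering.inter_mono h i),
      congrArg (familyOneRestrict P h) hz⟩

/-- Restriction of cohomology classes to a finer covering in degree two. -/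
def cechTwoRestrict : CechTwo P U →+ CechTwo P V :=
  QuotientAddGroup.map ((coboundariesTwo P U).addSubgroupOf (cocyclesTwo P U))
    ((coboundariesTwo P V).addSubgroupOf (cocyclesTwo P V)) (cocyclesTwoRestrict P h) <| by
    rintro z ⟨c, hc, hz⟩
    exact ⟨familyOneRestrict P h c, familyOneRestrict_mem P h hc,
      congrArg (familyTwoRestrict P h) hz⟩

end Refinement

instance : DirectedSystem (CechOne P) (fun _ _ h => cechOneRestrict P h) where
  map_self U z := by
    obtain ⟨z, rfl⟩ := cechOneClass_surjective P U z
    rfl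
  map_map _ _ U _ _ z := by
    obtain ⟨z, rfl⟩ := cechOneClass_surjective P U z
    rfl

instance : DirectedSystem (CechTwo P) (fun _ _ h => cechTwoRestrict P h) where
  map_self U z := by
    obtain ⟨z, rfl⟩ := cechTwoClass_surjective P U z
    rfl
  map_map _ _ U _ _ z := by
    obtain ⟨z, rfl⟩ := cechTwoClass_surjective P U z
    rfl

/-- The hypercohomology group `ℍ¹(X, ℛ•)`: the direct limit over the coverings. -/
def HyperOne : Type u := DirectLimit (CechOne P) (fun _ _ h => cechOneRestrict P h)

/-- The hypercohomology group `ℍ²(X, ℛ•)`: the direct limit over the coverings. -/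
def HyperTwo : Type u := DirectLimit (CechTwo P) (fun _ _ h => cechTwoRestrict P h)

/-- The class in `ℍ¹(X, ℛ•)` of a cocycle. -/
def hyperOneClass (z : cocyclesOne P U) : HyperOne P := ⟦⟨U, cechOneClass P U z⟩⟧

/-- The class in `ℍ²(X, ℛ•)` of a cocycle. -/
def hyperTwoClass (z : cocyclesTwo P U) : HyperTwo P := ⟦⟨U, cechTwoClass P U z⟩⟧

instance : AddCommGroup (HyperOne P) := inferInstanceAs (AddCommGroup
  (DirectLimit (CechOne P) (fun _ _ h => cechOneRestrict P h)))

instance : AddCommGroup (HyperTwo P) := inferInstanceAs (AddCommGroup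
  (DirectLimit (CechTwo P) (fun _ _ h => cechTwoRestrict P h)))

theorem hyperTwoClass_zero : hyperTwoClass P U 0 = 0 := by
  have e : hyperTwoClass P U 0 + hyperTwoClass P U 0 = hyperTwoClass P U 0 := by
    refine (DirectLimit.add_def (f := fun _ _ h => cechTwoRestrict P h) U
      (cechTwoClass P U 0) (cechTwoClass P U 0)).trans ?_
    rw [← map_add, add_zero]
    rfl
  exact left_eq_add.1 e.symm

end Hypercohomology

section Bilinear
variable {k : Type u} [Field k] {A : Type u} [CommRing A] [IsLocalRing A] [Algebra k A]
  {I : Ideal A} {M : Type u} [AddCommGroup M] [Module A M]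

theorem formMul_add_right (P Q Q' : M →ₗ[A] PolarValued k I M) :
    formMul P (Q + Q') = formMul P Q + formMul P Q' := LinearMap.comp_add _ _ _

theorem formMul_neg_right (P Q : M →ₗ[A] PolarValued k I M) :
    formMul P (-Q) = -formMul P Q := LinearMap.comp_neg _ _

theorem formMul_add_left (P P' Q : M →ₗ[A] PolarValued k I M) :
    formMul (P + P') Q = formMul P Q + formMul P' Q := by
  ext m
  simp [formMul, act_add]

theorem zeroMulOne_add_left (a a' : M →ₗ[A] M) (P : M →ₗ[A] PoleValued k I M) :
    zeroMulOne (a + a') P = zeroMulOne a P + zeroMulOne a' P := by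
  ext m
  simp [zeroMulOne, LinearMap.rTensor_add]

theorem zeroMulOne_add_right (a : M →ₗ[A] M) (P P' : M →ₗ[A] PoleValued k I M) :
    zeroMulOne a (P + P') = zeroMulOne a P + zeroMulOne a P' := LinearMap.comp_add _ _ _

theorem oneMulZero_add_left (P P' : M →ₗ[A] PoleValued k I M) (a : M →ₗ[A] M) :
    oneMulZero (P + P') a = oneMulZero P a + oneMulZero P' a := rfl

theorem oneMulZero_add_right (P : M →ₗ[A] PoleValued k I M) (a a' : M →ₗ[A] M) :
    oneMulZero P (a + a') = oneMulZero P a + oneMulZero P a' := LinearMap.comp_add _ _ _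

theorem toPolarEnd_add (P P' : M →ₗ[A] PoleValued k I M) :
    toPolarEnd (P + P') = toPolarEnd P + toPolarEnd P' := LinearMap.comp_add _ _ _

theorem oneMulOne_add_left (P P' Q : M →ₗ[A] PoleValued k I M) :
    oneMulOne (P + P') Q = oneMulOne P Q + oneMulOne P' Q := by
  rw [oneMulOne, toPolarEnd_add, formMul_add_left]; rfl

theorem oneMulOne_add_right (P Q Q' : M →ₗ[A] PoleValued k I M) :
    oneMulOne P (Q + Q') = oneMulOne P Q + oneMulOne P Q' := by
  rw [oneMulOne, toPolarEnd_add, formMul_add_right]; rfl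

end Bilinear

section Faces
variable {X : LocallyRingedSpace.{u}} {F : X → Type u} [∀ x, AddCommGroup (F x)] {U : Covering X}

theorem Covering.inter_face (U : Covering X) {p q : ℕ} (f : Fin (p + 1) → Fin (q + 1))
    (i : Fin (q + 1) → X) : U.inter i ≤ U.inter (i ∘ f) := fun _ hx l => hx (f l)

/-- The cochain `i ↦ c (i ∘ f)`. -/
def Cochain.face {p q : ℕ} (f : Fin (p + 1) → Fin (q + 1)) (c : Cochain U p F) : Cochain U q F :=
  fun i x => c (i ∘ f) ⟨x.1, fun l => x.2 (f l)⟩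

theorem Cochain.face_face {p q r : ℕ} (f : Fin (p + 1) → Fin (q + 1))
    (g : Fin (q + 1) → Fin (r + 1)) (c : Cochain U p F) :
    Cochain.face g (Cochain.face f c) = Cochain.face (g ∘ f) c := rfl

theorem cechD_eq (p : ℕ) (c : Cochain U p F) (i : Fin (p + 2) → X) (x : U.inter i) :
    cechD U p c i x = ∑ j : Fin (p + 2), (-1 : ℤ) ^ (j : ℕ) • Cochain.face j.succAbove c i x := rfl

theorem cechD_zero_apply (c : Cochain U 0 F) (i : Fin 2 → X) (x : U.inter i) :
    cechD U 0 c i x = Cochain.face ![1] c i x - Cochain.face ![0] c i x := by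
  have e0 : (0 : Fin 2).succAbove = ![1] := by decide
  have e1 : (1 : Fin 2).succAbove = ![0] := by decide
  rw [cechD_eq, Fin.sum_univ_two, e0, e1]
  simp [sub_eq_add_neg]

theorem cechD_one_apply (c : Cochain U 1 F) (i : Fin 3 → X) (x : U.inter i) :
    cechD U 1 c i x = Cochain.face ![1, 2] c i x - Cochain.face ![0, 2] c i x
      + Cochain.face ![0, 1] c i x := by
  have e0 : (0 : Fin 3).succAbove = ![1, 2] := by decide
  have e1 : (1 : Fin 3).succAbove = ![0, 2] := by decide
  have e2 : (2 : Fin 3).succAbove = ![0, 1] := by decide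
  rw [cechD_eq, Fin.sum_univ_three, e0, e1, e2]
  simp [sub_eq_add_neg]

theorem cechD_two_apply (c : Cochain U 2 F) (i : Fin 4 → X) (x : U.inter i) :
    cechD U 2 c i x = Cochain.face ![1, 2, 3] c i x - Cochain.face ![0, 2, 3] c i x
      + Cochain.face ![0, 1, 3] c i x - Cochain.face ![0, 1, 2] c i x := by
  have e0 : (0 : Fin 4).succAbove = ![1, 2, 3] := by decide
  have e1 : (1 : Fin 4).succAbove = ![0, 2, 3] := by decide
  have e2 : (2 : Fin 4).succAbove = ![0, 1, 3] := by decide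
  have e3 : (3 : Fin 4).succAbove = ![0, 1, 2] := by decide
  rw [cechD_eq, Fin.sum_univ_four, e0, e1, e2, e3]
  simp [sub_eq_add_neg, pow_succ]

theorem comp_one {q : ℕ} (g : Fin 2 → Fin (q + 1)) (j : Fin 2) : g ∘ ![j] = ![g j] := by
  funext l
  fin_cases l
  rfl

theorem comp_two {p q : ℕ} (g : Fin (p + 1) → Fin (q + 1)) (j l : Fin (p + 1)) :
    g ∘ ![j, l] = ![g j, g l] := by
  funext m
  fin_cases m <;> rfl

theorem face_cechD_zero {q : ℕ} (c : Cochain U 0 F) (j l : Fin (q + 1)) (i : Fin (q + 1) → X)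
    (x : U.inter i) : Cochain.face ![j, l] (cechD U 0 c) i x =
      Cochain.face ![l] c i x - Cochain.face ![j] c i x := by
  have e0 : ![j, l] ∘ ![0] = ![j] := comp_one _ _
  have e1 : ![j, l] ∘ ![1] = ![l] := comp_one _ _
  have h : Cochain.face ![j, l] (cechD U 0 c) i x = Cochain.face (![j, l] ∘ ![1]) c i x -
      Cochain.face (![j, l] ∘ ![0]) c i x := cechD_zero_apply c (i ∘ ![j, l]) _
  rw [e0, e1] at h
  exact h

theorem face_cechD_one {q : ℕ} (c : Cochain U 1 F) (j l m : Fin (q + 1)) (i : Fin (q + 1) → X)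
    (x : U.inter i) : Cochain.face ![j, l, m] (cechD U 1 c) i x =
      Cochain.face ![l, m] c i x - Cochain.face ![j, m] c i x + Cochain.face ![j, l] c i x := by
  have e0 : ![j, l, m] ∘ ![0, 1] = ![j, l] := comp_two _ _ _
  have e1 : ![j, l, m] ∘ ![0, 2] = ![j, m] := comp_two _ _ _
  have e2 : ![j, l, m] ∘ ![1, 2] = ![l, m] := comp_two _ _ _
  have h : Cochain.face ![j, l, m] (cechD U 1 c) i x =
      Cochain.face (![j, l, m] ∘ ![1, 2]) c i x - Cochain.face (![j, l, m] ∘ ![0, 2]) c i x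
        + Cochain.face (![j, l, m] ∘ ![0, 1]) c i x := cechD_one_apply c (i ∘ ![j, l, m]) _
  rw [e0, e1, e2] at h
  exact h

theorem face_id_one (c : Cochain U 1 F) (i : Fin 2 → X) (x : U.inter i) :
    Cochain.face ![0, 1] c i x = c i x := by
  have e : (![0, 1] : Fin 2 → Fin 2) = id := by decide
  rw [e]
  rfl

theorem face_id_zero (c : Cochain U 0 F) (i : Fin 1 → X) (x : U.inter i) :
    Cochain.face ![0] c i x = c i x := by
  have e : (![0] : Fin 1 → Fin 1) = id := by decide
  rw [e]
  rfl

end Faces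

section Cup
variable {k : Type u} [Field k] {X : LocallyRingedSpace.{u}} [SpaceOver k X]
  {D : EffectiveCartierDivisor X} (P : IntegrableConnection k D 0) (U : Covering X)

/-- The cup product of cochains of degree one induced by composition of endomorphisms and wedge
product of forms: `(a, A) ∪ (b, B) = (a_{ij} b_{jk}, a_{ij} B_j - A_i b_{ij}, A_i ∧ B_i)`. -/
def cup (z w : FamilyOne P U) : FamilyTwo P U :=
  (fun i x => (Cochain.face ![0, 1] z.1 i x).comp (Cochain.face ![1, 2] w.1 i x),
   fun i x => zeroMulOne (z.1 i x) (Cochain.face ![1] w.2 i x)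
     - oneMulZero (Cochain.face ![0] z.2 i x) (w.1 i x),
   fun i x => oneMulOne (z.2 i x) (w.2 i x))

variable {P U}

theorem cup_add_left (z z' w : FamilyOne P U) : cup P U (z + z') w = cup P U z w + cup P U z' w := by
  refine Prod.ext ?_ (Prod.ext ?_ ?_) <;> funext i x
  · exact LinearMap.add_comp _ _ _
  · change zeroMulOne (z.1 i x + z'.1 i x) _ -
      oneMulZero (Cochain.face ![0] z.2 i x + Cochain.face ![0] z'.2 i x) _ = (_ - _) + (_ - _)
    rw [zeroMulOne_add_left, oneMulZero_add_left]
    abel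
  · exact oneMulOne_add_left _ _ _

theorem cup_add_right (z w w' : FamilyOne P U) :
    cup P U z (w + w') = cup P U z w + cup P U z w' := by
  refine Prod.ext ?_ (Prod.ext ?_ ?_) <;> funext i x
  · exact LinearMap.comp_add _ _ _
  · change zeroMulOne _ (Cochain.face ![1] w.2 i x + Cochain.face ![1] w'.2 i x) -
      oneMulZero _ (w.1 i x + w'.1 i x) = (_ - _) + (_ - _)
    rw [zeroMulOne_add_right, oneMulZero_add_right]
    abel
  · exact oneMulOne_add_right _ _ _

theorem isEndZero_face {p q : ℕ} (f : Fin (p + 1) → Fin (q + 1)) {c : Cochain U p (EndZero P)}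
    (hc : c ∈ cochainsZero P U p) (i : Fin (q + 1) → X) : IsEndZero P (Cochain.face f c i) :=
  (hc (i ∘ f)).res (U.inter_face f i)

theorem isEndOne_face {p q : ℕ} (f : Fin (p + 1) → Fin (q + 1)) {c : Cochain U p (EndOne P)}
    (hc : c ∈ cochainsOne P U p) (i : Fin (q + 1) → X) : IsEndOne P (Cochain.face f c i) :=
  (hc (i ∘ f)).res (U.inter_face f i)

theorem IsEndOne.sub {V : Opens X} {a b : ∀ x : V, EndOne P x.1} (ha : IsEndOne P a)
    (hb : IsEndOne P b) : IsEndOne P (a - b) := by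
  rw [sub_eq_add_neg]
  exact ha.add hb.neg

theorem cup_mem_total {z w : FamilyOne P U} (hz : z ∈ totalOne P U) (hw : w ∈ totalOne P U) :
    cup P U z w ∈ totalTwo P U :=
  ⟨fun i => (isEndZero_face _ hz.1 i).comp (isEndZero_face _ hw.1 i),
    fun i => (IsEndOne.zeroMulOne (hz.1 i) (isEndOne_face _ hw.2 i)).sub
      (IsEndOne.oneMulZero (isEndOne_face _ hz.2 i) (hw.1 i)),
    fun i => IsEndOne.oneMulOne (hz.2 i) (hw.2 i)⟩

theorem totalDOne_eq_zero {z : FamilyOne P U} (hz : totalDOne P U z = 0) :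
    cechD U 1 z.1 = 0 ∧ cechD U 0 z.2 = endZeroD P U 1 z.1 ∧ endOneD P U 0 z.2 = 0 :=
  ⟨congrArg Prod.fst hz, sub_eq_zero.1 (congrArg (fun t => t.2.1) hz),
    congrArg (fun t => t.2.2) hz⟩

theorem cocycle_face {z : FamilyOne P U} (hz : totalDOne P U z = 0) {q : ℕ}
    (i : Fin (q + 1) → X) (x : U.inter i) (j l m : Fin (q + 1)) :
    Cochain.face ![j, m] z.1 i x = Cochain.face ![j, l] z.1 i x + Cochain.face ![l, m] z.1 i x := by
  have h := face_cechD_one z.1 j l m i x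
  rw [(totalDOne_eq_zero hz).1] at h
  have h' : (0 : EndZero P x.1) = Cochain.face ![l, m] z.1 i x - Cochain.face ![j, m] z.1 i x
    + Cochain.face ![j, l] z.1 i x := h
  have e : Cochain.face ![j, m] z.1 i x = Cochain.face ![j, m] z.1 i x + 0 := by rw [add_zero]
  rw [e, h']
  abel

theorem cocycle_face_one {z : FamilyOne P U} (hz : totalDOne P U z = 0) {q : ℕ}
    (i : Fin (q + 1) → X) (x : U.inter i) (j l : Fin (q + 1)) :
    Cochain.face ![l] z.2 i x = Cochain.face ![j] z.2 i x
      + (P.nabla x.1).endZero (Cochain.face ![j, l] z.1 i x) := by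
  have h := face_cechD_zero z.2 j l i x
  rw [(totalDOne_eq_zero hz).2.1] at h
  have h' : (P.nabla x.1).endZero (Cochain.face ![j, l] z.1 i x) =
    Cochain.face ![l] z.2 i x - Cochain.face ![j] z.2 i x := h
  rw [h']
  abel

theorem cocycle_closed {z : FamilyOne P U} (hz : totalDOne P U z = 0) {q : ℕ}
    (i : Fin (q + 1) → X) (x : U.inter i) (j : Fin (q + 1)) :
    (P.nabla x.1).endOne (Cochain.face ![j] z.2 i x) = 0 :=
  congrFun (congrFun (totalDOne_eq_zero hz).2.2 (i ∘ ![j])) ⟨x.1, fun l => x.2 (![j] l)⟩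

theorem cup_face_one (z w : FamilyOne P U) {q : ℕ} (i : Fin (q + 1) → X) (x : U.inter i)
    (j l : Fin (q + 1)) : Cochain.face ![j, l] (cup P U z w).2.1 i x =
      zeroMulOne (Cochain.face ![j, l] z.1 i x) (Cochain.face ![l] w.2 i x)
        - oneMulZero (Cochain.face ![j] z.2 i x) (Cochain.face ![j, l] w.1 i x) := by
  have e0 : ![j, l] ∘ ![0] = ![j] := comp_one _ _
  have e1 : ![j, l] ∘ ![1] = ![l] := comp_one _ _
  have h : Cochain.face ![j, l] (cup P U z w).2.1 i x =
      zeroMulOne (Cochain.face ![j, l] z.1 i x) (Cochain.face (![j, l] ∘ ![1]) w.2 i x)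
        - oneMulZero (Cochain.face (![j, l] ∘ ![0]) z.2 i x) (Cochain.face ![j, l] w.1 i x) := rfl
  rw [e0, e1] at h
  exact h

theorem cup_face_two (z w : FamilyOne P U) {q : ℕ} (i : Fin (q + 1) → X) (x : U.inter i)
    (j l m : Fin (q + 1)) : Cochain.face ![j, l, m] (cup P U z w).1 i x =
      (Cochain.face ![j, l] z.1 i x).comp (Cochain.face ![l, m] w.1 i x) := by
  have e0 : ![j, l, m] ∘ ![0, 1] = ![j, l] := comp_two _ _ _
  have e1 : ![j, l, m] ∘ ![1, 2] = ![l, m] := comp_two _ _ _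
  have h : Cochain.face ![j, l, m] (cup P U z w).1 i x =
      (Cochain.face (![j, l, m] ∘ ![0, 1]) z.1 i x).comp
        (Cochain.face (![j, l, m] ∘ ![1, 2]) w.1 i x) := rfl
  rw [e0, e1] at h
  exact h

theorem formMul_zero_right {A : Type u} [CommRing A] [IsLocalRing A] [Algebra k A]
    {I : Ideal A} {M : Type u} [AddCommGroup M] [Module A M] (Q : M →ₗ[A] PolarValued k I M) :
    formMul Q 0 = 0 := LinearMap.comp_zero _

theorem formMul_zero_left {A : Type u} [CommRing A] [IsLocalRing A] [Algebra k A]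
    {I : Ideal A} {M : Type u} [AddCommGroup M] [Module A M] (Q : M →ₗ[A] PolarValued k I M) :
    formMul 0 Q = 0 := by
  have h := formMul_add_left (0 : M →ₗ[A] PolarValued k I M) 0 Q
  rw [add_zero] at h
  exact left_eq_add.1 h

theorem totalDTwo_cup {z w : FamilyOne P U} (hz : totalDOne P U z = 0)
    (hw : totalDOne P U w = 0) : totalDTwo P U (cup P U z w) = 0 := by
  refine Prod.ext ?_ (Prod.ext ?_ (Prod.ext ?_ ?_)) <;> funext i x
  · change cechD U 2 (cup P U z w).1 i x = 0
    rw [cechD_two_apply, cup_face_two, cup_face_two, cup_face_two, cup_face_two,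
      cocycle_face hz i x 0 1 2, cocycle_face hw i x 1 2 3, LinearMap.add_comp, LinearMap.comp_add]
    abel
  · change cechD U 1 (cup P U z w).2.1 i x + (P.nabla x.1).endZero ((Cochain.face ![0, 1] z.1 i x).comp
      (Cochain.face ![1, 2] w.1 i x)) = 0
    rw [cechD_one_apply, cup_face_one, cup_face_one, cup_face_one, Connection.endZero_mul,
      cocycle_face hz i x 0 1 2, cocycle_face hw i x 0 1 2, cocycle_face_one hz i x 0 1,
      cocycle_face_one hw i x 1 2]
    simp only [zeroMulOne_add_left, zeroMulOne_add_right, oneMulZero_add_left,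
      oneMulZero_add_right]
    abel
  · change cechD U 0 (cup P U z w).2.2 i x - (P.nabla x.1).endOne ((cup P U z w).2.1 i x) = 0
    rw [cechD_zero_apply, ← face_id_one (cup P U z w).2.1, cup_face_one]
    have e : ∀ R S : EndOne P x.1, (P.nabla x.1).endOne (R - S) =
      (P.nabla x.1).endOne R - (P.nabla x.1).endOne S := map_sub (P.nabla x.1).endOneHom
    rw [e, Connection.endOne_zeroMulOne, Connection.endOne_oneMulZero, cocycle_closed hz,
      cocycle_closed hw, formMul_zero_left, formMul_zero_right]
    change oneMulOne (Cochain.face ![1] z.2 i x) (Cochain.face ![1] w.2 i x) -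
      oneMulOne (Cochain.face ![0] z.2 i x) (Cochain.face ![0] w.2 i x) - _ = 0
    rw [cocycle_face_one hz i x 0 1, cocycle_face_one hw i x 0 1]
    simp only [oneMulOne_add_left, oneMulOne_add_right]
    abel
  · change (P.nabla x.1).endForm (oneMulOne (z.2 i x) (w.2 i x)) = 0
    rw [Connection.endForm_oneMulOne, ← face_id_zero z.2, ← face_id_zero w.2, cocycle_closed hz,
      cocycle_closed hw, formMul_zero_left, formMul_zero_right, sub_zero]

/-- A primitive of the product of a coboundary and a cocycle. -/
def primitiveLeft (h : Cochain U 0 (EndZero P)) (w : FamilyOne P U) : FamilyOne P U :=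
  (fun i x => (Cochain.face ![0] h i x).comp (w.1 i x), fun i x => zeroMulOne (h i x) (w.2 i x))

/-- A primitive of minus the product of a cocycle and a coboundary. -/
def primitiveRight (z : FamilyOne P U) (h : Cochain U 0 (EndZero P)) : FamilyOne P U :=
  (fun i x => (z.1 i x).comp (Cochain.face ![1] h i x), fun i x => oneMulZero (z.2 i x) (h i x))

theorem primitiveLeft_face (h : Cochain U 0 (EndZero P)) (w : FamilyOne P U) {q : ℕ}
    (i : Fin (q + 1) → X) (x : U.inter i) (j l : Fin (q + 1)) :
    Cochain.face ![j, l] (primitiveLeft h w).1 i x =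
      (Cochain.face ![j] h i x).comp (Cochain.face ![j, l] w.1 i x) := by
  have e0 : ![j, l] ∘ ![0] = ![j] := comp_one _ _
  have e : Cochain.face ![j, l] (primitiveLeft h w).1 i x =
      (Cochain.face (![j, l] ∘ ![0]) h i x).comp (Cochain.face ![j, l] w.1 i x) := rfl
  rw [e0] at e
  exact e

theorem primitiveRight_face (z : FamilyOne P U) (h : Cochain U 0 (EndZero P)) {q : ℕ}
    (i : Fin (q + 1) → X) (x : U.inter i) (j l : Fin (q + 1)) :
    Cochain.face ![j, l] (primitiveRight z h).1 i x =
      (Cochain.face ![j, l] z.1 i x).comp (Cochain.face ![l] h i x) := by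
  have e0 : ![j, l] ∘ ![1] = ![l] := comp_one _ _
  have e : Cochain.face ![j, l] (primitiveRight z h).1 i x =
      (Cochain.face ![j, l] z.1 i x).comp (Cochain.face (![j, l] ∘ ![1]) h i x) := rfl
  rw [e0] at e
  exact e

theorem zeroMulOne_sub_left {x : X} (a b : EndZero P x) (Q : EndOne P x) :
    zeroMulOne (a - b) Q = zeroMulOne a Q - zeroMulOne b Q := by
  rw [eq_sub_iff_add_eq, ← zeroMulOne_add_left, sub_add_cancel]

theorem oneMulZero_sub_right {x : X} (a b : EndZero P x) (Q : EndOne P x) :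
    oneMulZero Q (a - b) = oneMulZero Q a - oneMulZero Q b := by
  rw [eq_sub_iff_add_eq, ← oneMulZero_add_right, sub_add_cancel]

theorem cup_coboundary_left {w : FamilyOne P U} (hw : totalDOne P U w = 0)
    (h : Cochain U 0 (EndZero P)) :
    cup P U (totalDZero P U h) w = totalDOne P U (primitiveLeft h w) := by
  refine Prod.ext ?_ (Prod.ext ?_ ?_) <;> funext i x
  · change (Cochain.face ![0, 1] (cechD U 0 h) i x).comp (Cochain.face ![1, 2] w.1 i x) =
      cechD U 1 (F := EndZero P) (primitiveLeft h w).1 i x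
    rw [cechD_one_apply, primitiveLeft_face, primitiveLeft_face, primitiveLeft_face,
      face_cechD_zero, cocycle_face hw i x 0 1 2, LinearMap.sub_comp, LinearMap.comp_add]
    abel
  · change zeroMulOne (cechD U 0 h i x) (Cochain.face ![1] w.2 i x) -
      oneMulZero ((P.nabla x.1).endZero (Cochain.face ![0] h i x)) (w.1 i x) =
      cechD U 0 (F := EndOne P) (primitiveLeft h w).2 i x -
        (P.nabla x.1).endZero ((Cochain.face ![0] h i x).comp (w.1 i x))
    rw [cechD_zero_apply, cechD_zero_apply, Connection.endZero_mul]
    have e1 : Cochain.face ![1] (primitiveLeft h w).2 i x =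
      zeroMulOne (Cochain.face ![1] h i x) (Cochain.face ![1] w.2 i x) := rfl
    have e0 : Cochain.face ![0] (primitiveLeft h w).2 i x =
      zeroMulOne (Cochain.face ![0] h i x) (Cochain.face ![0] w.2 i x) := rfl
    rw [e1, e0, zeroMulOne_sub_left, cocycle_face_one hw i x 0 1, face_id_one,
      zeroMulOne_add_right, zeroMulOne_add_right]
    abel
  · change oneMulOne ((P.nabla x.1).endZero (h i x)) (w.2 i x) =
      (P.nabla x.1).endOne (zeroMulOne (h i x) (w.2 i x))
    rw [Connection.endOne_zeroMulOne, ← face_id_zero w.2, cocycle_closed hw, formMul_zero_right,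
      add_zero]

theorem cup_coboundary_right {z : FamilyOne P U} (hz : totalDOne P U z = 0)
    (h : Cochain U 0 (EndZero P)) :
    cup P U z (totalDZero P U h) = -totalDOne P U (primitiveRight z h) := by
  refine Prod.ext ?_ (Prod.ext ?_ ?_) <;> funext i x
  · change (Cochain.face ![0, 1] z.1 i x).comp (Cochain.face ![1, 2] (cechD U 0 h) i x) =
      -cechD U 1 (F := EndZero P) (primitiveRight z h).1 i x
    rw [cechD_one_apply, primitiveRight_face, primitiveRight_face, primitiveRight_face,
      face_cechD_zero, cocycle_face hz i x 0 1 2, LinearMap.comp_sub, LinearMap.add_comp]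
    abel
  · change zeroMulOne (z.1 i x) ((P.nabla x.1).endZero (Cochain.face ![1] h i x)) -
      oneMulZero (Cochain.face ![0] z.2 i x) (cechD U 0 h i x) =
      -(cechD U 0 (F := EndOne P) (primitiveRight z h).2 i x -
        (P.nabla x.1).endZero ((z.1 i x).comp (Cochain.face ![1] h i x)))
    rw [cechD_zero_apply, cechD_zero_apply, Connection.endZero_mul]
    have e1 : Cochain.face ![1] (primitiveRight z h).2 i x =
      oneMulZero (Cochain.face ![1] z.2 i x) (Cochain.face ![1] h i x) := rfl
    have e0 : Cochain.face ![0] (primitiveRight z h).2 i x =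
      oneMulZero (Cochain.face ![0] z.2 i x) (Cochain.face ![0] h i x) := rfl
    rw [e1, e0, oneMulZero_sub_right, cocycle_face_one hz i x 0 1, face_id_one,
      oneMulZero_add_left]
    abel
  · change oneMulOne (z.2 i x) ((P.nabla x.1).endZero (h i x)) =
      -(P.nabla x.1).endOne (oneMulZero (z.2 i x) (h i x))
    rw [Connection.endOne_oneMulZero, ← face_id_zero z.2, cocycle_closed hz, formMul_zero_left,
      zero_sub, neg_neg]

/-- The cup product of cocycles. -/
def cupCocycles (z w : cocyclesOne P U) : cocyclesTwo P U :=
  ⟨cup P U z w, cup_mem_total z.2.1 w.2.1, totalDTwo_cup z.2.2 w.2.2⟩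

theorem cupCocycles_rel {z z' w w' : cocyclesOne P U}
    (hz : -z + z' ∈ (coboundariesOne P U).addSubgroupOf (cocyclesOne P U))
    (hw : -w + w' ∈ (coboundariesOne P U).addSubgroupOf (cocyclesOne P U)) :
    -cupCocycles z w + cupCocycles z' w' ∈
      (coboundariesTwo P U).addSubgroupOf (cocyclesTwo P U) := by
  obtain ⟨g, hg, hz⟩ := hz
  obtain ⟨h, hh, hw⟩ := hw
  have ez : (z' : FamilyOne P U) = z + totalDZero P U g := by
    rw [hz]
    exact (add_neg_cancel_left (z : FamilyOne P U) z').symm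
  have ew : (w' : FamilyOne P U) = w + totalDZero P U h := by
    rw [hw]
    exact (add_neg_cancel_left (w : FamilyOne P U) w').symm
  have e : -cup P U z w + cup P U z' w' =
      totalDOne P U (primitiveLeft g w' - primitiveRight z h) := by
    rw [map_sub, ← cup_coboundary_left w'.2.2, ez, cup_add_left, ew, cup_add_right (z : FamilyOne P U),
      cup_coboundary_right z.2.2]
    abel
  refine ⟨_, sub_mem ?_ ?_, e.symm⟩
  · exact ⟨fun i => (isEndZero_face _ hg i).comp (w'.2.1.1 i),
      fun i => IsEndOne.zeroMulOne (hg i) (w'.2.1.2 i)⟩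
  · exact ⟨fun i => (z.2.1.1 i).comp (isEndZero_face _ hh i),
      fun i => IsEndOne.oneMulZero (z.2.1.2 i) (hh i)⟩

variable (P U) in
/-- The cup product `ℍ¹(𝔘, ℛ•) × ℍ¹(𝔘, ℛ•) → ℍ²(𝔘, ℛ•)`. -/
def cechYoneda : CechOne P U → CechOne P U → CechTwo P U :=
  Quotient.map₂ (sa := QuotientAddGroup.leftRel ((coboundariesOne P U).addSubgroupOf _))
    (sb := QuotientAddGroup.leftRel ((coboundariesOne P U).addSubgroupOf _))
    (sc := QuotientAddGroup.leftRel ((coboundariesTwo P U).addSubgroupOf _)) cupCocycles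
    fun _ _ hz _ _ hw => QuotientAddGroup.leftRel_apply.2 (cupCocycles_rel (QuotientAddGroup.leftRel_apply.1 hz) (QuotientAddGroup.leftRel_apply.1 hw))

variable (P)

/-- The Yoneda product `ℍ¹(X, ℛ•) × ℍ¹(X, ℛ•) → ℍ²(X, ℛ•)`, induced by composition in `ℰnd(ℰ)`. -/
def yonedaProduct : HyperOne P → HyperOne P → HyperTwo P :=
  DirectLimit.map₂ _ _ _ (fun U => cechYoneda P U) fun U V h z w => by
    obtain ⟨z, rfl⟩ := cechOneClass_surjective P U z
    obtain ⟨w, rfl⟩ := cechOneClass_surjective P U w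
    rfl

theorem yoneda_hyperOneClass (z w : cocyclesOne P U) :
    yonedaProduct P (hyperOneClass P U z) (hyperOneClass P U w) = hyperTwoClass P U (cupCocycles z w) :=
  DirectLimit.map₂_def _ _ _ _ _ U _ _

theorem directLimit_mk_eq {ι : Type u} [Preorder ι] [IsDirectedOrder ι] {G : ι → Type u}
    [∀ i, AddCommGroup (G i)] (f : ∀ i j : ι, i ≤ j → G i →+ G j) [DirectedSystem G (f · · ·)]
    (i : ι) (x y : G i) : (⟦⟨i, x⟩⟧ : DirectLimit G f) = ⟦⟨i, y⟩⟧ ↔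
      ∃ (j : ι) (h : i ≤ j), f i j h x = f i j h y :=
  ⟨fun e => by
    obtain ⟨j, h, _, e⟩ := Quotient.exact e
    exact ⟨j, h, e⟩, fun ⟨j, h, e⟩ => Quotient.sound ⟨j, h, h, e⟩⟩

theorem cechTwoRestrict_class_eq {V : Covering X} (h : U ≤ V) (z : cocyclesTwo P U) :
    cechTwoRestrict P h (cechTwoClass P U z) = cechTwoRestrict P h (cechTwoClass P U 0) ↔
      familyTwoRestrict P h z ∈ coboundariesTwo P V := by
  rw [map_zero, map_zero]
  exact cechTwoClass_eq_zero P V (cocyclesTwoRestrict P h z)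

theorem hyperTwoClass_eq (z w : cocyclesTwo P U) : hyperTwoClass P U z = hyperTwoClass P U w ↔
    ∃ (V : Covering X) (h : U ≤ V), cechTwoRestrict P h (cechTwoClass P U z) =
      cechTwoRestrict P h (cechTwoClass P U w) :=
  directLimit_mk_eq (fun _ _ h => cechTwoRestrict P h) U (cechTwoClass P U z) (cechTwoClass P U w)

/-- A class in `ℍ²(X, ℛ•)` vanishes if and only if it is a coboundary on a finer covering. -/
theorem hyperTwoClass_eq_zero (z : cocyclesTwo P U) : hyperTwoClass P U z = 0 ↔
    ∃ (V : Covering X) (h : U ≤ V), familyTwoRestrict P h z ∈ coboundariesTwo P V := by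
  rw [← hyperTwoClass_zero P U, hyperTwoClass_eq]
  simp only [cechTwoRestrict_class_eq]

end Cup

section Deformations
variable {k : Type u} [Field k] {X : LocallyRingedSpace.{u}} [SpaceOver k X]
  {D : EffectiveCartierDivisor X} {P : IntegrableConnection k D 0}
  {P1 : IntegrableConnection k D 1}

/-- The first order deformation `(ℰ₁, ∇₁)` of `(ℰ, ∇)` is the one defined by the cocycle
`(a_{ij}, A_i)`: there are local isomorphisms `ℰ[ε] → ℰ₁` over the members of the covering, which
are the identity modulo `ε`, such that the change of trivialization is `1 + ε a_{ij}` and `∇₁`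
corresponds to `∇ + ε A_i`. The isomorphisms are given by their restrictions `σ_i` to `ℰ`. -/
structure DefinedBy (ρ : Restriction P1 P) {U : Covering X} (z : cocyclesOne P U) where
  σ : ∀ (i : X) (x : U.nhd i), P.bundle.fiber x.1 →ₗ[Stalk X x.1] P1.bundle.fiber x.1
  σ_section : ∀ (i : X) (V : Opens X) (h : V ≤ U.nhd i) (s : ∀ x : V, P.bundle.fiber x.1),
    P.bundle.sheaf.pred s → P1.bundle.sheaf.pred fun x : V => σ i ⟨x.1, h x.2⟩ (s x)
  map_σ : ∀ (i : X) (x : U.nhd i) (m : P.bundle.fiber x.1), ρ.map x.1 (σ i x m) = m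
  σ_change : ∀ (i : Fin 2 → X) (x : U.inter i) (m : P.bundle.fiber x.1),
    σ (i 1) ⟨x.1, x.2 1⟩ m = σ (i 0) ⟨x.1, x.2 0⟩ m +
      P1.bundle.eps x.1 (σ (i 0) ⟨x.1, x.2 0⟩ (z.1.1 i x m))
  nabla_σ : ∀ (i : Fin 1 → X) (x : U.inter i) (m : P.bundle.fiber x.1),
    (P1.nabla x.1).toFun (σ (i 0) ⟨x.1, x.2 0⟩ m) =
      LinearMap.rTensor (PoleForms k (D.ideal x.1)) (σ (i 0) ⟨x.1, x.2 0⟩)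
        ((P.nabla x.1).toFun m) +
      LinearMap.rTensor (PoleForms k (D.ideal x.1))
        (P1.bundle.eps x.1 ∘ₗ σ (i 0) ⟨x.1, x.2 0⟩) (z.1.2 i x m)

end Deformations

end DeRham

end

open DeRham AlgebraicGeometry

/-! Everything is an expansion in powers of ε modulo ε³. On a fine enough covering, an extension
(ℰ₂, ∇₂) of (ℰ₁, ∇₁) is ℰ[ε]/(ε³) on each member, with connection ∇ + εA_i + ε²B_i and transition
maps 1 + εa_ij + ε²b_ij. The coefficients of degree at most one are the given cocycle. The new
conditions are the ε²-coefficients of the cocycle rule, of the change of trivialization and of the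
curvature: b_ik = b_ij + b_jk + a_ij a_jk, B_j = B_i + ∇b_ij + A_i a_ij − a_ij A_j, ∇B_i + A_i ∧ A_i
= 0. With the sign conventions of the total complex these three equations say exactly that the total
differential of (b, B) is −(a, A) ∪ (a, A). So an extension exists if and only if, after refining
the covering, the square of the cocycle is a coboundary. Since ℍ² is a direct limit over coverings,
this is the vanishing of the Yoneda square.

Necessity. Since ℰ is locally free, the trivializations σ_i : ℰ → ℰ₁ lift locally to τ_i : ℰ → ℰ₂
(`exists_lift`, `exists_lifting`). Each τ_i identifies ℰ³ with ℰ₂ by (m₀, m₁, m₂) ↦ τm₀ + ετm₁ +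
ε²τm₂ (`Restriction.tripleMap_bijective`), so b_ij and B_i can be read off as last coordinates. The
three equations are `change_comp`, `Represents.change` and `Represents.endOne_eq`; they are
assembled in `Lifting.totalDOne_eq`.

Sufficiency. A primitive (b, B) of minus the square is used as gluing data. Coverings are indexed by
points, so the stalk of the glued bundle at x can be taken to be ℰ_x³, read in the trivialization
with index x. The first equation glues the bundle (`SquarePrimitive.change_change`), the second
makes the stalkwise connections independent of the trivialization
(`SquarePrimitive.represents_chart`), and the third gives integrability
(`tripleConnection_curvature`). Dropping the ε²-coordinate recovers (ℰ₁, ∇₁)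
(`SquarePrimitive.restriction`). -/

noncomputable section

namespace DeRham

open CategoryTheory Opposite TopologicalSpace

set_option linter.unusedSectionVars false

/-! ### Algebra on one stalk: connections of the form ∇ + εP + ε²Q. -/

section Stalks
variable {k : Type u} [Field k] {A : Type u} [CommRing A] [IsLocalRing A] [Algebra k A]
  {I : Ideal A} {M : Type u} [AddCommGroup M] [Module A M] {N : Type u} [AddCommGroup N]
  [Module A N]

theorem valuedToPolar_rTensor_hom (f : M →ₗ[A] N) (t : PoleValued k I M) :
    valuedToPolar k I N (LinearMap.rTensor (PoleForms k I) f t) =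
      LinearMap.rTensor (PolarForms k I) f (valuedToPolar k I M t) := by
  induction t using TensorProduct.induction_on with
  | zero => simp
  | add x y hx hy => simp only [map_add, hx, hy]
  | tmul m x => simp [valuedToPolar]

theorem wedge_rTensor (f : M →ₗ[A] N) (w : PolarForms k I) (t : PolarValued k I M) :
    wedge k I N w (LinearMap.rTensor (PolarForms k I) f t) =
      LinearMap.rTensor (PolarForms k I) f (wedge k I M w t) := by
  induction t using TensorProduct.induction_on with
  | zero => simp
  | add x y hx hy => simp only [map_add, hx, hy]
  | tmul m x => simp

variable {nab : Connection k I M} {nab' : Connection k I N}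

/-- A horizontal morphism commutes with the extended connections. -/
theorem Connection.ext_rTensor {f : M →ₗ[A] N}
    (hf : ∀ m, nab'.toFun (f m) = LinearMap.rTensor (PoleForms k I) f (nab.toFun m))
    (t : PolarValued k I M) :
    nab'.ext (LinearMap.rTensor (PolarForms k I) f t) =
      LinearMap.rTensor (PolarForms k I) f (nab.ext t) := by
  induction t using TensorProduct.induction_on with
  | zero => simp
  | add x y hx hy => simp only [map_add, hx, hy]
  | tmul m x =>
    simp only [LinearMap.rTensor_tmul, ext_tmul, map_add, hf, valuedToPolar_rTensor_hom,
      wedge_rTensor]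

/-- A horizontal morphism commutes with the curvatures. -/
theorem Connection.curvature_map {f : M →ₗ[A] N}
    (hf : ∀ m, nab'.toFun (f m) = LinearMap.rTensor (PoleForms k I) f (nab.toFun m)) (m : M) :
    nab'.curvature (f m) = LinearMap.rTensor (PolarForms k I) f (nab.curvature m) := by
  rw [curvature, hf, valuedToPolar_rTensor_hom, ext_rTensor hf, curvature]

theorem Connection.curvature_add (m m' : M) :
    nab.curvature (m + m') = nab.curvature m + nab.curvature m' := by
  simp [curvature]

/-- The plus sign comes from the oddness of one-forms: in `endForm` the subtracted term involves
`signed P = -P`. -/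
theorem Connection.endOne_apply (P : M →ₗ[A] PoleValued k I M) (m : M) :
    nab.endOne P m = nab.ext (valuedToPolar k I M (P m)) +
      act (toPolarEnd P) (valuedToPolar k I M (nab.toFun m)) := by
  have h : nab.endOne P m = nab.ext (toPolarEnd P m) -
    act (signed (toPolarEnd P)) (valuedToPolar k I M (nab.toFun m)) := rfl
  rw [h, signed_toPolarEnd, act_neg, sub_neg_eq_add]
  rfl

/-- The map `τ` identifies `∇'` with `∇ + ε P + ε² Q` on the image of `τ`. -/
def Represents (nab : Connection k I M) (nab' : Connection k I N) (eps : N →ₗ[A] N)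
    (τ : M →ₗ[A] N) (P Q : M →ₗ[A] PoleValued k I M) : Prop :=
  ∀ m, nab'.toFun (τ m) = LinearMap.rTensor (PoleForms k I) τ (nab.toFun m) +
    LinearMap.rTensor (PoleForms k I) (eps ∘ₗ τ) (P m) +
    LinearMap.rTensor (PoleForms k I) (eps ∘ₗ eps ∘ₗ τ) (Q m)

variable {eps : N →ₗ[A] N} {τ : M →ₗ[A] N} {P Q : M →ₗ[A] PoleValued k I M}

/-- The Leibniz term `m ⊗ d w` is carried by ∇ alone, so the corrections `P` and `Q` enter only
through the wedge action `act`. -/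
theorem Represents.ext_rTensor (h : Represents nab nab' eps τ P Q) (t : PolarValued k I M) :
    nab'.ext (LinearMap.rTensor (PolarForms k I) τ t) =
      LinearMap.rTensor (PolarForms k I) τ (nab.ext t) +
      LinearMap.rTensor (PolarForms k I) (eps ∘ₗ τ) (act (toPolarEnd P) t) +
      LinearMap.rTensor (PolarForms k I) (eps ∘ₗ eps ∘ₗ τ) (act (toPolarEnd Q) t) := by
  induction t using TensorProduct.induction_on with
  | zero => simp
  | add x y hx hy => simp only [map_add, hx, hy]; abel
  | tmul m x =>
    simp only [LinearMap.rTensor_tmul, Connection.ext_tmul, map_add, h m,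
      valuedToPolar_rTensor_hom, wedge_rTensor, act_tmul, toPolarEnd, LinearMap.comp_apply]
    abel

/-- The curvature of `∇ + ε P + ε² Q`. -/
theorem Represents.curvature (h : Represents nab nab' eps τ P Q)
    (heps : ∀ n, nab'.toFun (eps n) = LinearMap.rTensor (PoleForms k I) eps (nab'.toFun n))
    (hnil : eps ^ 3 = 0) (m : M) :
    nab'.curvature (τ m) = LinearMap.rTensor (PolarForms k I) τ (nab.curvature m) +
      LinearMap.rTensor (PolarForms k I) (eps ∘ₗ τ) (nab.endOne P m) +
      LinearMap.rTensor (PolarForms k I) (eps ∘ₗ eps ∘ₗ τ)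
        (nab.endOne Q m + oneMulOne P P m) := by
  have h0 : eps ∘ₗ eps ∘ₗ eps ∘ₗ τ = 0 := by
    ext x
    exact DFunLike.congr_fun hnil (τ x)
  -- As ε is horizontal, it passes through the extended connection and raises every degree in ε by
  -- one; ε³ = 0 then removes the `Q`-term here, and in `h2` also the `P`-term.
  have h1 : ∀ t, nab'.ext (LinearMap.rTensor (PolarForms k I) (eps ∘ₗ τ) t) =
      LinearMap.rTensor (PolarForms k I) (eps ∘ₗ τ) (nab.ext t) +
      LinearMap.rTensor (PolarForms k I) (eps ∘ₗ eps ∘ₗ τ) (act (toPolarEnd P) t) := by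
    intro t
    rw [LinearMap.rTensor_comp_apply, Connection.ext_rTensor heps, h.ext_rTensor]
    simp only [map_add, ← LinearMap.rTensor_comp_apply, h0, LinearMap.rTensor_zero,
      LinearMap.zero_apply, add_zero]
  have h2 : ∀ t, nab'.ext (LinearMap.rTensor (PolarForms k I) (eps ∘ₗ eps ∘ₗ τ) t) =
      LinearMap.rTensor (PolarForms k I) (eps ∘ₗ eps ∘ₗ τ) (nab.ext t) := by
    intro t
    rw [LinearMap.rTensor_comp_apply, Connection.ext_rTensor heps, h1]
    simp only [map_add, ← LinearMap.rTensor_comp_apply, h0, LinearMap.rTensor_zero,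
      LinearMap.zero_apply, add_zero]
  have h3 : oneMulOne P P m = act (toPolarEnd P) (valuedToPolar k I M (P m)) := rfl
  -- Applying the connection to the three summands of `nab'.toFun (τ m)` gives the anticommutator of
  -- ∇ and `P` in degree one, and that of ∇ and `Q` plus `P ∧ P` in degree two.
  rw [Connection.curvature, h m]
  simp only [map_add, valuedToPolar_rTensor_hom, h.ext_rTensor, h1, h2, h3,
    Connection.endOne_apply, Connection.curvature]
  abel

/-- The effect of a change of trivialization `1 + ε a + ε² b` on the connection. -/
theorem Represents.change (h : Represents nab nab' eps τ P Q)
    (heps : ∀ n, nab'.toFun (eps n) = LinearMap.rTensor (PoleForms k I) eps (nab'.toFun n))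
    (hnil : eps ^ 3 = 0) {τ' : M →ₗ[A] N} {a b : M →ₗ[A] M}
    (hτ : τ' = τ + eps ∘ₗ τ ∘ₗ a + eps ∘ₗ eps ∘ₗ τ ∘ₗ b) {P' : M →ₗ[A] PoleValued k I M}
    (hP : P' = P + nab.endZero a) :
    Represents nab nab' eps τ' P' (Q + nab.endZero b + oneMulZero P a - zeroMulOne a P') := by
  have e0 : ∀ m, eps (eps (eps m)) = 0 := DFunLike.congr_fun hnil
  have hz : ∀ (c : M →ₗ[A] M) (m : M), nab.toFun (c m) =
      nab.endZero c m + LinearMap.rTensor (PoleForms k I) c (nab.toFun m) := fun c m => by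
    rw [← sub_eq_iff_eq_add]; rfl
  -- Rewriting the ε-term against `τ'` instead of `τ` already produces `a P'` in degree two. This is
  -- why `zeroMulOne a P'`, with the new form `P'`, is subtracted.
  have e1 : eps ∘ₗ τ' = eps ∘ₗ τ + eps ∘ₗ eps ∘ₗ τ ∘ₗ a := by
    ext m; simp [hτ, e0]
  have e2 : eps ∘ₗ eps ∘ₗ τ' = eps ∘ₗ eps ∘ₗ τ := by
    ext m; simp [hτ, e0]
  have r3 : ∀ t, LinearMap.rTensor (PoleForms k I) eps (LinearMap.rTensor (PoleForms k I) eps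
      (LinearMap.rTensor (PoleForms k I) eps t)) = 0 := fun t => by
    rw [← LinearMap.rTensor_comp_apply, ← LinearMap.rTensor_comp_apply]
    have : eps ∘ₗ eps ∘ₗ eps = 0 := by ext m; exact e0 m
    rw [LinearMap.comp_assoc, this, LinearMap.rTensor_zero, LinearMap.zero_apply]
  intro m
  rw [e2, e1]
  have hm : τ' m = τ m + eps (τ (a m)) + eps (eps (τ (b m))) := by rw [hτ]; rfl
  rw [hm, hτ]
  have eP : P' m = P m + nab.endZero a m := by rw [hP]; rfl
  simp only [map_add, heps, h m, h (a m), h (b m), hz, LinearMap.rTensor_add,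
    LinearMap.add_apply, LinearMap.sub_apply, map_sub, LinearMap.rTensor_comp_apply, r3,
    oneMulZero, zeroMulOne, LinearMap.comp_apply, add_zero, eP]
  abel

/-- The failure `∇' ∘ f - f ∘ ∇` of a morphism to be horizontal. -/
def Connection.homDefect (nab : Connection k I M) (nab' : Connection k I N) (f : M →ₗ[A] N) :
    M →ₗ[A] PoleValued k I N where
  toFun m := nab'.toFun (f m) - LinearMap.rTensor (PoleForms k I) f (nab.toFun m)
  map_add' m m' := by simp only [map_add]; abel
  -- The two Leibniz terms `f m ⊗ d c` cancel, which makes the defect linear over the structure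
  -- ring.
  map_smul' c m := by
    simp only [map_smul, leibniz, map_add, LinearMap.rTensor_tmul, RingHom.id_apply, smul_sub]
    abel

theorem Connection.homDefect_apply (f : M →ₗ[A] N) (m : M) :
    nab.homDefect nab' f m =
      nab'.toFun (f m) - LinearMap.rTensor (PoleForms k I) f (nab.toFun m) := rfl

/-- Two representations with the same `P` differ only in the image of ε²τ, and the left inverse `r`
of ε²τ reads off the coefficient there. -/
theorem Represents.unique (h : Represents nab nab' eps τ P Q) {Q' : M →ₗ[A] PoleValued k I M}
    (h' : Represents nab nab' eps τ P Q') {r : N →ₗ[A] M} (hr : r ∘ₗ eps ∘ₗ eps ∘ₗ τ = LinearMap.id) :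
    Q = Q' := by
  ext m
  have e := congrArg (LinearMap.rTensor (PoleForms k I) r) (add_left_cancel ((h m).symm.trans (h' m)))
  simpa only [← LinearMap.rTensor_comp_apply, hr, LinearMap.rTensor_id, LinearMap.id_apply] using e

/-- If `∇ + ε P + ε² Q` is integrable, its term of degree two in `ε` vanishes. -/
theorem Represents.endOne_eq (h : Represents nab nab' eps τ P Q)
    (heps : ∀ n, nab'.toFun (eps n) = LinearMap.rTensor (PoleForms k I) eps (nab'.toFun n))
    (hnil : eps ^ 3 = 0) {r : N →ₗ[A] M} (hr : r ∘ₗ eps ∘ₗ eps ∘ₗ τ = LinearMap.id)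
    (hM : ∀ m, nab.curvature m = 0) (hN : ∀ n, nab'.curvature n = 0) (hP : nab.endOne P = 0) :
    nab.endOne Q = -oneMulOne P P := by
  ext m
  -- Flatness of `nab` and closedness of `P` leave only the ε²-summand of the curvature formula,
  -- which `r` extracts.
  have e := congrArg (LinearMap.rTensor (PolarForms k I) r) (h.curvature heps hnil m)
  rw [hN, hM, hP, LinearMap.zero_apply, map_zero, map_zero, map_zero, zero_add, zero_add,
    ← LinearMap.rTensor_comp_apply, hr, LinearMap.rTensor_id, LinearMap.id_apply] at e
  exact eq_neg_of_add_eq_zero_left e.symm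

/-- Tensoring is right exact, so the kernel of `p ⊗ 1` is the image of `f ⊗ 1`, on which `g ⊗ 1` is
the identity. No flatness of the module of forms is needed. -/
theorem rTensor_eq_self {L : Type u} [AddCommGroup L] [Module A L]
    {f g : N →ₗ[A] N} {p : N →ₗ[A] L} (hker : LinearMap.ker p = LinearMap.range f)
    (hp : Function.Surjective p) (hg : g ∘ₗ f = f) {t : PoleValued k I N}
    (ht : LinearMap.rTensor (PoleForms k I) p t = 0) :
    LinearMap.rTensor (PoleForms k I) g t = t := by
  obtain ⟨u, rfl⟩ := (rTensor_exact (PoleForms k I) (LinearMap.exact_iff.2 hker) hp t).1 ht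
  rw [← LinearMap.rTensor_comp_apply, hg]

/-- The map `(m₀, m₁, m₂) ↦ τ m₀ + ε τ m₁ + ε² τ m₂`. -/
def tripleMap (eps : N →ₗ[A] N) (τ : M →ₗ[A] N) : M × M × M →ₗ[A] N :=
  τ.coprod ((eps ∘ₗ τ).coprod (eps ∘ₗ eps ∘ₗ τ))

theorem tripleMap_apply (m : M × M × M) :
    tripleMap eps τ m = τ m.1 + (eps (τ m.2.1) + eps (eps (τ m.2.2))) := rfl

/-- The coefficient of `ε²`. -/
def lastCoeff (h : Function.Bijective (tripleMap eps τ)) : N →ₗ[A] M :=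
  LinearMap.snd A M M ∘ₗ LinearMap.snd A M (M × M) ∘ₗ
    (LinearEquiv.ofBijective (tripleMap eps τ) h).symm.toLinearMap

theorem lastCoeff_tripleMap (h : Function.Bijective (tripleMap eps τ)) (m : M × M × M) :
    lastCoeff h (tripleMap eps τ m) = m.2.2 := by
  have e := (LinearEquiv.ofBijective (tripleMap eps τ) h).symm_apply_apply m
  exact congrArg (fun t => t.2.2) e

theorem lastCoeff_comp (h : Function.Bijective (tripleMap eps τ)) :
    lastCoeff h ∘ₗ eps ∘ₗ eps ∘ₗ τ = LinearMap.id := by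
  ext m
  simpa [tripleMap_apply] using lastCoeff_tripleMap h (0, 0, m)

/-- Multiplication by ε² moves the first coordinate to the last place and kills the others. Hence an
element of the image of ε² is determined by its last coordinate. -/
theorem comp_lastCoeff (h : Function.Bijective (tripleMap eps τ)) (hnil : eps ^ 3 = 0) :
    (eps ∘ₗ eps ∘ₗ τ ∘ₗ lastCoeff h) ∘ₗ (eps ^ 2) = eps ^ 2 := by
  have e0 : ∀ m, eps (eps (eps m)) = 0 := DFunLike.congr_fun hnil
  ext n
  obtain ⟨m, rfl⟩ := h.2 n
  have e : (eps ^ 2) (tripleMap eps τ m) = tripleMap eps τ (0, 0, m.1) := by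
    simp [tripleMap_apply, pow_two, e0]
  rw [LinearMap.comp_apply, e]
  simp only [LinearMap.comp_apply, lastCoeff_tripleMap]
  simp [tripleMap_apply]

/-- A lift `τ` of a trivialization `σ` of the reduction modulo `ε²` represents the connection, with
the `ε²`-coefficient of its defect as term of degree two. -/
theorem represents_of_lift {L : Type u} [AddCommGroup L] [Module A L] {nab₁ : Connection k I L}
    {eps₁ : L →ₗ[A] L} {p : N →ₗ[A] L} {σ : M →ₗ[A] L} (hnil : eps ^ 3 = 0)
    (hker : LinearMap.ker p = LinearMap.range (eps ^ 2)) (hp : Function.Surjective p)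
    (hpnab : ∀ v, nab₁.toFun (p v) = LinearMap.rTensor (PoleForms k I) p (nab'.toFun v))
    (hpeps : ∀ v, p (eps v) = eps₁ (p v)) (hτ : ∀ m, p (τ m) = σ m)
    (hσ : ∀ m, nab₁.toFun (σ m) = LinearMap.rTensor (PoleForms k I) σ (nab.toFun m) +
      LinearMap.rTensor (PoleForms k I) (eps₁ ∘ₗ σ) (P m))
    (h : Function.Bijective (tripleMap eps τ)) :
    Represents nab nab' eps τ P (LinearMap.rTensor (PoleForms k I) (lastCoeff h) ∘ₗ
      (nab.homDefect nab' τ - LinearMap.rTensor (PoleForms k I) (eps ∘ₗ τ) ∘ₗ P)) := by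
  intro m
  have e1 : p ∘ₗ τ = σ := LinearMap.ext hτ
  have e2 : p ∘ₗ eps ∘ₗ τ = eps₁ ∘ₗ σ := by
    rw [← e1]
    ext m
    exact hpeps _
  -- The difference vanishes modulo ε² because `σ` identifies the reduced connection with ∇ + εP. It
  -- therefore lies in the image of ε² and is recovered from its last coefficient.
  have ht : LinearMap.rTensor (PoleForms k I) p (nab'.toFun (τ m) -
      LinearMap.rTensor (PoleForms k I) τ (nab.toFun m) -
      LinearMap.rTensor (PoleForms k I) (eps ∘ₗ τ) (P m)) = 0 := by
    rw [map_sub, map_sub, ← hpnab, hτ, hσ, ← LinearMap.rTensor_comp_apply,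
      ← LinearMap.rTensor_comp_apply, e1, e2]
    abel
  have key := rTensor_eq_self hker hp (comp_lastCoeff h hnil) ht
  have e3 : eps ∘ₗ eps ∘ₗ τ ∘ₗ lastCoeff h = (eps ∘ₗ eps ∘ₗ τ) ∘ₗ lastCoeff h := rfl
  rw [e3, LinearMap.rTensor_comp_apply] at key
  rw [LinearMap.comp_apply, LinearMap.sub_apply, LinearMap.comp_apply, Connection.homDefect_apply,
    key]
  abel

/-- The terms of degree two of composable changes of trivialization. -/
theorem change_comp (hnil : eps ^ 3 = 0) {τ₁ τ₂ : M →ₗ[A] N}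
    {a₀₁ a₁₂ a₀₂ b₀₁ b₁₂ b₀₂ : M →ₗ[A] M}
    (h₀₁ : τ₁ = τ + eps ∘ₗ τ ∘ₗ a₀₁ + eps ∘ₗ eps ∘ₗ τ ∘ₗ b₀₁)
    (h₁₂ : τ₂ = τ₁ + eps ∘ₗ τ₁ ∘ₗ a₁₂ + eps ∘ₗ eps ∘ₗ τ₁ ∘ₗ b₁₂)
    (h₀₂ : τ₂ = τ + eps ∘ₗ τ ∘ₗ a₀₂ + eps ∘ₗ eps ∘ₗ τ ∘ₗ b₀₂) (ha : a₀₂ = a₀₁ + a₁₂)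
    {r : N →ₗ[A] M} (hr : r ∘ₗ eps ∘ₗ eps ∘ₗ τ = LinearMap.id) :
    b₀₂ = b₀₁ + b₁₂ + a₀₁ ∘ₗ a₁₂ := by
  have e0 : ∀ m, eps (eps (eps m)) = 0 := DFunLike.congr_fun hnil
  have hr' : ∀ m, r (eps (eps (τ m))) = m := DFunLike.congr_fun hr
  ext m
  -- Both expansions of `τ₂` are compared in degree two; the product `a₀₁ a₁₂` comes from
  -- substituting `τ₁` into the term `ε τ₁ a₁₂`.
  have e : eps (eps (τ (b₀₂ m))) = eps (eps (τ (b₀₁ m + b₁₂ m + a₀₁ (a₁₂ m)))) := by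
    have h := DFunLike.congr_fun (h₀₂.symm.trans h₁₂) m
    simp only [h₀₁, ha, LinearMap.add_apply, LinearMap.comp_apply, map_add, e0, add_zero] at h ⊢
    rw [← sub_eq_zero] at h ⊢
    rw [← h]
    abel
  have h := congrArg r e
  simp only [hr'] at h
  exact h

end Stalks

/-! ### Sections of vector bundles and their germs. -/

section BundleSections
variable {X : LocallyRingedSpace.{u}} {n : ℕ} (E : VectorBundle X n)

theorem LocallyOn.of_forall {V : Opens X} {F : ∀ W : Opens X, W ≤ V → Prop} (h : F V le_rfl) :
    LocallyOn V F := fun x => ⟨V, le_rfl, x.2, h⟩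

theorem germAt_mul {V : Opens X} (f g : Regular X V) (x : V) :
    germAt (f * g) x = germAt f x * germAt g x := map_mul _ _ _

/-- A germ that vanishes at a point vanishes nearby. -/
theorem exists_germAt_eq_zero {V : Opens X} (f : Regular X V) (x : V) (h : germAt f x = 0) :
    ∃ (W : Opens X) (hW : W ≤ V), x.1 ∈ W ∧ ∀ y : W, germAt f ⟨y.1, hW y.2⟩ = 0 := by
  obtain ⟨W, hx, i₁, i₂, e⟩ := TopCat.Presheaf.germ_eq X.presheaf x.1 x.2 x.2 f 0
    (h.trans (map_zero _).symm)
  refine ⟨W, i₁.le, hx, fun y => ?_⟩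
  have e' : Regular.res i₁.le f = 0 := e.trans (map_zero _)
  rw [← germAt_res i₁.le f y, e']
  exact map_zero _

theorem exists_germAt_eq {x : X} (c : Stalk X x) :
    ∃ (V : Opens X) (hx : x ∈ V) (f : Regular X V), germAt f ⟨x, hx⟩ = c := by
  obtain ⟨V, hx, f, hf⟩ := TopCat.Presheaf.exists_germ_eq X.presheaf c
  exact ⟨V, hx, f, hf⟩

/-- The sections of a `VectorBundle` are given by a bare local predicate. Their stability under
regular functions, and below under ε, has to be extracted from the coordinates in a local frame. -/
theorem VectorBundle.smul_pred {V : Opens X} (f : Regular X V) {s : ∀ x : V, E.fiber x.1}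
    (hs : E.sheaf.pred s) : E.sheaf.pred fun x : V => germAt f x • s x := by
  refine E.of_local fun x => ?_
  obtain ⟨W, hx, r, e, -, he⟩ := E.locally_free x.1
  refine ⟨W ⊓ V, inf_le_right, ⟨hx, x.2⟩, (he _ inf_le_left _).2 fun y => ?_⟩
  obtain ⟨W1, h1, hy1, c1, hc1⟩ := (he _ inf_le_left _).1 (E.res (inf_le_right : W ⊓ V ≤ V) hs) y
  refine ⟨W1, h1, hy1, fun i j => Regular.res (h1.trans inf_le_right) f * c1 i j, fun z => ?_⟩
  have e1 := hc1 z
  simp only at e1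
  simp only [e1, Finset.smul_sum, germAt_mul, germAt_res, mul_smul]

theorem VectorBundle.eps_pred {V : Opens X} {s : ∀ x : V, E.fiber x.1}
    (hs : E.sheaf.pred s) : E.sheaf.pred fun x : V => E.eps x.1 (s x) := by
  refine E.of_local fun x => ?_
  obtain ⟨W, hx, r, e, -, he⟩ := E.locally_free x.1
  refine ⟨W ⊓ V, inf_le_right, ⟨hx, x.2⟩, (he _ inf_le_left _).2 fun y => ?_⟩
  obtain ⟨W1, h1, hy1, c, hc⟩ := (he _ inf_le_left _).1 (E.res (inf_le_right : W ⊓ V ≤ V) hs) y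
  -- Multiplication by ε shifts the coefficients up by one place; the top one is dropped because
  -- ε^(n+1) = 0.
  refine ⟨W1, h1, hy1, fun i => Fin.cons 0 fun j : Fin n => c i j.castSucc, fun z => ?_⟩
  have e1 := hc z
  simp only at e1
  simp only [e1, map_sum, map_smul]
  refine Finset.sum_congr rfl fun i _ => ?_
  rw [Fin.sum_univ_castSucc, Fin.sum_univ_succ]
  have h0 : ∀ m, E.eps z.1 ((E.eps z.1 ^ n) m) = 0 := fun m => by
    rw [← Module.End.mul_apply, ← pow_succ', E.eps_pow]; rfl
  have h1 : germAt (0 : Regular X W1) z = 0 := map_zero _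
  simp only [Fin.val_last, h0, smul_zero, add_zero, Fin.cons_zero, h1, zero_smul, zero_add,
    Fin.cons_succ, Fin.val_castSucc, Fin.val_succ, pow_succ', Module.End.mul_apply]

theorem VectorBundle.eps_pow_pred {V : Opens X} {s : ∀ x : V, E.fiber x.1}
    (hs : E.sheaf.pred s) (j : ℕ) : E.sheaf.pred fun x : V => (E.eps x.1 ^ j) (s x) := by
  induction j with
  | zero => exact hs
  | succ j ih =>
    simp only [pow_succ', Module.End.mul_apply]
    exact E.eps_pred ih

theorem VectorBundle.sum_pred {V : Opens X} {ι : Type*} (t : Finset ι)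
    {s : ι → ∀ x : V, E.fiber x.1} (hs : ∀ i ∈ t, E.sheaf.pred (s i)) :
    E.sheaf.pred fun x : V => ∑ i ∈ t, s i x := by
  classical
  induction t using Finset.induction_on with
  | empty => simpa using E.zero_pred
  | insert i t hi ih =>
    simp only [Finset.sum_insert hi]
    exact E.add_pred (hs i (by simp)) (ih fun j hj => hs j (by simp [hj]))

/-- The members of a local frame are sections. -/
theorem VectorBundle.frame_pred {V : Opens X} {r : ℕ} {e : Fin r → ∀ y : V, E.fiber y.1}
    (he : ∀ (W : Opens X) (h : W ≤ V) (s : ∀ y : W, E.fiber y.1), E.sheaf.pred s ↔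
      LocallyOn W fun W' h' => ∃ c : Fin r → Fin (n + 1) → Regular X W', ∀ y : W',
        s ⟨y.1, h' y.2⟩ = ∑ i, ∑ j : Fin (n + 1),
          germAt (c i j) y • (E.eps y.1 ^ (j : ℕ)) (e i ⟨y.1, h (h' y.2)⟩)) (i : Fin r) :
    E.sheaf.pred (e i) := by
  refine (he V le_rfl _).2 (LocallyOn.of_forall ⟨Pi.single i (Pi.single 0 1), fun y => ?_⟩)
  have h1 : germAt (1 : Regular X V) y = 1 := map_one _
  have h0 : germAt (0 : Regular X V) y = 0 := map_zero _
  rw [Finset.sum_eq_single i, Finset.sum_eq_single 0]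
  · simp [h1]
  · intro j _ hj
    simp [hj, h0]
  · simp
  · intro j _ hj
    simp [hj, h0]
  · simp

/-- Every element of a stalk is the germ of a section. -/
theorem VectorBundle.exists_section {x : X} (m : E.fiber x) :
    ∃ (V : Opens X) (hx : x ∈ V) (s : ∀ y : V, E.fiber y.1), E.sheaf.pred s ∧ s ⟨x, hx⟩ = m := by
  obtain ⟨V, hx, r, e, hb, he⟩ := E.locally_free x
  have hm : m ∈ Submodule.span (Stalk X x) (Set.range
      (fun p : Fin r × Fin (n + 1) => (E.eps x ^ (p.2 : ℕ)) (e p.1 ⟨x, hx⟩))) := by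
    have := (hb ⟨x, hx⟩).2
    simp only at this
    rw [this]; trivial
  -- The germs of sections form a submodule of the stalk that contains the frame with its powers of
  -- ε, so they fill the whole span.
  induction hm using Submodule.span_induction with
  | mem m hm =>
    obtain ⟨p, rfl⟩ := hm
    exact ⟨V, hx, _, E.eps_pow_pred (E.frame_pred he p.1) p.2, rfl⟩
  | zero => exact ⟨V, hx, _, E.zero_pred, rfl⟩
  | add m m' _ _ h h' =>
    obtain ⟨W, hxW, s, hs, rfl⟩ := h
    obtain ⟨W', hxW', s', hs', rfl⟩ := h'
    exact ⟨W ⊓ W', ⟨hxW, hxW'⟩, _, E.add_pred (E.res inf_le_left hs) (E.res inf_le_right hs'), rfl⟩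
  | smul c m _ h =>
    obtain ⟨W, hxW, s, hs, rfl⟩ := h
    obtain ⟨W', hxW', f, rfl⟩ := exists_germAt_eq c
    refine ⟨W ⊓ W', ⟨hxW, hxW'⟩, _, E.smul_pred (Regular.res inf_le_right f)
      (E.res inf_le_left hs), ?_⟩
    rw [germAt_res]

/-- Serves to treat the finitely many coefficients, or members, of a frame on one common
neighbourhood. -/
theorem exists_opens_of_finite {ι : Type*} [Finite ι] {V : Opens X} (x : V) {F : ι → V → Prop}
    (h : ∀ i, ∃ (W : Opens X) (hW : W ≤ V), x.1 ∈ W ∧ ∀ y : W, F i ⟨y.1, hW y.2⟩) :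
    ∃ (W : Opens X) (hW : W ≤ V), x.1 ∈ W ∧ ∀ (y : W) (i : ι), F i ⟨y.1, hW y.2⟩ := by
  choose W hW hx hF using h
  refine ⟨V ⊓ ⟨⋂ i, W i, isOpen_iInter_of_finite fun i => (W i).isOpen⟩, inf_le_left,
    ⟨x.2, Set.mem_iInter.2 hx⟩, fun y i => ?_⟩
  exact hF i ⟨y.1, Set.mem_iInter.1 y.2.2 i⟩

/-- Sections with the same germ at a point agree nearby. -/
theorem VectorBundle.exists_eq {V : Opens X} {s t : ∀ x : V, E.fiber x.1}
    (hs : E.sheaf.pred s) (ht : E.sheaf.pred t) (x : V) (hst : s x = t x) :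
    ∃ (W : Opens X) (hW : W ≤ V), x.1 ∈ W ∧ ∀ y : W, s ⟨y.1, hW y.2⟩ = t ⟨y.1, hW y.2⟩ := by
  obtain ⟨V', hx, r, e, hb, he⟩ := E.locally_free x.1
  obtain ⟨W, hW, hxW, c, hc⟩ := (he _ inf_le_left _).1
    (E.res (inf_le_right : V' ⊓ V ≤ V) (E.sub_pred hs ht)) ⟨x.1, hx, x.2⟩
  simp only at hc
  -- The coefficients of `s - t` in the frame have zero germ at `x` by linear independence, and a
  -- zero germ is zero nearby.
  have h0 : ∀ p : Fin r × Fin (n + 1), germAt (c p.1 p.2) ⟨x.1, hxW⟩ = 0 := by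
    have h := Fintype.linearIndependent_iff.1 (hb ⟨x.1, hx⟩).1
      (fun p => germAt (c p.1 p.2) ⟨x.1, hxW⟩)
    refine h ?_
    rw [Fintype.sum_prod_type]
    exact (hc ⟨x.1, hxW⟩).symm.trans (sub_eq_zero.2 hst)
  obtain ⟨W', hW', hxW', h'⟩ := exists_opens_of_finite (V := W) ⟨x.1, hxW⟩
    (F := fun (p : Fin r × Fin (n + 1)) y => germAt (c p.1 p.2) y = 0)
    (fun p => exists_germAt_eq_zero _ _ (h0 p))
  refine ⟨W', (hW'.trans hW).trans inf_le_right, hxW', fun y => sub_eq_zero.1 ?_⟩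
  have h2 := hc ⟨y.1, hW' y.2⟩
  rw [h2]
  refine Finset.sum_eq_zero fun i _ => Finset.sum_eq_zero fun j _ => ?_
  rw [h' y (i, j), zero_smul]

/-- The kernel of `ε` is the image of `ε ^ n`. -/
theorem VectorBundle.exists_of_eps_eq_zero {x : X} {m : E.fiber x} (hm : E.eps x m = 0) :
    ∃ m', m = (E.eps x ^ n) m' := by
  obtain ⟨V, hx, r, e, hb, -⟩ := E.locally_free x
  have hmem : m ∈ Submodule.span (Stalk X x) (Set.range
      (fun p : Fin r × Fin (n + 1) => (E.eps x ^ (p.2 : ℕ)) (e p.1 ⟨x, hx⟩))) := by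
    have := (hb ⟨x, hx⟩).2
    simp only at this
    rw [this]; trivial
  obtain ⟨c, rfl⟩ := (Submodule.mem_span_range_iff_exists_fun _).1 hmem
  have hlast : ∀ v, E.eps x ((E.eps x ^ n) v) = 0 := fun v => by
    rw [← Module.End.mul_apply, ← pow_succ', E.eps_pow]; rfl
  -- In the frame, `ε m` has the coefficients of `m` shifted up by one place. Independence therefore
  -- kills all coefficients of `m` except those of ε^n, which ε annihilates anyway.
  have h := Fintype.linearIndependent_iff.1 (hb ⟨x, hx⟩).1
    (fun p => (Fin.cons 0 fun j : Fin n => c (p.1, j.castSucc) : Fin (n + 1) → Stalk X x) p.2) (by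
      rw [← hm, Fintype.sum_prod_type, Fintype.sum_prod_type, map_sum]
      refine Finset.sum_congr rfl fun i _ => ?_
      rw [Fin.sum_univ_succ, Fin.sum_univ_castSucc, map_add, map_sum]
      simp only [Fin.cons_zero, zero_smul, zero_add, Fin.cons_succ, map_smul, Fin.val_last, hlast,
        smul_zero, add_zero, Fin.val_castSucc, Fin.val_succ, pow_succ', Module.End.mul_apply])
  refine ⟨∑ i, c (i, Fin.last n) • e i ⟨x, hx⟩, ?_⟩
  rw [Fintype.sum_prod_type, map_sum]
  refine Finset.sum_congr rfl fun i _ => ?_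
  rw [Fin.sum_univ_castSucc, map_smul, Finset.sum_eq_zero, zero_add, Fin.val_last]
  intro j _
  have hj := h (i, j.succ)
  simp only [Fin.cons_succ] at hj
  rw [hj, zero_smul]

/-- Local frames of a vector bundle on `X`. -/
theorem VectorBundle.exists_frame (E : VectorBundle X 0) (x : X) :
    ∃ V : Opens X, x ∈ V ∧ ∃ (r : ℕ) (e : Fin r → ∀ y : V, E.fiber y.1),
      (∀ y : V, LinearIndependent (Stalk X y.1) (fun i => e i y) ∧
        Submodule.span (Stalk X y.1) (Set.range fun i => e i y) = ⊤) ∧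
      ∀ (W : Opens X) (h : W ≤ V) (s : ∀ y : W, E.fiber y.1), E.sheaf.pred s ↔
        LocallyOn W fun W' h' => ∃ c : Fin r → Regular X W', ∀ y : W',
          s ⟨y.1, h' y.2⟩ = ∑ i, germAt (c i) y • e i ⟨y.1, h (h' y.2)⟩ := by
  obtain ⟨V, hx, r, e, hb, he⟩ := E.locally_free x
  refine ⟨V, hx, r, e, fun y => ?_, fun W h s => (he W h s).trans ?_⟩
  -- Over `X` itself the only power of ε is ε⁰ = 1, so the second index is a dummy.
  · have h : (fun p : Fin r × Fin (0 + 1) => (E.eps y.1 ^ (p.2 : ℕ)) (e p.1 y)) =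
        (fun i => e i y) ∘ (Equiv.prodUnique (Fin r) (Fin 1)) := by
      funext p
      obtain ⟨i, j⟩ := p
      have : j = 0 := Subsingleton.elim (α := Fin 1) _ _
      subst this
      simp
    obtain ⟨h1, h2⟩ := hb y
    rw [h] at h1 h2
    rw [(Equiv.surjective _).range_comp] at h2
    exact ⟨(linearIndependent_equiv _).1 h1, h2⟩
  · constructor
    · intro H z
      obtain ⟨W', h', hz, c, hc⟩ := H z
      exact ⟨W', h', hz, fun i => c i 0, fun y => by simpa using hc y⟩
    · intro H z
      obtain ⟨W', h', hz, c, hc⟩ := H z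
      exact ⟨W', h', hz, fun i _ => c i, fun y => by simpa using hc y⟩

end BundleSections

/-! ### Morphisms of sheaves given by families of stalk maps. -/

section SheafHoms
variable {X : LocallyRingedSpace.{u}} {n m l : ℕ} {E : VectorBundle X n} {F : VectorBundle X m}
  {G : VectorBundle X l} {V : Opens X}

/-- A family of linear maps of stalks that is a morphism of sheaves over `V`. -/
def IsSheafHom (E : VectorBundle X n) (F : VectorBundle X m)
    (f : ∀ x : V, E.fiber x.1 →ₗ[Stalk X x.1] F.fiber x.1) : Prop :=
  ∀ (W : Opens X) (h : W ≤ V) (s : ∀ x : W, E.fiber x.1), E.sheaf.pred s →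
    F.sheaf.pred fun x : W => f ⟨x.1, h x.2⟩ (s x)

theorem IsSheafHom.res {W : Opens X} (h : W ≤ V)
    {f : ∀ x : V, E.fiber x.1 →ₗ[Stalk X x.1] F.fiber x.1} (hf : IsSheafHom E F f) :
    IsSheafHom E F fun x : W => f ⟨x.1, h x.2⟩ :=
  fun W' h' s hs => hf W' (h'.trans h) s hs

theorem IsSheafHom.comp {g : ∀ x : V, F.fiber x.1 →ₗ[Stalk X x.1] G.fiber x.1}
    {f : ∀ x : V, E.fiber x.1 →ₗ[Stalk X x.1] F.fiber x.1} (hg : IsSheafHom F G g)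
    (hf : IsSheafHom E F f) : IsSheafHom E G fun x => g x ∘ₗ f x :=
  fun W h _ hs => hg W h _ (hf W h _ hs)

theorem IsSheafHom.sub {f g : ∀ x : V, E.fiber x.1 →ₗ[Stalk X x.1] F.fiber x.1}
    (hf : IsSheafHom E F f) (hg : IsSheafHom E F g) : IsSheafHom E F fun x => f x - g x :=
  fun W h s hs => F.sub_pred (hf W h s hs) (hg W h s hs)

theorem isSheafHom_eps : IsSheafHom F F fun x : V => F.eps x.1 := fun _ _ _ hs => F.eps_pred hs

end SheafHoms

/-! ### Functoriality of the sections of ℰ ⊗ Ω¹(D). -/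

section PoleValues
variable {k : Type u} [Field k] {X : LocallyRingedSpace.{u}} [SpaceOver k X]
  {D : EffectiveCartierDivisor X} {n m : ℕ} {E : VectorBundle X n} {E' : VectorBundle X m}

theorem IsPoleValued.map {V : Opens X} (f : ∀ x : V, E.fiber x.1 →ₗ[Stalk X x.1] E'.fiber x.1)
    (hf : IsSheafHom E E' f)
    {t : ∀ x : V, PoleValued k (D.ideal x.1) (E.fiber x.1)} (ht : IsPoleValued k D E t) :
    IsPoleValued k D E' fun x => LinearMap.rTensor (PoleForms k (D.ideal x.1)) (f x) (t x) := by
  refine LocallySum.map (isPoleValued_restricts E')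
    (fun x : V => (LinearMap.rTensor (PoleForms k (D.ideal x.1)) (f x)).toAddMonoidHom) ?_ ht
  rintro W h _ ⟨s, w, hs, hw, rfl⟩
  exact LocallySum.of_mem ⟨_, w, hf W h s hs, hw, rfl⟩

end PoleValues

/-! ### Local lifting out of a locally free sheaf. -/

section Sections
variable {X : LocallyRingedSpace.{u}} {n m : ℕ} {F : VectorBundle X n}
  {G : VectorBundle X m} {V : Opens X}

/-- Morphisms from a vector bundle on `X` lift locally along surjective morphisms. -/
theorem exists_lift (E : VectorBundle X 0) (p : ∀ x : X, F.fiber x →ₗ[Stalk X x] G.fiber x)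
    (hp : IsSheafHom F G fun x : (⊤ : Opens X) => p x.1) (hsurj : ∀ x, Function.Surjective (p x))
    {σ : ∀ x : V, E.fiber x.1 →ₗ[Stalk X x.1] G.fiber x.1} (hσ : IsSheafHom E G σ) (x : V) :
    ∃ (W : Opens X) (hW : W ≤ V) (τ : ∀ y : W, E.fiber y.1 →ₗ[Stalk X y.1] F.fiber y.1),
      x.1 ∈ W ∧ IsSheafHom E F τ ∧ ∀ (y : W) (m : E.fiber y.1),
        p y.1 (τ y m) = σ ⟨y.1, hW y.2⟩ m := by
  obtain ⟨V', hx, r, e, hb, he⟩ := E.exists_frame x.1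
  have hepred : ∀ i, E.sheaf.pred (e i) := fun i => by
    refine (he V' le_rfl _).2 (LocallyOn.of_forall ⟨Pi.single i 1, fun y => ?_⟩)
    have h1 : germAt (1 : Regular X V') y = 1 := map_one _
    have h0 : germAt (0 : Regular X V') y = 0 := map_zero _
    rw [Finset.sum_eq_single i]
    · simp [h1]
    · intro j _ hj
      simp [hj, h0]
    · simp
  -- Surjectivity on the stalk at `x` lifts the germ of σ(e_i). A section through the lift maps to
  -- σ(e_i) at `x`, hence also on a neighbourhood.
  have key : ∀ i : Fin r, ∃ (W : Opens X) (hW : W ≤ V' ⊓ V) (s : ∀ y : W, F.fiber y.1),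
      x.1 ∈ W ∧ F.sheaf.pred s ∧ ∀ y : W,
        p y.1 (s y) = σ ⟨y.1, (hW y.2).2⟩ (e i ⟨y.1, (hW y.2).1⟩) := by
    intro i
    obtain ⟨u, hu⟩ := hsurj x.1 (σ x (e i ⟨x.1, hx⟩))
    obtain ⟨W, hxW, s, hs, rfl⟩ := F.exists_section u
    have h1 : G.sheaf.pred fun y : (W ⊓ (V' ⊓ V) : Opens X) => p y.1 (s ⟨y.1, y.2.1⟩) :=
      hp _ le_top _ (F.res inf_le_left hs)
    have h2 : G.sheaf.pred fun y : (W ⊓ (V' ⊓ V) : Opens X) =>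
        σ ⟨y.1, y.2.2.2⟩ (e i ⟨y.1, y.2.2.1⟩) :=
      hσ _ (inf_le_right.trans inf_le_right) _ (E.res (inf_le_right.trans inf_le_left) (hepred i))
    obtain ⟨W', hW', hxW', h'⟩ := G.exists_eq h1 h2 ⟨x.1, hxW, hx, x.2⟩ hu
    exact ⟨W', hW'.trans inf_le_right, _, hxW', F.res (hW'.trans inf_le_left) hs, h'⟩
  choose W hW s hxW hs hps using key
  obtain ⟨W₀, hW₀, hxW₀, hall⟩ := exists_opens_of_finite (V := V' ⊓ V) ⟨x.1, hx, x.2⟩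
    (F := fun i y => y.1 ∈ W i) (fun i => ⟨W i, hW i, hxW i, fun y => y.2⟩)
  let B : ∀ y : W₀, Module.Basis (Fin r) (Stalk X y.1) (E.fiber y.1) := fun y =>
    Module.Basis.mk (hb ⟨y.1, (hW₀ y.2).1⟩).1 (hb ⟨y.1, (hW₀ y.2).1⟩).2.ge
  have hB : ∀ y i, B y i = e i ⟨y.1, (hW₀ y.2).1⟩ := fun y i => Module.Basis.mk_apply _ _ _
  -- A frame admits arbitrary values, so the lifts `s i` define a linear map on every stalk. It
  -- preserves sections because these have regular coefficients in the frame.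
  let τ : ∀ y : W₀, E.fiber y.1 →ₗ[Stalk X y.1] F.fiber y.1 := fun y =>
    (B y).constr (Stalk X y.1) fun i => s i ⟨y.1, hall y i⟩
  have hτ : ∀ y i, τ y (e i ⟨y.1, (hW₀ y.2).1⟩) = s i ⟨y.1, hall y i⟩ := fun y i => by
    rw [← hB y i]
    exact (B y).constr_basis _ _ i
  refine ⟨W₀, hW₀.trans inf_le_right, τ, hxW₀, ?_, fun y => ?_⟩
  · intro W' h' t ht
    refine F.of_local fun z => ?_
    obtain ⟨W'', h'', hz, c, hc⟩ := (he W' (h'.trans (hW₀.trans inf_le_left)) t).1 ht z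
    refine ⟨W'', h'', hz, ?_⟩
    simp only [hc, map_sum, map_smul]
    refine F.sum_pred _ fun i _ => F.smul_pred (c i) ?_
    have e1 : ∀ y : W'', τ ⟨y.1, h' (h'' y.2)⟩ (e i ⟨y.1, (hW₀ (h' (h'' y.2))).1⟩) =
      s i ⟨y.1, hall ⟨y.1, h' (h'' y.2)⟩ i⟩ := fun y => hτ _ _
    simp only [e1]
    exact F.res (fun y hy => hall ⟨y, h' (h'' hy)⟩ i) (hs i)
  · have e1 : p y.1 ∘ₗ τ y = σ ⟨y.1, (hW₀ y.2).2⟩ := by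
      refine (B y).ext fun i => ?_
      rw [LinearMap.comp_apply, hB, hτ]
      exact hps i ⟨y.1, hall y i⟩
    exact DFunLike.congr_fun e1

end Sections

/-! ### Restrictions to smaller thickenings and ε-adic expansions. -/

section Restrictions
variable {k : Type u} [Field k] {X : LocallyRingedSpace.{u}} [SpaceOver k X]
  {D : EffectiveCartierDivisor X} {P : IntegrableConnection k D 0} {n : ℕ}
  {Q : IntegrableConnection k D n} (ρ : Restriction Q P)

theorem Restriction.map_eps_eq_zero {x : X} (v : Q.bundle.fiber x) :
    ρ.map x (Q.bundle.eps x v) = 0 := by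
  rw [ρ.map_eps]
  have := P.bundle.eps_pow x
  rw [zero_add, pow_one] at this
  rw [this, LinearMap.zero_apply]

theorem Restriction.exists_eps_of_map_eq_zero {x : X} {v : Q.bundle.fiber x}
    (h : ρ.map x v = 0) : ∃ v', v = Q.bundle.eps x v' := by
  have h' : v ∈ LinearMap.range (Q.bundle.eps x ^ (0 + 1)) := ρ.ker_map x ▸ h
  obtain ⟨v', rfl⟩ := h'
  exact ⟨v', by rw [zero_add, pow_one]⟩

/-- Subtracting τ(ρ v) from `v` lands in the kernel of ρ, which is the image of ε. This is one step
of the ε-adic expansion of `v`, to be iterated. -/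
theorem Restriction.exists_decomposition {x : X} {τ : P.bundle.fiber x →ₗ[Stalk X x] Q.bundle.fiber x}
    (hτ : ∀ m, ρ.map x (τ m) = m) (v : Q.bundle.fiber x) :
    ∃ m v', v = τ m + Q.bundle.eps x v' := by
  obtain ⟨v', h⟩ := ρ.exists_eps_of_map_eq_zero (v := v - τ (ρ.map x v)) (by rw [map_sub, hτ, sub_self])
  exact ⟨_, v', by rw [← h, add_sub_cancel]⟩

/-- The composite of restrictions. -/
def Restriction.comp {P2 : IntegrableConnection k D 2} {P1 : IntegrableConnection k D 1}
    (π : Restriction P2 P1) (ρ : Restriction P1 P) : Restriction P2 P where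
  map x := ρ.map x ∘ₗ π.map x
  map_section V s hs := ρ.map_section V _ (π.map_section V s hs)
  map_eps x s := by rw [LinearMap.comp_apply, π.map_eps, ρ.map_eps]; rfl
  surjective x := (ρ.surjective x).comp (π.surjective x)
  ker_map x := by
    rw [zero_add, pow_one]
    ext v
    constructor
    · intro h
      obtain ⟨u, hu⟩ := ρ.exists_eps_of_map_eq_zero (v := π.map x v) h
      obtain ⟨u, rfl⟩ := π.surjective x u
      -- After a preimage `u` is chosen, `v` agrees with `ε u` modulo ε², hence is itself a multiple
      -- of ε.
      have h' : v - P2.bundle.eps x u ∈ LinearMap.range (P2.bundle.eps x ^ (1 + 1)) := by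
        rw [← π.ker_map, LinearMap.mem_ker, map_sub, hu, π.map_eps, sub_self]
      obtain ⟨w, hw⟩ := h'
      refine ⟨u + P2.bundle.eps x w, ?_⟩
      rw [map_add]
      exact (sub_eq_iff_eq_add'.1 hw.symm).symm
    · rintro ⟨u, rfl⟩
      rw [LinearMap.mem_ker, LinearMap.comp_apply, π.map_eps, ρ.map_eps_eq_zero]
  map_nabla x s := by
    rw [LinearMap.comp_apply, ρ.map_nabla, π.map_nabla, ← LinearMap.rTensor_comp_apply]

/-- By local freeness the kernel of ε is the image of ε^(n+1). The exponent is at least one, so this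
image lies in the multiples of ε, which ρ kills. This is the source of all injectivity statements
about ε-expansions. -/
theorem Restriction.map_eq_zero_of_eps {n : ℕ} {Q : IntegrableConnection k D (n + 1)}
    (ρ : Restriction Q P) {x : X} {v : Q.bundle.fiber x} (h : Q.bundle.eps x v = 0) :
    ρ.map x v = 0 := by
  obtain ⟨v', rfl⟩ := Q.bundle.exists_of_eps_eq_zero h
  rw [pow_succ', Module.End.mul_apply, ρ.map_eps_eq_zero]

/-- A section τ of ρ yields unique ε-adic expansions: existence by dividing three times by ε,
uniqueness because multiplication by ε loses nothing below the top degree. This is what gives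
meaning to the coefficient of ε². -/
theorem Restriction.tripleMap_bijective {Q : IntegrableConnection k D 2} (ρ : Restriction Q P)
    {x : X} {τ : P.bundle.fiber x →ₗ[Stalk X x] Q.bundle.fiber x}
    (hτ : ∀ m, ρ.map x (τ m) = m) : Function.Bijective (tripleMap (Q.bundle.eps x) τ) := by
  have h3 : ∀ v, Q.bundle.eps x (Q.bundle.eps x (Q.bundle.eps x v)) = 0 :=
    DFunLike.congr_fun (Q.bundle.eps_pow x)
  constructor
  · rw [injective_iff_map_eq_zero]
    rintro ⟨m₀, m₁, m₂⟩ h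
    rw [tripleMap_apply] at h
    have e0 : m₀ = 0 := by
      have := congrArg (ρ.map x) h
      simpa [hτ, ρ.map_eps_eq_zero] using this
    subst e0
    have h1 : Q.bundle.eps x (τ m₁ + Q.bundle.eps x (τ m₂)) = 0 := by simpa using h
    have e1 : m₁ = 0 := by
      simpa [hτ, ρ.map_eps_eq_zero] using ρ.map_eq_zero_of_eps h1
    subst e1
    -- From ε²τm₂ = 0 it follows that ετm₂ = ε²w for some `w`. Then τm₂ − εw is killed by ε, and ρ
    -- maps it to m₂, which must vanish.
    obtain ⟨w, hw⟩ := Q.bundle.exists_of_eps_eq_zero (by simpa using h1 :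
      Q.bundle.eps x (Q.bundle.eps x (τ m₂)) = 0)
    have h2 : Q.bundle.eps x (τ m₂ - Q.bundle.eps x w) = 0 := by
      rw [map_sub, hw, pow_two, Module.End.mul_apply, sub_self]
    have e2 : m₂ = 0 := by
      simpa [hτ, ρ.map_eps_eq_zero] using ρ.map_eq_zero_of_eps h2
    rw [e2]
    rfl
  · intro v
    obtain ⟨m₀, v, rfl⟩ := ρ.exists_decomposition hτ v
    obtain ⟨m₁, v, rfl⟩ := ρ.exists_decomposition hτ v
    obtain ⟨m₂, v, rfl⟩ := ρ.exists_decomposition hτ v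
    refine ⟨(m₀, m₁, m₂), ?_⟩
    simp [tripleMap_apply, h3]

/-- The inverse of a stalkwise bijective sheaf map preserves sections. The coordinates of the germ
at a point extend to sections whose combination equals `s` at that point, hence nearby, and there
the last coordinate is one of the chosen sections. -/
theorem isSheafHom_lastCoeff {n m : ℕ} {E : VectorBundle X n} {F : VectorBundle X m} {V : Opens X}
    {τ : ∀ x : V, E.fiber x.1 →ₗ[Stalk X x.1] F.fiber x.1} (hτ : IsSheafHom E F τ)
    (h : ∀ x : V, Function.Bijective (tripleMap (F.eps x.1) (τ x))) :
    IsSheafHom F E fun x => lastCoeff (h x) := by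
  intro W hW s hs
  refine E.of_local fun x => ?_
  obtain ⟨⟨m₀, m₁, m₂⟩, hm⟩ := (h ⟨x.1, hW x.2⟩).2 (s x)
  obtain ⟨W₀, hx₀, s₀, hs₀, rfl⟩ := E.exists_section m₀
  obtain ⟨W₁, hx₁, s₁, hs₁, rfl⟩ := E.exists_section m₁
  obtain ⟨W₂, hx₂, s₂, hs₂, rfl⟩ := E.exists_section m₂
  let W' : Opens X := W ⊓ (W₀ ⊓ (W₁ ⊓ W₂))
  have hle : W' ≤ V := inf_le_left.trans hW
  have hpred : F.sheaf.pred fun y : W' => tripleMap (F.eps y.1) (τ ⟨y.1, hle y.2⟩)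
      (s₀ ⟨y.1, y.2.2.1⟩, s₁ ⟨y.1, y.2.2.2.1⟩, s₂ ⟨y.1, y.2.2.2.2⟩) :=
    F.add_pred (hτ W' hle _ (E.res (inf_le_right.trans inf_le_left) hs₀))
      (F.add_pred (F.eps_pred (hτ W' hle _
        (E.res (inf_le_right.trans (inf_le_right.trans inf_le_left)) hs₁)))
        (F.eps_pred (F.eps_pred (hτ W' hle _
          (E.res (inf_le_right.trans (inf_le_right.trans inf_le_right)) hs₂)))))
  obtain ⟨W'', h'', hx'', heq⟩ := F.exists_eq hpred (F.res (inf_le_left : W' ≤ W) hs)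
    ⟨x.1, x.2, hx₀, hx₁, hx₂⟩ hm
  refine ⟨W'', h''.trans inf_le_left, hx'', ?_⟩
  have e : ∀ y : W'', lastCoeff (h ⟨y.1, hle (h'' y.2)⟩) (s ⟨y.1, (h'' y.2).1⟩) =
      s₂ ⟨y.1, (h'' y.2).2.2.2⟩ := fun y => by
    have := heq y
    simp only at this
    rw [← this, lastCoeff_tripleMap]
  simp only [e]
  exact E.res (fun y hy => (h'' hy).2.2.2) hs₂

end Restrictions

/-! ### Necessity: an extension makes the Yoneda square a coboundary. -/

section Obstruction
variable {k : Type u} [Field k] {X : LocallyRingedSpace.{u}} [SpaceOver k X]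
  {D : EffectiveCartierDivisor X} {P : IntegrableConnection k D 0}
  {P1 : IntegrableConnection k D 1} {P2 : IntegrableConnection k D 2}

/-- Restriction of a trivialization to a finer covering. -/
def DefinedBy.restrict {ρ : Restriction P1 P} {U V : Covering X} (h : U ≤ V) {z : cocyclesOne P U}
    (S : DefinedBy ρ z) : DefinedBy ρ (cocyclesOneRestrict P h z) where
  σ i x := S.σ i ⟨x.1, h i x.2⟩
  σ_section i W hW s hs := S.σ_section i W (hW.trans (h i)) s hs
  map_σ i x m := S.map_σ i ⟨x.1, h i x.2⟩ m
  σ_change i x m := S.σ_change i ⟨x.1, Covering.inter_mono h i x.2⟩ m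
  nabla_σ i x m := S.nabla_σ i ⟨x.1, Covering.inter_mono h i x.2⟩ m

/-- Local liftings to `ℰ₂` of the trivializations of `ℰ₁`. -/
structure Lifting (π : Restriction P2 P1) {ρ : Restriction P1 P} {U : Covering X}
    {z : cocyclesOne P U} (S : DefinedBy ρ z) where
  τ : ∀ (i : X) (x : U.nhd i), P.bundle.fiber x.1 →ₗ[Stalk X x.1] P2.bundle.fiber x.1
  isSheafHom : ∀ i, IsSheafHom P.bundle P2.bundle (τ i)
  map_τ : ∀ (i : X) (x : U.nhd i) (m : P.bundle.fiber x.1), π.map x.1 (τ i x m) = S.σ i x m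

theorem Restriction.isSheafHom {n m : ℕ} {Q : IntegrableConnection k D n}
    {Q' : IntegrableConnection k D m} (π : Restriction Q Q') {V : Opens X} :
    IsSheafHom Q.bundle Q'.bundle fun x : V => π.map x.1 :=
  fun W _ s hs => π.map_section W s hs

theorem Covering.inter_le (U : Covering X) {p : ℕ} (i : Fin (p + 1) → X) (l : Fin (p + 1)) :
    U.inter i ≤ U.nhd (i l) := fun _ hx => hx l

/-- Coverings assign a neighbourhood to every point, so lifting σ_i near the single point `i`, for
each `i`, already produces a finer covering with lifts on all its members. -/
theorem exists_lifting (π : Restriction P2 P1) {ρ : Restriction P1 P} {U : Covering X}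
    {z : cocyclesOne P U} (S : DefinedBy ρ z) :
    ∃ (V : Covering X) (h : U ≤ V), Nonempty (Lifting π (S.restrict h)) := by
  choose W hW τ hi hτ hm using fun i : X => exists_lift P.bundle π.map π.isSheafHom π.surjective
    (S.σ_section i) (⟨i, (OrderDual.ofDual U i).mem⟩ : U.nhd i)
  exact ⟨OrderDual.toDual fun i => ⟨W i, hi i⟩, hW, ⟨⟨τ, hτ, hm⟩⟩⟩

namespace Lifting
variable {π : Restriction P2 P1} {ρ : Restriction P1 P} {U : Covering X} {z : cocyclesOne P U}
  {S : DefinedBy ρ z} (T : Lifting π S)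

theorem bijective (i : X) (x : U.nhd i) :
    Function.Bijective (tripleMap (P2.bundle.eps x.1) (T.τ i x)) :=
  (π.comp ρ).tripleMap_bijective fun m => by
    change ρ.map x.1 (π.map x.1 _) = m
    rw [T.map_τ, S.map_σ]

/-- The coefficient of `ε²` in the trivialization with index `i`. -/
def coeff (i : X) (x : U.nhd i) : P2.bundle.fiber x.1 →ₗ[Stalk X x.1] P.bundle.fiber x.1 :=
  lastCoeff (T.bijective i x)

theorem isSheafHom_coeff (i : X) : IsSheafHom P2.bundle P.bundle (T.coeff i) :=
  isSheafHom_lastCoeff (T.isSheafHom i) (T.bijective i)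

theorem map_τ_apply (i : X) {x : X} (hx : x ∈ U.nhd i) (m : P.bundle.fiber x) :
    π.map x (T.τ i ⟨x, hx⟩ m) = S.σ i ⟨x, hx⟩ m := T.map_τ i ⟨x, hx⟩ m

theorem coeff_comp (i : X) {x : X} (hx : x ∈ U.nhd i) :
    T.coeff i ⟨x, hx⟩ ∘ₗ P2.bundle.eps x ∘ₗ P2.bundle.eps x ∘ₗ T.τ i ⟨x, hx⟩ = LinearMap.id :=
  lastCoeff_comp (T.bijective i ⟨x, hx⟩)

/-- The kernel of π is the image of ε², and on it `coeff` inverts ε²τ_i. -/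
theorem eps_coeff (i : X) {x : X} (hx : x ∈ U.nhd i) {v : P2.bundle.fiber x}
    (hv : π.map x v = 0) :
    P2.bundle.eps x (P2.bundle.eps x (T.τ i ⟨x, hx⟩ (T.coeff i ⟨x, hx⟩ v))) = v := by
  have h : v ∈ LinearMap.range (P2.bundle.eps x ^ 2) := π.ker_map x ▸ hv
  obtain ⟨v, rfl⟩ := h
  exact DFunLike.congr_fun (comp_lastCoeff (T.bijective i ⟨x, hx⟩) (P2.bundle.eps_pow x)) v

/-- The terms of degree two of the transition maps. -/
def transition : Cochain U 1 (EndZero P) := fun i x =>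
  T.coeff (i 0) ⟨x.1, U.inter_le i 0 x.2⟩ ∘ₗ (T.τ (i 1) ⟨x.1, U.inter_le i 1 x.2⟩ - T.τ (i 0) ⟨x.1, U.inter_le i 0 x.2⟩ -
    P2.bundle.eps x.1 ∘ₗ T.τ (i 0) ⟨x.1, U.inter_le i 0 x.2⟩ ∘ₗ z.1.1 i x)

/-- Both τ_j and τ_i(1 + εa_ij) reduce to σ_j modulo ε². Their difference thus lies in the kernel of
π, where `eps_coeff` writes it as ε²τ_i applied to `transition`. -/
theorem τ_change (i : Fin 2 → X) (x : U.inter i) :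
    T.τ (i 1) ⟨x.1, U.inter_le i 1 x.2⟩ = T.τ (i 0) ⟨x.1, U.inter_le i 0 x.2⟩ +
      P2.bundle.eps x.1 ∘ₗ T.τ (i 0) ⟨x.1, U.inter_le i 0 x.2⟩ ∘ₗ z.1.1 i x +
      P2.bundle.eps x.1 ∘ₗ P2.bundle.eps x.1 ∘ₗ T.τ (i 0) ⟨x.1, U.inter_le i 0 x.2⟩ ∘ₗ T.transition i x := by
  ext m
  have h := T.eps_coeff (i 0) (U.inter_le i 0 x.2) (v := (T.τ (i 1) ⟨x.1, U.inter_le i 1 x.2⟩ -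
    T.τ (i 0) ⟨x.1, U.inter_le i 0 x.2⟩ - P2.bundle.eps x.1 ∘ₗ T.τ (i 0) ⟨x.1, U.inter_le i 0 x.2⟩ ∘ₗ z.1.1 i x) m) (by
      simp only [LinearMap.sub_apply, LinearMap.comp_apply, map_sub, π.map_eps,
        T.map_τ_apply]
      rw [S.σ_change i x m]
      abel)
  rw [LinearMap.add_apply, LinearMap.add_apply]
  simp only [LinearMap.comp_apply, transition]
  simp only at h
  rw [h]
  simp only [LinearMap.sub_apply, LinearMap.comp_apply]
  abel

theorem transition_mem : T.transition ∈ cochainsZero P U 1 := by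
  intro i
  have h0 := (T.isSheafHom (i 0)).res (U.inter_le i 0)
  have h1 := (T.isSheafHom (i 1)).res (U.inter_le i 1)
  have hc := (T.isSheafHom_coeff (i 0)).res (U.inter_le i 0)
  have ha : IsSheafHom P.bundle P.bundle (z.1.1 i) := z.2.1.1 i
  have h2 := ((h1.sub h0).sub (isSheafHom_eps.comp (h0.comp ha)))
  have h3 := hc.comp h2
  exact h3

/-- The terms of degree two of the connection forms. -/
def connectionForm : Cochain U 0 (EndOne P) := fun i x =>
  LinearMap.rTensor (PoleForms k (D.ideal x.1)) (T.coeff (i 0) ⟨x.1, U.inter_le i 0 x.2⟩) ∘ₗ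
    ((P.nabla x.1).homDefect (P2.nabla x.1) (T.τ (i 0) ⟨x.1, U.inter_le i 0 x.2⟩) -
      LinearMap.rTensor (PoleForms k (D.ideal x.1))
        (P2.bundle.eps x.1 ∘ₗ T.τ (i 0) ⟨x.1, U.inter_le i 0 x.2⟩) ∘ₗ z.1.2 i x)

theorem represents (i : Fin 1 → X) (x : U.inter i) :
    Represents (P.nabla x.1) (P2.nabla x.1) (P2.bundle.eps x.1) (T.τ (i 0) ⟨x.1, U.inter_le i 0 x.2⟩)
      (z.1.2 i x) (T.connectionForm i x) := by
  exact represents_of_lift (P2.bundle.eps_pow x.1) (π.ker_map x.1) (π.surjective x.1)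
    (π.map_nabla x.1) (π.map_eps x.1) (T.map_τ_apply (i 0) (U.inter_le i 0 x.2))
    (S.nabla_σ i x) (T.bijective (i 0) ⟨x.1, U.inter_le i 0 x.2⟩)

/-- The defect of τ_i is a difference of terms each of which sends sections to sections of ℰ₂ ⊗
Ω¹(D), although ∇₂τ_i and τ_i∇ are not separately linear. -/
theorem connectionForm_mem : T.connectionForm ∈ cochainsOne P U 0 := by
  intro i W h s hs
  have hle : W ≤ U.nhd (i 0) := h.trans (U.inter_le i 0)
  have hτ := (T.isSheafHom (i 0)).res hle
  refine IsPoleValued.map (E := P2.bundle) (E' := P.bundle) _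
    ((T.isSheafHom_coeff (i 0)).res hle) (t := fun x : W =>
      (((P2.nabla x.1).toFun (T.τ (i 0) ⟨x.1, hle x.2⟩ (s x)) -
        LinearMap.rTensor (PoleForms k (D.ideal x.1)) (T.τ (i 0) ⟨x.1, hle x.2⟩)
          ((P.nabla x.1).toFun (s x))) -
        LinearMap.rTensor (PoleForms k (D.ideal x.1))
          (P2.bundle.eps x.1 ∘ₗ T.τ (i 0) ⟨x.1, hle x.2⟩) (z.1.2 i ⟨x.1, h x.2⟩ (s x)))) ?_
  have h1 := P2.nabla_section W _ (hτ W le_rfl s hs)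
  have h2 := IsPoleValued.map _ hτ (P.nabla_section W s hs)
  have h3 := IsPoleValued.map _ (isSheafHom_eps.comp hτ) (z.2.1.2 i W h s hs)
  simp only [sub_eq_add_neg]
  exact LocallySum.add (isPoleValued_restricts _) (LocallySum.add (isPoleValued_restricts _) h1
    (LocallySum.neg h2)) (LocallySum.neg h3)

/-- The terms of degree two of an extension are a primitive of minus the square of the cocycle. -/
theorem totalDOne_eq :
    totalDOne P U (T.transition, T.connectionForm) = -cup P U z z := by
  have hz : totalDOne P U z.1 = 0 := z.2.2
  refine Prod.ext ?_ (Prod.ext ?_ ?_) <;> funext i x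
  · change cechD U 1 T.transition i x =
      -(Cochain.face ![0, 1] z.1.1 i x).comp (Cochain.face ![1, 2] z.1.1 i x)
    rw [cechD_one_apply]
    -- On a triple overlap the three changes of trivialization compose; in degree two this is b_ik =
    -- b_ij + b_jk + a_ij a_jk.
    have key := change_comp (P2.bundle.eps_pow x.1)
      (T.τ_change (i ∘ ![0, 1]) ⟨x.1, fun l => x.2 (![0, 1] l)⟩)
      (T.τ_change (i ∘ ![1, 2]) ⟨x.1, fun l => x.2 (![1, 2] l)⟩)
      (T.τ_change (i ∘ ![0, 2]) ⟨x.1, fun l => x.2 (![0, 2] l)⟩)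
      (cocycle_face hz i x 0 1 2) (T.coeff_comp (i 0) (U.inter_le i 0 x.2))
    have key' : Cochain.face ![0, 2] T.transition i x = Cochain.face ![0, 1] T.transition i x +
      Cochain.face ![1, 2] T.transition i x +
      (Cochain.face ![0, 1] z.1.1 i x).comp (Cochain.face ![1, 2] z.1.1 i x) := key
    rw [key']
    abel
  · change cechD U 0 T.connectionForm i x - (P.nabla x.1).endZero (T.transition i x) =
      -(zeroMulOne (z.1.1 i x) (Cochain.face ![1] z.1.2 i x)
        - oneMulZero (Cochain.face ![0] z.1.2 i x) (z.1.1 i x))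
    rw [cechD_zero_apply]
    have hP := cocycle_face_one hz i x 0 1
    rw [face_id_one] at hP
    -- In the trivialization τ_j the degree-two term of ∇₂ is known twice, as B_j and by transport
    -- of B_i from τ_i. Uniqueness of this term gives the second component.
    have h0 := (T.represents (i ∘ ![0]) ⟨x.1, fun l => x.2 (![0] l)⟩).change
      (P2.nabla_eps x.1) (P2.bundle.eps_pow x.1) (T.τ_change i x) hP
    have h1 := (T.represents (i ∘ ![1]) ⟨x.1, fun l => x.2 (![1] l)⟩).unique h0
      (T.coeff_comp (i 1) (U.inter_le i 1 x.2))
    have h2 : Cochain.face ![1] T.connectionForm i x = Cochain.face ![0] T.connectionForm i x +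
      (P.nabla x.1).endZero (T.transition i x) +
      oneMulZero (Cochain.face ![0] z.1.2 i x) (z.1.1 i x) -
      zeroMulOne (z.1.1 i x) (Cochain.face ![1] z.1.2 i x) := h1
    rw [h2]
    abel
  · have hc := cocycle_closed hz i x 0
    rw [face_id_zero] at hc
    exact (T.represents i x).endOne_eq (P2.nabla_eps x.1) (P2.bundle.eps_pow x.1)
      (T.coeff_comp (i 0) (U.inter_le i 0 x.2)) (P.integrable x.1) (P2.integrable x.1) hc

theorem cup_mem_coboundariesTwo (T : Lifting π S) : cup P U z z ∈ coboundariesTwo P U := by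
  refine ⟨-(T.transition, T.connectionForm), neg_mem ?_, ?_⟩
  · exact ⟨T.transition_mem, T.connectionForm_mem⟩
  · rw [map_neg, T.totalDOne_eq, neg_neg]

end Lifting

/-- The lifts τ_i exist only on a refinement of the covering, which is enough because ℍ² is a direct
limit. -/
theorem yoneda_eq_zero_of_restriction {ρ : Restriction P1 P} {U : Covering X} {z : cocyclesOne P U}
    (S : DefinedBy ρ z) (π : Restriction P2 P1) :
    yonedaProduct P (hyperOneClass P U z) (hyperOneClass P U z) = 0 := by
  obtain ⟨V, h, ⟨T⟩⟩ := exists_lifting π S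
  rw [yoneda_hyperOneClass, hyperTwoClass_eq_zero]
  exact ⟨V, h, T.cup_mem_coboundariesTwo⟩

end Obstruction

/-! ### The local model M[ε]/(ε³) = M × M × M. -/

section Triples
variable {k : Type u} [Field k] {A : Type u} [CommRing A] [IsLocalRing A] [Algebra k A]
  {I : Ideal A} {M : Type u} [AddCommGroup M] [Module A M] {N : Type u} [AddCommGroup N]
  [Module A N] {eps : N →ₗ[A] N} {τ : M →ₗ[A] N}

/-- Matches the double sum over the frame and the powers of ε in the definition of a vector bundle
with the three coordinates of `tripleMap`. -/
theorem tripleMap_sum {r : ℕ} (e : Fin r → M) (c : Fin r → Fin (2 + 1) → A) :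
    ∑ i, ∑ j : Fin (2 + 1), c i j • (eps ^ (j : ℕ)) (τ (e i)) =
      tripleMap eps τ (∑ i, c i 0 • e i, ∑ i, c i 1 • e i, ∑ i, c i 2 • e i) := by
  rw [tripleMap_apply]
  simp only [map_sum, map_smul, ← Finset.sum_add_distrib]
  refine Finset.sum_congr rfl fun i _ => (Fin.sum_univ_three _).trans ?_
  simp [pow_two, add_assoc]

theorem linearIndependent_tripleMap (h : Function.Bijective (tripleMap eps τ)) {r : ℕ}
    {e : Fin r → M} (he : LinearIndependent A e) :
    LinearIndependent A fun p : Fin r × Fin (2 + 1) => (eps ^ (p.2 : ℕ)) (τ (e p.1)) := by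
  rw [Fintype.linearIndependent_iff] at he ⊢
  intro g hg
  rw [Fintype.sum_prod_type] at hg
  have h0 := (tripleMap_sum e fun i j => g (i, j)).symm.trans hg
  have h1 := (injective_iff_map_eq_zero _).1 h.1 _ h0
  simp only [Prod.mk_eq_zero] at h1
  rintro ⟨i, j⟩
  fin_cases j
  · exact he _ h1.1 i
  · exact he _ h1.2.1 i
  · exact he _ h1.2.2 i

theorem span_tripleMap (h : Function.Bijective (tripleMap eps τ)) {r : ℕ}
    {e : Fin r → M} (he : Submodule.span A (Set.range e) = ⊤) :
    Submodule.span A (Set.range fun p : Fin r × Fin (2 + 1) =>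
      (eps ^ (p.2 : ℕ)) (τ (e p.1))) = ⊤ := by
  have hc : ∀ m : M, ∃ c : Fin r → A, ∑ i, c i • e i = m := fun m =>
    (Submodule.mem_span_range_iff_exists_fun A).1 (he ▸ Submodule.mem_top)
  rw [eq_top_iff]
  intro v _
  obtain ⟨⟨m₀, m₁, m₂⟩, rfl⟩ := h.2 v
  obtain ⟨c₀, rfl⟩ := hc m₀
  obtain ⟨c₁, rfl⟩ := hc m₁
  obtain ⟨c₂, rfl⟩ := hc m₂
  refine (Submodule.mem_span_range_iff_exists_fun A).2
    ⟨fun p => (![c₀ p.1, c₁ p.1, c₂ p.1] : Fin (2 + 1) → A) p.2, ?_⟩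
  rw [Fintype.sum_prod_type]
  exact tripleMap_sum e fun i j => (![c₀ i, c₁ i, c₂ i] : Fin (2 + 1) → A) j

variable (A M) in
/-- Multiplication by `ε` on `M[ε]/(ε³)`. -/
def shift : M × M × M →ₗ[A] M × M × M :=
  LinearMap.prod 0 (LinearMap.prod (LinearMap.fst A M (M × M))
    (LinearMap.fst A M M ∘ₗ LinearMap.snd A M (M × M)))

@[simp] theorem shift_apply (m : M × M × M) : shift A M m = (0, m.1, m.2.1) := rfl

theorem shift_pow : shift A M ^ (2 + 1) = 0 := by
  ext m <;> simp [pow_succ]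

/-- The action of `1 + ε a + ε² b` on `M`. -/
def graphMap (a b : M →ₗ[A] M) : M →ₗ[A] M × M × M := LinearMap.id.prod (a.prod b)

/-- The action of `1 + ε a + ε² b` on `M[ε]/(ε³)`. -/
def shear (a b : M →ₗ[A] M) : M × M × M →ₗ[A] M × M × M := tripleMap (shift A M) (graphMap a b)

theorem shear_apply (a b : M →ₗ[A] M) (m : M × M × M) :
    shear a b m = (m.1, a m.1 + m.2.1, b m.1 + (a m.2.1 + m.2.2)) := by
  simp [shear, tripleMap_apply, graphMap]

/-- Modulo ε³ the product (1 + εa + ε²b)(1 + εa′ + ε²b′) equals 1 + ε(a + a′) + ε²(b + b′ + aa′). -/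
theorem shear_shear {a b a' b' a'' b'' : M →ₗ[A] M} (ha : a'' = a + a') (hb : b'' = b + b' + a ∘ₗ a')
    (m : M × M × M) : shear a b (shear a' b' m) = shear a'' b'' m := by
  simp only [shear_apply, ha, hb, map_add, LinearMap.add_apply, LinearMap.comp_apply]
  refine Prod.ext rfl (Prod.ext ?_ ?_) <;> simp only <;> abel

theorem shear_zero (m : M × M × M) : shear (0 : M →ₗ[A] M) 0 m = m := by
  simp [shear_apply]

/-- Brings 1 + εa + ε²b into the shape required by `Represents.change`, starting from the standard
inclusion of `M`. -/
theorem graphMap_eq (a b : M →ₗ[A] M) : graphMap a b = LinearMap.inl A M (M × M) +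
    shift A M ∘ₗ LinearMap.inl A M (M × M) ∘ₗ a +
    shift A M ∘ₗ shift A M ∘ₗ LinearMap.inl A M (M × M) ∘ₗ b := by
  ext m <;> simp [graphMap]

theorem triple_eq (m : M × M × M) : m = LinearMap.inl A M (M × M) m.1 +
    (shift A M (LinearMap.inl A M (M × M) m.2.1) +
      shift A M (shift A M (LinearMap.inl A M (M × M) m.2.2))) := by
  simp

/-- The connection `∇ + ε P + ε² Q` on `M[ε]/(ε³)`. -/
def tripleConnection (nab : Connection k I M) (P Q : M →ₗ[A] PoleValued k I M) :
    Connection k I (M × M × M) where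
  toFun :=
    { toFun := fun m =>
        LinearMap.rTensor (PoleForms k I) (LinearMap.inl A M (M × M)) (nab.toFun m.1) +
        LinearMap.rTensor (PoleForms k I) (shift A M ∘ₗ LinearMap.inl A M (M × M))
          (nab.toFun m.2.1 + P m.1) +
        LinearMap.rTensor (PoleForms k I) (shift A M ∘ₗ shift A M ∘ₗ LinearMap.inl A M (M × M))
          (nab.toFun m.2.2 + P m.2.1 + Q m.1)
      map_zero' := by simp
      map_add' := fun m m' => by
        simp only [Prod.fst_add, Prod.snd_add, map_add]
        abel }
  leibniz f m := by
    -- Each of the three coordinates contributes its own Leibniz term, and together these make up `m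
    -- ⊗ d f`.
    have e : m ⊗ₜ[A] poleD k I f = LinearMap.inl A M (M × M) m.1 ⊗ₜ[A] poleD k I f +
        (shift A M (LinearMap.inl A M (M × M) m.2.1) ⊗ₜ[A] poleD k I f +
          shift A M (shift A M (LinearMap.inl A M (M × M) m.2.2)) ⊗ₜ[A] poleD k I f) := by
      rw [← TensorProduct.add_tmul, ← TensorProduct.add_tmul, ← triple_eq]
    rw [e]
    simp only [AddMonoidHom.coe_mk, ZeroHom.coe_mk, Prod.smul_fst, Prod.smul_snd, nab.leibniz,
      map_add, map_smul, LinearMap.rTensor_tmul, smul_add, LinearMap.comp_apply]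
    abel

section TripleConnection
variable (nab : Connection k I M) (P Q : M →ₗ[A] PoleValued k I M)

theorem tripleConnection_apply (m : M × M × M) : (tripleConnection nab P Q).toFun m =
    LinearMap.rTensor (PoleForms k I) (LinearMap.inl A M (M × M)) (nab.toFun m.1) +
    LinearMap.rTensor (PoleForms k I) (shift A M ∘ₗ LinearMap.inl A M (M × M))
      (nab.toFun m.2.1 + P m.1) +
    LinearMap.rTensor (PoleForms k I) (shift A M ∘ₗ shift A M ∘ₗ LinearMap.inl A M (M × M))
      (nab.toFun m.2.2 + P m.2.1 + Q m.1) := rfl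

theorem represents_tripleConnection : Represents nab (tripleConnection nab P Q) (shift A M)
    (LinearMap.inl A M (M × M)) P Q := by
  intro m
  rw [tripleConnection_apply]
  simp

theorem tripleConnection_shift (m : M × M × M) : (tripleConnection nab P Q).toFun (shift A M m) =
    LinearMap.rTensor (PoleForms k I) (shift A M) ((tripleConnection nab P Q).toFun m) := by
  have h0 : shift A M ∘ₗ shift A M ∘ₗ shift A M ∘ₗ LinearMap.inl A M (M × M) = 0 := by
    ext m <;> simp
  rw [tripleConnection_apply, tripleConnection_apply]
  simp only [shift_apply, map_add, map_zero, zero_add, add_zero, ← LinearMap.rTensor_comp_apply, h0,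
    LinearMap.rTensor_zero, LinearMap.zero_apply]

theorem tripleConnection_tripleMap (τ : M →ₗ[A] M × M × M) (m : M × M × M) :
    (tripleConnection nab P Q).toFun (tripleMap (shift A M) τ m) =
      (tripleConnection nab P Q).toFun (τ m.1) +
      (LinearMap.rTensor (PoleForms k I) (shift A M)
          ((tripleConnection nab P Q).toFun (τ m.2.1)) +
        LinearMap.rTensor (PoleForms k I) (shift A M) (LinearMap.rTensor (PoleForms k I)
          (shift A M) ((tripleConnection nab P Q).toFun (τ m.2.2)))) := by
  rw [tripleMap_apply, map_add, map_add, tripleConnection_shift, tripleConnection_shift,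
    tripleConnection_shift]

/-- Since ε is horizontal, it suffices to test the image of `M`, where the three hypotheses kill the
coefficients of 1, ε and ε² in the curvature formula. -/
theorem tripleConnection_curvature (hnab : ∀ m, nab.curvature m = 0) (hP : nab.endOne P = 0)
    (hQ : nab.endOne Q = -oneMulOne P P) (m : M × M × M) :
    (tripleConnection nab P Q).curvature m = 0 := by
  have h0 : ∀ m, (tripleConnection nab P Q).curvature (LinearMap.inl A M (M × M) m) = 0 := by
    intro m
    rw [(represents_tripleConnection nab P Q).curvature (tripleConnection_shift nab P Q)
      shift_pow, hnab, hP, hQ]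
    simp
  have h1 := Connection.curvature_map (tripleConnection_shift nab P Q)
  rw [triple_eq (A := A) m, Connection.curvature_add, Connection.curvature_add, h1, h1, h1, h0, h0,
    h0]
  simp

end TripleConnection

end Triples

/-! ### Cochains evaluated at explicit indices. -/

section PairIndices
variable {X : LocallyRingedSpace.{u}} {F : X → Type u} {U : Covering X}

/-- Gives every stalk a preferred trivialization, the one indexed by the point itself. The gluing
below rests on this choice. -/
theorem Covering.mem_self (U : Covering X) (x : X) : x ∈ U.nhd x := (OrderDual.ofDual U x).mem

theorem Covering.inf_le_inter (U : Covering X) (i j : X) : U.nhd i ⊓ U.nhd j ≤ U.inter ![i, j] := by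
  intro x hx l
  fin_cases l
  · exact hx.1
  · exact hx.2

theorem Covering.nhd_le_inter (U : Covering X) (i : X) : U.nhd i ≤ U.inter ![i] := by
  intro x hx l
  fin_cases l
  exact hx

/-- The value of a cochain of degree one at a pair of indices. -/
def Cochain.pair (c : Cochain U 1 F) (i j : X) {x : X} (hi : x ∈ U.nhd i) (hj : x ∈ U.nhd j) : F x :=
  c ![i, j] ⟨x, U.inf_le_inter i j ⟨hi, hj⟩⟩

/-- The value of a cochain of degree zero at an index. -/
def Cochain.single (c : Cochain U 0 F) (i : X) {x : X} (hi : x ∈ U.nhd i) : F x :=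
  c ![i] ⟨x, U.nhd_le_inter i hi⟩

/-- Index tuples such as `i ∘ ![j, l]` and `![i j, i l]` are equal only propositionally; the value
at a fixed point has a type that does not depend on the tuple, so it can be transported. -/
theorem Cochain.apply_congr {p : ℕ} (c : Cochain U p F) {i j : Fin (p + 1) → X} (h : i = j) {x : X}
    (hx : x ∈ U.inter i) (hx' : x ∈ U.inter j) : c i ⟨x, hx⟩ = c j ⟨x, hx'⟩ := by
  subst h
  rfl

theorem Cochain.face_pair (c : Cochain U 1 F) {q : ℕ} (i : Fin (q + 1) → X) (x : U.inter i)
    (j l : Fin (q + 1)) : Cochain.face ![j, l] c i x = c.pair (i j) (i l) (x.2 j) (x.2 l) :=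
  c.apply_congr (by funext m; fin_cases m <;> rfl) _ _

theorem Cochain.face_single (c : Cochain U 0 F) {q : ℕ} (i : Fin (q + 1) → X) (x : U.inter i)
    (j : Fin (q + 1)) : Cochain.face ![j] c i x = c.single (i j) (x.2 j) :=
  c.apply_congr (by funext m; fin_cases m; rfl) _ _

theorem Covering.mem_inter_three (U : Covering X) {i j l x : X} (hi : x ∈ U.nhd i)
    (hj : x ∈ U.nhd j) (hl : x ∈ U.nhd l) : x ∈ U.inter ![i, j, l] := by
  intro m
  fin_cases m
  · exact hi
  · exact hj
  · exact hl

end PairIndices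

/-! ### Sufficiency: gluing a bundle over the second-order thickening. -/

section Gluing
variable {k : Type u} [Field k] {X : LocallyRingedSpace.{u}} [SpaceOver k X]
  {D : EffectiveCartierDivisor X} {P : IntegrableConnection k D 0} {U : Covering X}
  {z : cocyclesOne P U}

/-- Sections of `ℰ ⊕ ℰ ⊕ ℰ`. -/
def IsTripleSection (E : VectorBundle X 0) {V : Opens X}
    (t : ∀ x : V, E.fiber x.1 × E.fiber x.1 × E.fiber x.1) : Prop :=
  (E.sheaf.pred fun x => (t x).1) ∧ (E.sheaf.pred fun x => (t x).2.1) ∧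
    E.sheaf.pred fun x => (t x).2.2

theorem IsTripleSection.res {E : VectorBundle X 0} {V W : Opens X} (h : W ≤ V)
    {t : ∀ x : V, E.fiber x.1 × E.fiber x.1 × E.fiber x.1} (ht : IsTripleSection E t) :
    IsTripleSection E fun x : W => t ⟨x.1, h x.2⟩ :=
  ⟨E.res h ht.1, E.res h ht.2.1, E.res h ht.2.2⟩

theorem IsTripleSection.of_local {E : VectorBundle X 0} {V : Opens X}
    {t : ∀ x : V, E.fiber x.1 × E.fiber x.1 × E.fiber x.1}
    (ht : LocallyOn V fun W h => IsTripleSection E fun x : W => t ⟨x.1, h x.2⟩) :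
    IsTripleSection E t := by
  refine ⟨E.of_local fun x => ?_, E.of_local fun x => ?_, E.of_local fun x => ?_⟩ <;>
    obtain ⟨W, h, hx, h0, h1, h2⟩ := ht x
  · exact ⟨W, h, hx, h0⟩
  · exact ⟨W, h, hx, h1⟩
  · exact ⟨W, h, hx, h2⟩

theorem IsTripleSection.shear {E : VectorBundle X 0} {V : Opens X}
    {t : ∀ x : V, E.fiber x.1 × E.fiber x.1 × E.fiber x.1} (ht : IsTripleSection E t)
    {a b : ∀ x : V, E.fiber x.1 →ₗ[Stalk X x.1] E.fiber x.1} (ha : IsSheafHom E E a)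
    (hb : IsSheafHom E E b) : IsTripleSection E fun x => shear (a x) (b x) (t x) := by
  obtain ⟨h0, h1, h2⟩ := ht
  simp only [IsTripleSection, shear_apply]
  exact ⟨h0, E.add_pred (ha V le_rfl _ h0) h1, E.add_pred (hb V le_rfl _ h0)
    (E.add_pred (ha V le_rfl _ h1) h2)⟩

/-- A primitive of minus the square of a cocycle. -/
structure SquarePrimitive (z : cocyclesOne P U) where
  w : FamilyOne P U
  mem : w ∈ totalOne P U
  eq : totalDOne P U w = -cup P U z z

namespace SquarePrimitive
variable (q : SquarePrimitive z)

section Relations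
variable {i j l x : X} (hi : x ∈ U.nhd i) (hj : x ∈ U.nhd j) (hl : x ∈ U.nhd l)

theorem pair_add (z : cocyclesOne P U) : z.1.1.pair i l hi hl =
    z.1.1.pair i j hi hj + z.1.1.pair j l hj hl := by
  have h := cocycle_face z.2.2 ![i, j, l] ⟨x, U.mem_inter_three hi hj hl⟩ 0 1 2
  simp only [Cochain.face_pair] at h
  exact h

/-- The cocycle relation at (i, i, i) reads a_ii = a_ii + a_ii. -/
theorem pair_self (z : cocyclesOne P U) : z.1.1.pair i i hi hi = 0 :=
  left_eq_add.1 (pair_add hi hi hi z)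

theorem single_eq (z : cocyclesOne P U) : z.1.2.single j hj =
    z.1.2.single i hi + (P.nabla x).endZero (z.1.1.pair i j hi hj) := by
  have h := cocycle_face_one z.2.2 ![i, j] ⟨x, U.inf_le_inter i j ⟨hi, hj⟩⟩ 0 1
  simp only [Cochain.face_pair, Cochain.face_single] at h
  exact h

theorem endOne_single (z : cocyclesOne P U) : (P.nabla x).endOne (z.1.2.single i hi) = 0 := by
  have h := cocycle_closed z.2.2 ![i] ⟨x, U.nhd_le_inter i hi⟩ 0
  rw [Cochain.face_single] at h
  exact h

/-- The component in C²(ℛ⁰) of the primitive equation; it is exactly the multiplicativity of 1 +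
εa_ij + ε²b_ij. -/
theorem pair_eq : q.w.1.pair i l hi hl = q.w.1.pair i j hi hj + q.w.1.pair j l hj hl +
    z.1.1.pair i j hi hj ∘ₗ z.1.1.pair j l hj hl := by
  have h : cechD U 1 q.w.1 ![i, j, l] ⟨x, U.mem_inter_three hi hj hl⟩ =
      -(Cochain.face ![0, 1] z.1.1 ![i, j, l] ⟨x, U.mem_inter_three hi hj hl⟩).comp
        (Cochain.face ![1, 2] z.1.1 ![i, j, l] ⟨x, U.mem_inter_three hi hj hl⟩) :=
    congrFun (congrFun (congrArg Prod.fst q.eq) _) _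
  rw [cechD_one_apply] at h
  simp only [Cochain.face_pair] at h
  have h' : q.w.1.pair j l hj hl - q.w.1.pair i l hi hl + q.w.1.pair i j hi hj =
    -(z.1.1.pair i j hi hj ∘ₗ z.1.1.pair j l hj hl) := h
  rw [← sub_eq_zero] at h' ⊢
  rw [← neg_eq_zero, ← h']
  abel

theorem pair_self_eq : q.w.1.pair i i hi hi = 0 := by
  have h := q.pair_eq hi hi hi
  rw [pair_self, LinearMap.comp_zero, add_zero] at h
  exact left_eq_add.1 h

/-- The component in C¹(ℛ¹); it has the form of the transformation rule in `Represents.change`. -/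
theorem single_eq_add : q.w.2.single j hj = q.w.2.single i hi +
    (P.nabla x).endZero (q.w.1.pair i j hi hj) +
    oneMulZero (z.1.2.single i hi) (z.1.1.pair i j hi hj) -
    zeroMulOne (z.1.1.pair i j hi hj) (z.1.2.single j hj) := by
  have h : cechD U 0 q.w.2 ![i, j] ⟨x, U.inf_le_inter i j ⟨hi, hj⟩⟩ -
      (P.nabla x).endZero (q.w.1.pair i j hi hj) =
      -(zeroMulOne (z.1.1.pair i j hi hj)
        (Cochain.face ![1] z.1.2 ![i, j] ⟨x, U.inf_le_inter i j ⟨hi, hj⟩⟩) -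
        oneMulZero (Cochain.face ![0] z.1.2 ![i, j] ⟨x, U.inf_le_inter i j ⟨hi, hj⟩⟩)
          (z.1.1.pair i j hi hj)) :=
    congrFun (congrFun (congrArg (fun t => t.2.1) q.eq) ![i, j]) _
  rw [cechD_zero_apply] at h
  simp only [Cochain.face_single] at h
  have h' : q.w.2.single j hj - q.w.2.single i hi - (P.nabla x).endZero (q.w.1.pair i j hi hj) =
    -(zeroMulOne (z.1.1.pair i j hi hj) (z.1.2.single j hj) -
      oneMulZero (z.1.2.single i hi) (z.1.1.pair i j hi hj)) := h
  rw [← sub_eq_zero] at h' ⊢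
  rw [← h']
  abel

/-- The component in C⁰(ℛ²); it is the integrability of ∇ + εA_i + ε²B_i in degree two. -/
theorem endOne_eq : (P.nabla x).endOne (q.w.2.single i hi) =
    -oneMulOne (z.1.2.single i hi) (z.1.2.single i hi) :=
  congrFun (congrFun (congrArg (fun t => t.2.2) q.eq) ![i]) ⟨x, U.nhd_le_inter i hi⟩

end Relations

/-- The change of coordinates on `ℰ[ε]/(ε³)` at `x` from the trivialization with index `j` to the
one with index `i`. -/
def change (i j : X) {x : X} (hi : x ∈ U.nhd i) (hj : x ∈ U.nhd j) :
    P.bundle.fiber x × P.bundle.fiber x × P.bundle.fiber x →ₗ[Stalk X x]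
      P.bundle.fiber x × P.bundle.fiber x × P.bundle.fiber x :=
  shear (z.1.1.pair i j hi hj) (q.w.1.pair i j hi hj)

theorem change_change {i j l x : X} (hi : x ∈ U.nhd i) (hj : x ∈ U.nhd j) (hl : x ∈ U.nhd l)
    (m : P.bundle.fiber x × P.bundle.fiber x × P.bundle.fiber x) :
    q.change i j hi hj (q.change j l hj hl m) = q.change i l hi hl m :=
  shear_shear (pair_add hi hj hl z) (q.pair_eq hi hj hl) m

theorem change_self {i x : X} (hi : x ∈ U.nhd i)
    (m : P.bundle.fiber x × P.bundle.fiber x × P.bundle.fiber x) :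
    q.change i i hi hi m = m := by
  rw [change, pair_self, pair_self_eq, shear_zero]

theorem change_cancel {i j x : X} (hi : x ∈ U.nhd i) (hj : x ∈ U.nhd j)
    (m : P.bundle.fiber x × P.bundle.fiber x × P.bundle.fiber x) :
    q.change i j hi hj (q.change j i hj hi m) = m := by
  rw [change_change, change_self]

theorem change_bijective {i j x : X} (hi : x ∈ U.nhd i) (hj : x ∈ U.nhd j) :
    Function.Bijective (q.change i j hi hj) :=
  Function.bijective_iff_has_inverse.2 ⟨q.change j i hj hi, q.change_cancel hj hi,
    q.change_cancel hi hj⟩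

theorem isSheafHom_pair (i j : X) {V : Opens X} (hi : V ≤ U.nhd i) (hj : V ≤ U.nhd j) :
    IsSheafHom P.bundle P.bundle fun x : V => z.1.1.pair i j (hi x.2) (hj x.2) := by
  have h : IsSheafHom P.bundle P.bundle (z.1.1 ![i, j]) := z.2.1.1 ![i, j]
  exact h.res ((le_inf hi hj).trans (U.inf_le_inter i j))

theorem isSheafHom_pair_primitive (i j : X) {V : Opens X} (hi : V ≤ U.nhd i) (hj : V ≤ U.nhd j) :
    IsSheafHom P.bundle P.bundle fun x : V => q.w.1.pair i j (hi x.2) (hj x.2) := by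
  have h : IsSheafHom P.bundle P.bundle (q.w.1 ![i, j]) := q.mem.1 ![i, j]
  exact h.res ((le_inf hi hj).trans (U.inf_le_inter i j))

theorem isTripleSection_change (i j : X) {V : Opens X} (hi : V ≤ U.nhd i) (hj : V ≤ U.nhd j)
    {t : ∀ x : V, P.bundle.fiber x.1 × P.bundle.fiber x.1 × P.bundle.fiber x.1}
    (ht : IsTripleSection P.bundle t) :
    IsTripleSection P.bundle fun x => q.change i j (hi x.2) (hj x.2) (t x) :=
  ht.shear (isSheafHom_pair i j hi hj) (q.isSheafHom_pair_primitive i j hi hj)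

/-- The sections of the glued bundle, whose stalk at `x` is identified with `ℰ[ε]/(ε³)` by the
trivialization with index `x`. -/
def IsSection {V : Opens X}
    (s : ∀ x : V, P.bundle.fiber x.1 × P.bundle.fiber x.1 × P.bundle.fiber x.1) : Prop :=
  ∀ (i : X) (W : Opens X) (h : W ≤ V) (hi : W ≤ U.nhd i), IsTripleSection P.bundle fun x : W =>
    q.change i x.1 (hi x.2) (U.mem_self x.1) (s ⟨x.1, h x.2⟩)

/-- Quantifying over all trivializations makes restriction and locality immediate, while in practice
one trivialization suffices: the changes of coordinates preserve sections and compose by the cocycle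
rule. -/
theorem isSection_iff {i : X} {V : Opens X} (hi : V ≤ U.nhd i)
    (s : ∀ x : V, P.bundle.fiber x.1 × P.bundle.fiber x.1 × P.bundle.fiber x.1) :
    q.IsSection s ↔ IsTripleSection P.bundle fun x : V =>
      q.change i x.1 (hi x.2) (U.mem_self x.1) (s x) := by
  refine ⟨fun h => h i V le_rfl hi, fun h j W hW hj => ?_⟩
  have h' := q.isTripleSection_change j i hj (hW.trans hi) (h.res hW)
  simpa only [change_change] using h'

/-- The sheaf of sections of the glued bundle. -/
def sheaf : TopCat.LocalPredicate (X := X.toTopCat)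
    (fun x : X => P.bundle.fiber x × P.bundle.fiber x × P.bundle.fiber x) where
  pred s := q.IsSection s
  res i s hs j W h hj := hs j W (h.trans i.le) hj
  locality {V} s hs i W h hi := by
    refine IsTripleSection.of_local fun x => ?_
    obtain ⟨W', hx, hle, hs'⟩ := hs ⟨x.1, h x.2⟩
    exact ⟨W' ⊓ W, inf_le_right, ⟨hx, x.2⟩, hs' i (W' ⊓ W) inf_le_left (inf_le_right.trans hi)⟩

/-- The three components have coefficients on three possibly different neighbourhoods; their
intersection serves for all. -/
theorem isTripleSection_iff {V : Opens X} {r : ℕ} {e : Fin r → ∀ y : V, P.bundle.fiber y.1}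
    (he : ∀ (W : Opens X) (h : W ≤ V) (s : ∀ y : W, P.bundle.fiber y.1), P.bundle.sheaf.pred s ↔
      LocallyOn W fun W' h' => ∃ c : Fin r → Regular X W', ∀ y : W',
        s ⟨y.1, h' y.2⟩ = ∑ i, germAt (c i) y • e i ⟨y.1, h (h' y.2)⟩)
    (W : Opens X) (h : W ≤ V)
    (t : ∀ x : W, P.bundle.fiber x.1 × P.bundle.fiber x.1 × P.bundle.fiber x.1) :
    IsTripleSection P.bundle t ↔ LocallyOn W fun W' h' =>
      ∃ c : Fin r → Fin (2 + 1) → Regular X W', ∀ y : W', t ⟨y.1, h' y.2⟩ =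
        (∑ i, germAt (c i 0) y • e i ⟨y.1, h (h' y.2)⟩,
          ∑ i, germAt (c i 1) y • e i ⟨y.1, h (h' y.2)⟩,
          ∑ i, germAt (c i 2) y • e i ⟨y.1, h (h' y.2)⟩) := by
  constructor
  · rintro ⟨h0, h1, h2⟩ x
    obtain ⟨W0, hW0, hx0, c0, hc0⟩ := (he W h _).1 h0 x
    obtain ⟨W1, hW1, hx1, c1, hc1⟩ := (he W h _).1 h1 x
    obtain ⟨W2, hW2, hx2, c2, hc2⟩ := (he W h _).1 h2 x
    refine ⟨W0 ⊓ (W1 ⊓ W2), inf_le_left.trans hW0, ⟨hx0, hx1, hx2⟩, fun i =>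
      (![Regular.res inf_le_left (c0 i), Regular.res (inf_le_right.trans inf_le_left) (c1 i),
        Regular.res (inf_le_right.trans inf_le_right) (c2 i)] : Fin (2 + 1) → _), fun y => ?_⟩
    refine Prod.ext ?_ (Prod.ext ?_ ?_)
    · refine (hc0 ⟨y.1, y.2.1⟩).trans (Finset.sum_congr rfl fun i _ => ?_)
      exact congrArg (· • _) (germAt_res _ (c0 i) y).symm
    · refine (hc1 ⟨y.1, y.2.2.1⟩).trans (Finset.sum_congr rfl fun i _ => ?_)
      exact congrArg (· • _) (germAt_res _ (c1 i) y).symm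
    · refine (hc2 ⟨y.1, y.2.2.2⟩).trans (Finset.sum_congr rfl fun i _ => ?_)
      exact congrArg (· • _) (germAt_res _ (c2 i) y).symm
  · intro H
    refine ⟨(he W h _).2 fun x => ?_, (he W h _).2 fun x => ?_, (he W h _).2 fun x => ?_⟩ <;>
      obtain ⟨W', h', hx, c, hc⟩ := H x
    · exact ⟨W', h', hx, fun i => c i 0, fun y => congrArg (fun t => t.1) (hc y)⟩
    · exact ⟨W', h', hx, fun i => c i 1, fun y => congrArg (fun t => t.2.1) (hc y)⟩
    · exact ⟨W', h', hx, fun i => c i 2, fun y => congrArg (fun t => t.2.2) (hc y)⟩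

/-- The trivialization with index `i`, on `ℰ`. -/
def chart (i : X) {x : X} (hi : x ∈ U.nhd i) : P.bundle.fiber x →ₗ[Stalk X x]
    P.bundle.fiber x × P.bundle.fiber x × P.bundle.fiber x :=
  graphMap (z.1.1.pair x i (U.mem_self x) hi) (q.w.1.pair x i (U.mem_self x) hi)

/-- Extending the chart ε-linearly from ℰ to ℰ[ε]/(ε³) is the change of coordinates from the
trivialization `i` to the preferred one. -/
theorem tripleMap_chart (i : X) {x : X} (hi : x ∈ U.nhd i) :
    tripleMap (shift (Stalk X x) (P.bundle.fiber x)) (q.chart i hi) =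
      q.change x i (U.mem_self x) hi := rfl

theorem sum_chart (i : X) {x : X} (hi : x ∈ U.nhd i) {r : ℕ} (e : Fin r → P.bundle.fiber x)
    (c : Fin r → Fin (2 + 1) → Stalk X x) :
    ∑ l, ∑ j : Fin (2 + 1), c l j •
      (shift (Stalk X x) (P.bundle.fiber x) ^ (j : ℕ)) (q.chart i hi (e l)) =
      q.change x i (U.mem_self x) hi
        (∑ l, c l 0 • e l, ∑ l, c l 1 • e l, ∑ l, c l 2 • e l) :=
  tripleMap_sum e c

theorem chart_frame (i : X) {x : X} (hi : x ∈ U.nhd i) {r : ℕ} {e : Fin r → P.bundle.fiber x}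
    (he : LinearIndependent (Stalk X x) e) (he' : Submodule.span (Stalk X x) (Set.range e) = ⊤) :
    (LinearIndependent (Stalk X x) fun p : Fin r × Fin (2 + 1) =>
      (shift (Stalk X x) (P.bundle.fiber x) ^ (p.2 : ℕ)) (q.chart i hi (e p.1))) ∧
    Submodule.span (Stalk X x) (Set.range fun p : Fin r × Fin (2 + 1) =>
      (shift (Stalk X x) (P.bundle.fiber x) ^ (p.2 : ℕ)) (q.chart i hi (e p.1))) = ⊤ := by
  have hbij : Function.Bijective (tripleMap (shift (Stalk X x) (P.bundle.fiber x))
    (q.chart i hi)) := q.change_bijective _ _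
  exact ⟨linearIndependent_tripleMap hbij he, span_tripleMap hbij he'⟩

theorem change_eq_iff {i j x : X} (hi : x ∈ U.nhd i) (hj : x ∈ U.nhd j)
    (m m' : P.bundle.fiber x × P.bundle.fiber x × P.bundle.fiber x) :
    q.change i j hi hj m = m' ↔ m = q.change j i hj hi m' := by
  constructor
  · rintro rfl
    rw [change_cancel]
  · rintro rfl
    rw [change_cancel]

/-- In the trivialization `i` a section is a triple of sections of ℰ. Expanding the triple in a
frame of ℰ and moving back to the preferred trivialization gives the expansion in the transported
frame. -/
theorem isSection_iff_frame {i : X} {V : Opens X} (hV : V ≤ U.nhd i) {r : ℕ}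
    {e : Fin r → ∀ y : V, P.bundle.fiber y.1}
    (he : ∀ (W : Opens X) (h : W ≤ V) (s : ∀ y : W, P.bundle.fiber y.1), P.bundle.sheaf.pred s ↔
      LocallyOn W fun W' h' => ∃ c : Fin r → Regular X W', ∀ y : W',
        s ⟨y.1, h' y.2⟩ = ∑ i, germAt (c i) y • e i ⟨y.1, h (h' y.2)⟩)
    (W : Opens X) (h : W ≤ V)
    (s : ∀ x : W, P.bundle.fiber x.1 × P.bundle.fiber x.1 × P.bundle.fiber x.1) :
    q.IsSection s ↔ LocallyOn W fun W' h' =>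
      ∃ c : Fin r → Fin (2 + 1) → Regular X W', ∀ y : W', s ⟨y.1, h' y.2⟩ =
        ∑ l, ∑ j : Fin (2 + 1), germAt (c l j) y •
          (shift (Stalk X y.1) (P.bundle.fiber y.1) ^ (j : ℕ))
            (q.chart i (hV (h (h' y.2))) (e l ⟨y.1, h (h' y.2)⟩)) := by
  rw [q.isSection_iff (h.trans hV) s, isTripleSection_iff he W h]
  simp only [sum_chart, change_eq_iff]

/-- Near `x` the single trivialization with index `x` is used at all points `y`, although the stalk
at `y` is written in the trivialization with index `y`. The chart carries a frame of ℰ to one of the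
glued bundle. -/
theorem exists_chart_frame (x : X) : ∃ V : Opens X, x ∈ V ∧ ∃ (r : ℕ)
    (e : Fin r → ∀ y : V, P.bundle.fiber y.1 × P.bundle.fiber y.1 × P.bundle.fiber y.1),
    (∀ y : V, LinearIndependent (Stalk X y.1) (fun p : Fin r × Fin (2 + 1) =>
        (shift (Stalk X y.1) (P.bundle.fiber y.1) ^ (p.2 : ℕ)) (e p.1 y)) ∧
      Submodule.span (Stalk X y.1) (Set.range fun p : Fin r × Fin (2 + 1) =>
        (shift (Stalk X y.1) (P.bundle.fiber y.1) ^ (p.2 : ℕ)) (e p.1 y)) = ⊤) ∧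
    ∀ (W : Opens X) (h : W ≤ V)
      (s : ∀ y : W, P.bundle.fiber y.1 × P.bundle.fiber y.1 × P.bundle.fiber y.1),
      q.sheaf.pred s ↔ LocallyOn W fun W' h' =>
        ∃ c : Fin r → Fin (2 + 1) → Regular X W', ∀ y : W', s ⟨y.1, h' y.2⟩ =
          ∑ l, ∑ j : Fin (2 + 1), germAt (c l j) y •
            (shift (Stalk X y.1) (P.bundle.fiber y.1) ^ (j : ℕ)) (e l ⟨y.1, h (h' y.2)⟩) := by
  obtain ⟨V, hx, r, e, hb, he⟩ := P.bundle.exists_frame x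
  have h1 := fun y : (V ⊓ U.nhd x : Opens X) =>
    q.chart_frame x y.2.2 (hb ⟨y.1, y.2.1⟩).1 (hb ⟨y.1, y.2.1⟩).2
  have h2 := q.isSection_iff_frame (V := V ⊓ U.nhd x) (e := fun i y => e i ⟨y.1, y.2.1⟩)
    inf_le_right fun W h s => he W (h.trans inf_le_left) s
  let e' : Fin r → ∀ y : (V ⊓ U.nhd x : Opens X),
      P.bundle.fiber y.1 × P.bundle.fiber y.1 × P.bundle.fiber y.1 :=
    fun i y => q.chart x y.2.2 (e i ⟨y.1, y.2.1⟩)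
  exact ⟨V ⊓ U.nhd x, ⟨hx, U.mem_self x⟩, r, e', h1, h2⟩

/-- The bundle over `X × Spec k[ε]/(ε³)` with transition maps `1 + ε a_{ij} + ε² b_{ij}`. -/
def bundle : VectorBundle X 2 where
  fiber x := P.bundle.fiber x × P.bundle.fiber x × P.bundle.fiber x
  addCommGroup _ := Prod.instAddCommGroup
  module _ := Prod.instModule
  eps x := shift (Stalk X x) (P.bundle.fiber x)
  eps_pow _ := shift_pow
  sheaf := q.sheaf
  locally_free := q.exists_chart_frame

end SquarePrimitive

end Gluing

/-! ### Sufficiency: the connection on the glued bundle and its reduction modulo ε². -/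

section Extension
variable {k : Type u} [Field k] {X : LocallyRingedSpace.{u}} [SpaceOver k X]
  {D : EffectiveCartierDivisor X} {P : IntegrableConnection k D 0}
  {P1 : IntegrableConnection k D 1} {ρ : Restriction P1 P} {U : Covering X}
  {z : cocyclesOne P U}

namespace SquarePrimitive
variable (q : SquarePrimitive z)

/-- The connection `∇ + ε A_x + ε² B_x` at `x`. -/
def nabla (x : X) :
    Connection k (D.ideal x) (P.bundle.fiber x × P.bundle.fiber x × P.bundle.fiber x) :=
  tripleConnection (P.nabla x) (z.1.2.single x (U.mem_self x)) (q.w.2.single x (U.mem_self x))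

/-- The connection at `x` is defined through the trivialization `x`; `single_eq_add` is precisely
the rule by which it becomes ∇ + εA_i + ε²B_i in any other trivialization `i`. Thus the stalkwise
definitions fit together. -/
theorem represents_chart (i : X) {x : X} (hi : x ∈ U.nhd i) :
    Represents (P.nabla x) (q.nabla x) (shift (Stalk X x) (P.bundle.fiber x)) (q.chart i hi)
      (z.1.2.single i hi) (q.w.2.single i hi) := by
  rw [q.single_eq_add (U.mem_self x) hi]
  exact (represents_tripleConnection _ _ _).change (tripleConnection_shift _ _ _) shift_pow
    (graphMap_eq _ _) (single_eq (U.mem_self x) hi z)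

theorem nabla_curvature (x : X) (m : P.bundle.fiber x × P.bundle.fiber x × P.bundle.fiber x) :
    (q.nabla x).curvature m = 0 :=
  tripleConnection_curvature _ _ _ (P.integrable x) (endOne_single (U.mem_self x) z)
    (q.endOne_eq (U.mem_self x)) m

theorem change_chart {i x : X} (hi : x ∈ U.nhd i) (m : P.bundle.fiber x) :
    q.change i x hi (U.mem_self x) (q.chart i hi m) = (m, 0, 0) := by
  have e : q.chart i hi m = q.change x i (U.mem_self x) hi (m, 0, 0) := by
    rw [← tripleMap_chart, tripleMap_apply]
    simp
  rw [e, change_cancel]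

theorem isSheafHom_chart (i : X) {V : Opens X} (hi : V ≤ U.nhd i) :
    IsSheafHom P.bundle q.bundle fun x : V => q.chart i (hi x.2) := by
  intro W h s hs
  have key : q.IsSection fun x : W => q.chart i (hi (h x.2)) (s x) := by
    rw [q.isSection_iff (h.trans hi)]
    simp only [change_chart]
    exact ⟨hs, P.bundle.zero_pred, P.bundle.zero_pred⟩
  exact key

/-- A section is a combination `s₀ + ε s₁ + ε² s₂` in every trivialization. -/
theorem exists_coordinates {i : X} {V : Opens X} (hi : V ≤ U.nhd i)
    {s : ∀ x : V, P.bundle.fiber x.1 × P.bundle.fiber x.1 × P.bundle.fiber x.1}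
    (hs : q.IsSection s) :
    ∃ t : ∀ x : V, P.bundle.fiber x.1 × P.bundle.fiber x.1 × P.bundle.fiber x.1,
      IsTripleSection P.bundle t ∧ ∀ x : V, s x =
        tripleMap (shift (Stalk X x.1) (P.bundle.fiber x.1)) (q.chart i (hi x.2)) (t x) := by
  refine ⟨_, (q.isSection_iff hi s).1 hs, fun x => ?_⟩
  rw [tripleMap_chart, change_cancel]

/-- In a fixed trivialization the connection is expressed by ∇, A_i and B_i, each of which takes
sections to sections. -/
theorem isPoleValued_chart (i : X) {V : Opens X} (hi : V ≤ U.nhd i)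
    {s : ∀ x : V, P.bundle.fiber x.1} (hs : P.bundle.sheaf.pred s) :
    IsPoleValued k D q.bundle fun x : V => (q.nabla x.1).toFun (q.chart i (hi x.2) (s x)) := by
  have hA : IsPoleValued k D P.bundle fun x : V => z.1.2.single i (hi x.2) (s x) :=
    z.2.1.2 ![i] V (hi.trans (U.nhd_le_inter i)) s hs
  have hB : IsPoleValued k D P.bundle fun x : V => q.w.2.single i (hi x.2) (s x) :=
    q.mem.2 ![i] V (hi.trans (U.nhd_le_inter i)) s hs
  have hc := q.isSheafHom_chart i hi
  have h0 := IsPoleValued.map _ hc (P.nabla_section V s hs)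
  have h1 := IsPoleValued.map _ (isSheafHom_eps.comp hc) hA
  have h2 := IsPoleValued.map _ (isSheafHom_eps.comp (isSheafHom_eps.comp hc)) hB
  have h3 := LocallySum.add (isPoleValued_restricts q.bundle)
    (LocallySum.add (isPoleValued_restricts q.bundle) h0 h1) h2
  have e : (fun x : V => (q.nabla x.1).toFun (q.chart i (hi x.2) (s x))) = fun x : V =>
      LinearMap.rTensor (PoleForms k (D.ideal x.1)) (q.chart i (hi x.2)) ((P.nabla x.1).toFun (s x)) +
      LinearMap.rTensor (PoleForms k (D.ideal x.1)) (shift (Stalk X x.1) (P.bundle.fiber x.1) ∘ₗ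
        q.chart i (hi x.2)) (z.1.2.single i (hi x.2) (s x)) +
      LinearMap.rTensor (PoleForms k (D.ideal x.1)) (shift (Stalk X x.1) (P.bundle.fiber x.1) ∘ₗ
        shift (Stalk X x.1) (P.bundle.fiber x.1) ∘ₗ q.chart i (hi x.2))
        (q.w.2.single i (hi x.2) (s x)) := by
    funext x
    exact q.represents_chart i (hi x.2) (s x)
  rw [e]
  exact h3

theorem nabla_shift (x : X) (m : P.bundle.fiber x × P.bundle.fiber x × P.bundle.fiber x) :
    (q.nabla x).toFun (shift (Stalk X x) (P.bundle.fiber x) m) =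
      LinearMap.rTensor (PoleForms k (D.ideal x)) (shift (Stalk X x) (P.bundle.fiber x))
        ((q.nabla x).toFun m) := tripleConnection_shift _ _ _ m

/-- Commutation with ε reduces a general section s₀ + εs₁ + ε²s₂ to its three coefficients. -/
theorem isPoleValued_nabla_of_le {i : X} {V : Opens X} (hi : V ≤ U.nhd i)
    {s : ∀ x : V, P.bundle.fiber x.1 × P.bundle.fiber x.1 × P.bundle.fiber x.1}
    (hs : q.IsSection s) :
    IsPoleValued k D q.bundle fun x : V => (q.nabla x.1).toFun (s x) := by
  obtain ⟨t, ⟨ht0, ht1, ht2⟩, hst⟩ := q.exists_coordinates hi hs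
  have h0 := q.isPoleValued_chart i hi ht0
  have h1 := IsPoleValued.map _ (isSheafHom_eps (F := q.bundle)) (q.isPoleValued_chart i hi ht1)
  have h2 := IsPoleValued.map _ (isSheafHom_eps (F := q.bundle))
    (IsPoleValued.map _ (isSheafHom_eps (F := q.bundle)) (q.isPoleValued_chart i hi ht2))
  have h3 := LocallySum.add (isPoleValued_restricts q.bundle) h0
    (LocallySum.add (isPoleValued_restricts q.bundle) h1 h2)
  have e : (fun x : V => (q.nabla x.1).toFun (s x)) = fun x : V =>
      (q.nabla x.1).toFun (q.chart i (hi x.2) (t x).1) +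
      (LinearMap.rTensor (PoleForms k (D.ideal x.1)) (shift (Stalk X x.1) (P.bundle.fiber x.1))
        ((q.nabla x.1).toFun (q.chart i (hi x.2) (t x).2.1)) +
      LinearMap.rTensor (PoleForms k (D.ideal x.1)) (shift (Stalk X x.1) (P.bundle.fiber x.1))
        (LinearMap.rTensor (PoleForms k (D.ideal x.1)) (shift (Stalk X x.1) (P.bundle.fiber x.1))
        ((q.nabla x.1).toFun (q.chart i (hi x.2) (t x).2.2)))) := by
    funext x
    rw [hst x]
    exact tripleConnection_tripleMap _ _ _ _ _
  rw [e]
  exact h3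

theorem isPoleValued_nabla {V : Opens X}
    {s : ∀ x : V, P.bundle.fiber x.1 × P.bundle.fiber x.1 × P.bundle.fiber x.1}
    (hs : q.IsSection s) :
    IsPoleValued k D q.bundle fun x : V => (q.nabla x.1).toFun (s x) := by
  refine LocallySum.of_local fun x => ?_
  exact ⟨V ⊓ U.nhd x.1, inf_le_left, ⟨x.2, U.mem_self x.1⟩,
    q.isPoleValued_nabla_of_le (i := x.1) inf_le_right
      (fun i W h hi => hs i W (h.trans inf_le_left) hi)⟩

/-- The integrable connection glued from `∇ + ε A_i + ε² B_i`. -/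
def connection : IntegrableConnection k D 2 where
  bundle := q.bundle
  nabla x := q.nabla x
  nabla_section _ _ hs := q.isPoleValued_nabla hs
  nabla_eps x m := q.nabla_shift x m
  integrable x m := q.nabla_curvature x m

/-- The reduction modulo `ε²` of the glued bundle, in the trivialization `σ`. -/
def reduction (S : DefinedBy ρ z) (x : X) :
    P.bundle.fiber x × P.bundle.fiber x × P.bundle.fiber x →ₗ[Stalk X x] P1.bundle.fiber x :=
  (S.σ x ⟨x, U.mem_self x⟩).coprod
    ((P1.bundle.eps x ∘ₗ S.σ x ⟨x, U.mem_self x⟩) ∘ₗ LinearMap.fst _ _ _)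

theorem reduction_apply (S : DefinedBy ρ z) (x : X)
    (m : P.bundle.fiber x × P.bundle.fiber x × P.bundle.fiber x) :
    reduction S x m = S.σ x ⟨x, U.mem_self x⟩ m.1 +
      P1.bundle.eps x (S.σ x ⟨x, U.mem_self x⟩ m.2.1) := rfl

theorem eps_eps (x : X) (v : P1.bundle.fiber x) : P1.bundle.eps x (P1.bundle.eps x v) = 0 :=
  DFunLike.congr_fun (P1.bundle.eps_pow x) v

theorem σ_pair (S : DefinedBy ρ z) {i j x : X} (hi : x ∈ U.nhd i) (hj : x ∈ U.nhd j)
    (m : P.bundle.fiber x) : S.σ j ⟨x, hj⟩ m = S.σ i ⟨x, hi⟩ m +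
      P1.bundle.eps x (S.σ i ⟨x, hi⟩ (z.1.1.pair i j hi hj m)) :=
  S.σ_change ![i, j] ⟨x, U.inf_le_inter i j ⟨hi, hj⟩⟩ m

theorem map_σ_apply (S : DefinedBy ρ z) {i x : X} (hi : x ∈ U.nhd i) (m : P.bundle.fiber x) :
    ρ.map x (S.σ i ⟨x, hi⟩ m) = m := S.map_σ i ⟨x, hi⟩ m

theorem nabla_σ_apply (S : DefinedBy ρ z) {i x : X} (hi : x ∈ U.nhd i) (m : P.bundle.fiber x) :
    (P1.nabla x).toFun (S.σ i ⟨x, hi⟩ m) =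
      LinearMap.rTensor (PoleForms k (D.ideal x)) (S.σ i ⟨x, hi⟩) ((P.nabla x).toFun m) +
      LinearMap.rTensor (PoleForms k (D.ideal x)) (P1.bundle.eps x ∘ₗ S.σ i ⟨x, hi⟩)
        (z.1.2.single i hi m) :=
  S.nabla_σ ![i] ⟨x, U.nhd_le_inter i hi⟩ m

theorem reduction_shift (S : DefinedBy ρ z) (x : X)
    (m : P.bundle.fiber x × P.bundle.fiber x × P.bundle.fiber x) :
    reduction S x (shift (Stalk X x) (P.bundle.fiber x) m) =
      P1.bundle.eps x (reduction S x m) := by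
  simp [reduction_apply, eps_eps]

/-- Modulo ε² only 1 + εa_xi survives of the change of trivialization, and it carries σ_x to σ_i. So
the pointwise reductions agree with σ_i over a whole member of the covering. -/
theorem reduction_chart (S : DefinedBy ρ z) {i x : X} (hi : x ∈ U.nhd i) (m : P.bundle.fiber x) :
    reduction S x (q.chart i hi m) = S.σ i ⟨x, hi⟩ m := by
  rw [σ_pair S (U.mem_self x) hi]
  rfl

theorem reduction_section (S : DefinedBy ρ z) {V : Opens X}
    {s : ∀ x : V, P.bundle.fiber x.1 × P.bundle.fiber x.1 × P.bundle.fiber x.1}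
    (hs : q.IsSection s) : P1.bundle.sheaf.pred fun x : V => reduction S x.1 (s x) := by
  refine P1.bundle.of_local fun x => ?_
  refine ⟨V ⊓ U.nhd x.1, inf_le_left, ⟨x.2, U.mem_self x.1⟩, ?_⟩
  have hs' : q.IsSection fun y : (V ⊓ U.nhd x.1 : Opens X) => s ⟨y.1, y.2.1⟩ :=
    fun i W h hi => hs i W (h.trans inf_le_left) hi
  obtain ⟨t, ⟨ht0, ht1, -⟩, hst⟩ := q.exists_coordinates inf_le_right hs'
  have e : ∀ y : (V ⊓ U.nhd x.1 : Opens X), reduction S y.1 (s ⟨y.1, y.2.1⟩) =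
      S.σ x.1 ⟨y.1, y.2.2⟩ (t y).1 + P1.bundle.eps y.1 (S.σ x.1 ⟨y.1, y.2.2⟩ (t y).2.1) :=
    fun y => by
    rw [hst y, tripleMap_apply, map_add, map_add, reduction_shift, reduction_shift, reduction_shift,
      eps_eps, add_zero, reduction_chart, reduction_chart]
  simp only [e]
  exact P1.bundle.add_pred (S.σ_section x.1 _ inf_le_right _ ht0)
    (P1.bundle.eps_pred (S.σ_section x.1 _ inf_le_right _ ht1))

theorem reduction_surjective (S : DefinedBy ρ z) (x : X) :
    Function.Surjective (reduction S x) := by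
  intro v
  have hσ : ∀ m, ρ.map x (S.σ x ⟨x, U.mem_self x⟩ m) = m := map_σ_apply S (U.mem_self x)
  obtain ⟨m₀, v, rfl⟩ := ρ.exists_decomposition hσ v
  obtain ⟨m₁, v, rfl⟩ := ρ.exists_decomposition hσ v
  exact ⟨(m₀, m₁, 0), by simp [reduction_apply, eps_eps]⟩

/-- If σm₀ + εσm₁ = 0, applying ρ gives m₀ = 0. Then ε kills σm₁, so `map_eq_zero_of_eps` gives m₁ =
0, and only the ε²-coordinate remains. -/
theorem ker_reduction (S : DefinedBy ρ z) (x : X) : LinearMap.ker (reduction S x) =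
    LinearMap.range (shift (Stalk X x) (P.bundle.fiber x) ^ (1 + 1)) := by
  have hσ : ∀ m, ρ.map x (S.σ x ⟨x, U.mem_self x⟩ m) = m := map_σ_apply S (U.mem_self x)
  ext m
  constructor
  · intro h
    obtain ⟨m₀, m₁, m₂⟩ := m
    rw [LinearMap.mem_ker, reduction_apply] at h
    have e0 : m₀ = 0 := by
      simpa [hσ, ρ.map_eps_eq_zero] using congrArg (ρ.map x) h
    subst e0
    rw [map_zero, zero_add] at h
    have e1 : m₁ = 0 := by
      simpa [hσ] using ρ.map_eq_zero_of_eps h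
    subst e1
    exact ⟨(m₂, 0, 0), by simp [pow_succ]⟩
  · rintro ⟨m, rfl⟩
    simp [pow_succ, reduction_apply]

/-- The form B_x occurs only with ε² and disappears, leaving ∇ + εA_x, which is ∇₁ in the
trivialization σ_x. -/
theorem reduction_nabla (S : DefinedBy ρ z) (x : X)
    (m : P.bundle.fiber x × P.bundle.fiber x × P.bundle.fiber x) :
    (P1.nabla x).toFun (reduction S x m) =
      LinearMap.rTensor (PoleForms k (D.ideal x)) (reduction S x) ((q.nabla x).toFun m) := by
  have e0 : reduction S x ∘ₗ LinearMap.inl _ _ _ = S.σ x ⟨x, U.mem_self x⟩ := by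
    ext m; simp [reduction_apply]
  have e1 : reduction S x ∘ₗ shift (Stalk X x) (P.bundle.fiber x) ∘ₗ LinearMap.inl _ _ _ =
      P1.bundle.eps x ∘ₗ S.σ x ⟨x, U.mem_self x⟩ := by
    ext m; simp [reduction_apply]
  have e2 : reduction S x ∘ₗ shift (Stalk X x) (P.bundle.fiber x) ∘ₗ
      shift (Stalk X x) (P.bundle.fiber x) ∘ₗ LinearMap.inl _ _ _ = 0 := by
    ext m; simp [reduction_apply]
  have e3 : P1.bundle.eps x ∘ₗ P1.bundle.eps x ∘ₗ S.σ x ⟨x, U.mem_self x⟩ = 0 :=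
    LinearMap.ext fun m => eps_eps x _
  rw [nabla, tripleConnection_apply, map_add, map_add]
  simp only [← LinearMap.rTensor_comp_apply]
  rw [e0, e1, e2, reduction_apply, map_add, P1.nabla_eps, nabla_σ_apply, nabla_σ_apply]
  simp only [map_add, ← LinearMap.rTensor_comp_apply, e3, LinearMap.rTensor_zero,
    LinearMap.zero_apply, add_zero]
  abel

/-- The glued connection extends the first order deformation. -/
def restriction (S : DefinedBy ρ z) : Restriction q.connection P1 where
  map x := reduction S x
  map_section _ _ hs := q.reduction_section S hs
  map_eps x m := reduction_shift S x m
  surjective x := reduction_surjective S x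
  ker_map x := ker_reduction S x
  map_nabla x m := q.reduction_nabla S x m

end SquarePrimitive

/-- Vanishing in the direct limit gives a primitive only on a finer covering; since the
trivializations of ℰ₁ restrict to it, the gluing can be carried out there. -/
theorem exists_restriction_of_yoneda_eq_zero (S : DefinedBy ρ z)
    (h : yonedaProduct P (hyperOneClass P U z) (hyperOneClass P U z) = 0) :
    ∃ P2 : IntegrableConnection k D 2, Nonempty (Restriction P2 P1) := by
  rw [yoneda_hyperOneClass, hyperTwoClass_eq_zero] at h
  obtain ⟨V, hV, w, hw, e⟩ := h
  -- The degree-two terms must be a primitive of minus the square, hence the sign in front of `w`.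
  let q : SquarePrimitive (cocyclesOneRestrict P hV z) :=
    ⟨-w, neg_mem hw, (map_neg _ _).trans (congrArg Neg.neg e)⟩
  exact ⟨q.connection, ⟨q.restriction (S.restrict hV)⟩⟩

end Extension

end DeRham

end

theorem mainTheorem10 {k : Type u} [Field k] [IsAlgClosed k] (X : LocallyRingedSpace.{u})
    [SpaceOver k X] (hX : IsAlgebraicScheme k X ∨ IsComplexSpace k X)
    (D : EffectiveCartierDivisor X) (P : IntegrableConnection k D 0)
    (P1 : IntegrableConnection k D 1) (ρ : Restriction P1 P)
    (U : Covering X) (z : cocyclesOne P U) (hz : Nonempty (DefinedBy ρ z)) :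
    (∃ P2 : IntegrableConnection k D 2, Nonempty (Restriction P2 P1)) ↔
      yonedaProduct P (hyperOneClass P U z) (hyperOneClass P U z) = 0 := by
  obtain ⟨S⟩ := hz
  exact ⟨fun ⟨_, ⟨π⟩⟩ => yoneda_eq_zero_of_restriction S π, exists_restriction_of_yoneda_eq_zero S⟩
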